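/- **Setting.** For integers $n,k\ge 0$ let $\Delta_{n,k}=\{\mathbf x\in[0,1]^n:\ \|\mathbf x\|_1\le k\}$, and let $[d]$ denote a set of $d$ indices. A random map $\mathcal A:\Delta_{n,k}\to 2^{[n]}$ is an *$\alpha$-stretch correlated sampling algorithm for $\Delta_{n,k}$* if for all $\mathbf x,\mathbf y\in\Delta_{n,k}$: (i) $|\mathcal A(\mathbf x)|\in\{\lfloor\|\mathbf x\|_1\rfloor,\lceil\|\mathbf x\|_1\rceil\}$ almost surely; (ii) $\Pr[i\in\mathcal A(\mathbf x)]=x_i$ for all $i\in[n]$; (iii) $\mathbb E\,|\mathcal A(\mathbf x)\oplus\mathcal A(\mathbf y)|\le\alpha\|\mathbf x-\mathbf y\|_1$, where $\oplus$ is the symmetric difference. Logarithms are to base two. **Subroutines.** *Exponential clocks* $\mathcal A_1$ for probability vectors $\mathbf v\in\mathbb R^n$: draw i.i.d. $E_i\sim\mathrm{Exp}(1)$ once; on input $\mathbf v$ output $\{\arg\min_{i:\,v_i>0}E_i/v_i\}$. *Coordinate tree rounding* $\mathcal A_k$ for $\Delta_{d,k}$: take the balanced full binary tree with the $d$ coordinates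 at its leaves, and draw once independent thresholds uniform on $[0,1]$, one for every non-leaf node and an additional one, $\theta_r$, for the root. On input $\hat{\mathbf x}$, every leaf $i$ sends $(i,\hat x_i)$ to its parent. A non-leaf node with threshold $\theta$ that receives $(i,a)$ and $(j,b)$ acts as follows. If $a+b\le1$: when $\theta\le a/(a+b)$ it fixes $j$ to $0$ and sends $(i,a+b)$ to its parent, otherwise it fixes $i$ to $0$ and sends $(j,a+b)$. If $a+b>1$: when $\theta\le(1-b)/(2-a-b)$ it fixes $i$ to $1$ and sends $(j,a+b-1)$, otherwise it fixes $j$ to $1$ and sends $(i,a+b-1)$. The coordinate remaining at the end, with marginal $\gamma$, is fixed to $1$ if $\theta_r\le\gamma$ and to $0$ otherwise. The output is the set of coordinates fixed to $1$. **The algorithm $ALG$.** Let $\mathcal A$ be an $\alpha$-stretch correlated sampling algorithm for $\Delta_{n,k}$, and let $m=2^5k^5\alpha^5$ (rounded up if this is not an integer). *Initialization* (shared by all inputs; all draws independent): draw the randomness of $\mathcal A$, of $\mathcal A_1$ in dimension $n$, and of $\mathcal A_k$ in dimension $m^3$; for each bucket $b\in[m]$ draw $R_b\sim\mathrm{Uni}[m^3]$;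 for each $i\in[n]$ draw $C_i\sim\mathrm{Uni}[m^3]$ and put $i$ into the set $\mathcal B_b$ for a uniformly random $b\in[m]$; draw $\sigma,\tau\sim\mathrm{Uni}[0,1/10]$. *On input $\mathbf x\in\Delta_{n,k}$:* 1. Let $S=\{i:0<x_i\le1/10+\sigma\}$, $L=\{i:x_i>1/10+\sigma\}$, $S_b=S\cap\mathcal B_b$ and $s_b=\sum_{i\in S_b}x_i$. 2. If some $h\in[m^3]$ has $|\{i\in L:C_i=h\}|+|\{b:R_b=h\}|>1$ (a hash collision), or if $s_b>1-\tau$ for some $b$ (a heavy bucket), return $\mathcal A(\mathbf x)$. 3. Otherwise, for every $b$ with $s_b>0$ let $REP_b=\mathcal A_1\big((x_i\mathbf 1[i\in S_b]/s_b)_{i\in[n]}\big)$, and set $x_i\gets s_b\cdot\mathbf 1[i\in REP_b]$ for all $i\in S_b$. For the other $b$ let $REP_b=\emptyset$. 4. Let $\hat{\mathbf x}\in\mathbb R^{m^3}$ be the vector into which the non-zero entries of the modified $\mathbf x$ are copied, $x_i$ going to coordinate $R_b$ if $i\in REP_b$ for some $b$ and to coordinate $C_i$ otherwise; its other entries are $0$.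 5. Let $T=\mathcal A_k(\hat{\mathbf x})$ and return $\{i\in L:C_i\in T\}\cup\bigcup_{b:\,R_b\in T}REP_b$. **Theorem.** There is an absolute constant $c>0$ such that the following holds for all $n$, all $k$ and $\alpha$ with $k\alpha\ge2$ (in particular for all $k,\alpha\ge2$), and every $\alpha$-stretch correlated sampling algorithm $\mathcal A$ for $\Delta_{n,k}$. For all $\mathbf x,\mathbf y\in\Delta_{n,k}$, the sets $X=ALG(\mathbf x)$ and $Y=ALG(\mathbf y)$, computed with the same initialization, satisfy $$\mathbb E\,|X\oplus Y|\ \le\ c\,(\log k+\log\alpha)\,\|\mathbf x-\mathbf y\|_1 .$$ -/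

import Mathlib

open MeasureTheory ProbabilityTheory

noncomputable section

namespace CorrelatedSampling

/-- The `ℓ₁` norm on `ℝⁿ`. -/
def l1 {n : ℕ} (x : Fin n → ℝ) : ℝ := ∑ i, |x i|

/-- The polytope `Δ_{n,k} = {x ∈ [0,1]ⁿ : ‖x‖₁ ≤ k}`. -/
def hypersimplex (n k : ℕ) : Set (Fin n → ℝ) :=
  {x | (∀ i, x i ∈ Set.Icc (0 : ℝ) 1) ∧ l1 x ≤ k}

/-- `A : Ω → (deterministic algorithms)`, with `Ω` carrying the probability measure `μ`, is an
`α`-stretch correlated sampling algorithm for `Δ_{n,k}`. Only the values of `A ω` on `Δ_{n,k}`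
matter. -/
structure IsCorrelatedSampling {Ω : Type*} [MeasurableSpace Ω] (μ : Measure Ω) (n k : ℕ) (α : ℝ)
    (A : Ω → (Fin n → ℝ) → Finset (Fin n)) : Prop where
  /-- the output on each input is a random variable -/
  measurable : ∀ x ∈ hypersimplex n k, ∀ S : Finset (Fin n), MeasurableSet {ω | A ω x = S}
  cardinality : ∀ x ∈ hypersimplex n k, ∀ᵐ ω ∂μ,
    (A ω x).card = ⌊l1 x⌋₊ ∨ (A ω x).card = ⌈l1 x⌉₊
  marginals : ∀ x ∈ hypersimplex n k, ∀ i, μ.real {ω | i ∈ A ω x} = x i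
  stretch : ∀ x ∈ hypersimplex n k, ∀ y ∈ hypersimplex n k,
    ∫ ω, ((symmDiff (A ω x) (A ω y)).card : ℝ) ∂μ ≤ α * l1 (x - y)

/-- The uniform distribution on the interval `[a, b]`. -/
def unif (a b : ℝ) : Measure ℝ := cond volume (Set.Icc a b)

/-- The uniform distribution on `{0, …, d - 1}`. -/
def unifFin (d : ℕ) : Measure (Fin d) := uniformOn Set.univ

/-! ### Exponential clocks: the algorithm for the probability simplex -/

/-- The law of the clocks: i.i.d. `Exp(1)`. -/
def clockLaw (n : ℕ) : Measure (Fin n → ℝ) := Measure.pi fun _ => expMeasure 1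

/-- Output `argmin_i E i / v i` over the coordinates with `v i > 0` (where `v i = 0` the quotient
is `+∞`). Ties, which have probability zero, are broken in favour of the smallest index. -/
def expClocks {n : ℕ} (E v : Fin n → ℝ) : Finset (Fin n) :=
  open Classical in
  {i | 0 < v i ∧ ∀ j, 0 < v j → E i / v i < E j / v j ∨ (E i / v i = E j / v j ∧ i ≤ j)}

/-! ### Coordinate tree rounding: the algorithm for the hypersimplex -/

/-- Full binary trees with coordinates at the leaves. -/
inductive CoordTree : Type
  | leaf (i : ℕ) : CoordTree
  | node (l r : CoordTree) : CoordTree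

/-- The balanced tree with leaves `a, a + 1, …, a + len - 1` (for `len ≥ 1`), which has height
`⌈log₂ len⌉`. -/
def balancedTree (a len : ℕ) : CoordTree :=
  if len ≤ 1 then .leaf a
  else .node (balancedTree a (len / 2)) (balancedTree (a + len / 2) (len - len / 2))
termination_by len
decreasing_by all_goals omega

/-- One real threshold for every non-leaf node. -/
def CoordTree.Seed : CoordTree → Type
  | .leaf _ => Unit
  | .node l r => l.Seed × r.Seed × ℝ

instance CoordTree.instMeasurableSpaceSeed : (T : CoordTree) → MeasurableSpace T.Seed
  | .leaf _ => (inferInstance : MeasurableSpace Unit)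
  | .node l r =>
    letI := instMeasurableSpaceSeed l
    letI := instMeasurableSpaceSeed r
    (inferInstance : MeasurableSpace (l.Seed × r.Seed × ℝ))

/-- The thresholds of the nodes are independent and uniform on `[0,1]`. -/
def CoordTree.seedLaw : (T : CoordTree) → Measure T.Seed
  | .leaf _ => (Measure.dirac () : Measure Unit)
  | .node l r => (l.seedLaw.prod (r.seedLaw.prod (unif 0 1)) : Measure (l.Seed × r.Seed × ℝ))

/-- State sent by a tree node to its parent: its only coordinate that is not fixed yet, the current
marginal of that coordinate, and the set of the coordinates below the node fixed to `1` so far (the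
remaining coordinates below the node are fixed to `0`). -/
structure NodeState where
  coord : ℕ
  marginal : ℝ
  ones : Finset ℕ

/-- Combine the two children of a node, using the threshold `θ` of the node. One of the two
coordinates is fixed, to `0` if the marginals sum to at most `1` and to `1` otherwise. -/
def resolve (p q : NodeState) (θ : ℝ) : NodeState :=
  let α := p.marginal
  let β := q.marginal
  if α + β ≤ 1 then
    if θ ≤ α / (α + β) then ⟨p.coord, α + β, p.ones ∪ q.ones⟩
    else ⟨q.coord, α + β, p.ones ∪ q.ones⟩
  else
    if θ ≤ (1 - β) / (2 - α - β) then ⟨q.coord, α + β - 1, insert p.coord (p.ones ∪ q.ones)⟩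
    else ⟨p.coord, α + β - 1, insert q.coord (p.ones ∪ q.ones)⟩

/-- Run the rounding bottom-up on the marginals `x`. -/
def CoordTree.process (x : ℕ → ℝ) : (T : CoordTree) → T.Seed → NodeState
  | .leaf i, _ => ⟨i, x i, ∅⟩
  | .node l r, (ωl, ωr, θ) => resolve (l.process x ωl) (r.process x ωr) θ

/-- The seed of coordinate tree rounding in dimension `d`: the thresholds of the nodes of the
balanced tree, and an additional threshold for the root. -/
abbrev TreeSeed (d : ℕ) : Type := (balancedTree 0 d).Seed × ℝ

def treeLaw (d : ℕ) : Measure (TreeSeed d) := (balancedTree 0 d).seedLaw.prod (unif 0 1)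

/-- Coordinate tree rounding of `x ∈ ℝᵈ`, for `d ≥ 1`: after the bottom-up pass the remaining
coordinate, with marginal `γ`, is rounded to `1` if the additional threshold is at most `γ` and to
`0` otherwise. -/
def treeRounding {d : ℕ} (ω : TreeSeed d) (x : Fin d → ℝ) : Finset (Fin d) :=
  let s := (balancedTree 0 d).process (fun i => if h : i < d then x ⟨i, h⟩ else 0) ω.1
  let ones := if ω.2 ≤ s.marginal then insert s.coord s.ones else s.ones
  {h | (h : ℕ) ∈ ones}

/-! ### One level of the hashing/compression construction -/

/-- The random choices of the initialization other than the seeds of the subroutines. -/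
structure Hashing (n m : ℕ) where
  /-- target hash of the small items of a bucket -/
  R : Fin m → Fin (m ^ 3)
  /-- target hash of a coordinate -/
  C : Fin n → Fin (m ^ 3)
  /-- bucket of a coordinate -/
  bucket : Fin n → Fin m
  /-- random part of the threshold between small and large items -/
  σ : ℝ
  /-- random part of the threshold for heavy buckets -/
  τ : ℝ

namespace Hashing

variable {n m : ℕ} (H : Hashing n m) (x : Fin n → ℝ)

open Classical in
/-- Coordinates of the non-zero small items. -/
def small : Finset (Fin n) := {i | 0 < x i ∧ x i ≤ 1 / 10 + H.σ}

open Classical in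
/-- Coordinates of the large items. -/
def large : Finset (Fin n) := {i | 1 / 10 + H.σ < x i}

/-- Small items in bucket `b`. -/
def smallIn (b : Fin m) : Finset (Fin n) := {i ∈ H.small x | H.bucket i = b}

/-- Total value of the small items in bucket `b`. -/
def load (b : Fin m) : ℝ := ∑ i ∈ H.smallIn x b, x i

/-- Some value is the target hash of two objects among the large items and the buckets. -/
def Collision : Prop :=
  ∃ h : Fin (m ^ 3),
    1 < ({i ∈ H.large x | H.C i = h} : Finset (Fin n)).card +
      ({b | H.R b = h} : Finset (Fin m)).card

/-- Some bucket is too heavy. -/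
def Heavy : Prop := ∃ b, 1 - H.τ < H.load x b

variable (A₁ : (Fin n → ℝ) → Finset (Fin n))

open Classical in
/-- The representative of the small items in bucket `b` (empty if there are none), drawn with the
probability-simplex algorithm `A₁`. -/
def rep (b : Fin m) : Finset (Fin n) :=
  if 0 < H.load x b then
    A₁ fun i => if i ∈ H.smallIn x b then x i / H.load x b else 0
  else ∅

open Classical in
/-- The vector after compression: the representative of each bucket absorbs the total value of the
small items in the bucket, and the other small items are reset to zero. -/
def compressed (i : Fin n) : ℝ :=
  if i ∈ H.small x then
    if i ∈ H.rep x A₁ (H.bucket i) then H.load x (H.bucket i) else 0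
  else x i

open Classical in
/-- The coordinate of `[m³]` to which `i` is mapped. -/
def target (i : Fin n) : Fin (m ^ 3) :=
  if i ∈ H.rep x A₁ (H.bucket i) then H.R (H.bucket i) else H.C i

/-- The compressed vector, moved to `ℝ^(m³)`. When there is no collision, different `i` with
non-zero value have different targets, so that each sum has at most one non-zero term. -/
def xhat (h : Fin (m ^ 3)) : ℝ := ∑ i with H.target x A₁ i = h, H.compressed x A₁ i

open Classical in
/-- The output on input `x`, where `A`, `A₁` and `Aₖ` are the three subroutines (with their
randomness already fixed): on a hash collision or a heavy bucket fall back on `A`, otherwise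
compress, round in dimension `m³`, and map back. -/
def round (A : (Fin n → ℝ) → Finset (Fin n))
    (Aₖ : (Fin (m ^ 3) → ℝ) → Finset (Fin (m ^ 3))) : Finset (Fin n) :=
  if H.Collision x ∨ H.Heavy x then A x
  else
    let T := Aₖ (H.xhat x A₁)
    {i ∈ H.large x | H.C i ∈ T} ∪ ({b | H.R b ∈ T} : Finset (Fin m)).biUnion (H.rep x A₁)

end Hashing

/-- The number of buckets, `m = 2⁵ k⁵ α⁵` (rounded up if this is not an integer). -/
def numBuckets (k : ℕ) (α : ℝ) : ℕ := ⌈(2 : ℝ) ^ 5 * (k : ℝ) ^ 5 * α ^ 5⌉₊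

/-- The seed of the construction: the seed in `Ω` of the fallback algorithm, the seeds of the
exponential clocks and of coordinate tree rounding in dimension `m³`, and `R`, `C`, the buckets,
`σ` and `τ`. -/
abbrev AlgSeed (Ω : Type*) (n m : ℕ) : Type _ :=
  Ω × (Fin n → ℝ) × TreeSeed (m ^ 3) ×
    (Fin m → Fin (m ^ 3)) × (Fin n → Fin (m ^ 3)) × (Fin n → Fin m) × ℝ × ℝ

/-- All the components of the seed are independent. -/
def algLaw {Ω : Type*} [MeasurableSpace Ω] (μ : Measure Ω) (n m : ℕ) : Measure (AlgSeed Ω n m) :=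
  μ.prod <| (clockLaw n).prod <| (treeLaw (m ^ 3)).prod <|
    (Measure.pi fun _ : Fin m => unifFin (m ^ 3)).prod <|
    (Measure.pi fun _ : Fin n => unifFin (m ^ 3)).prod <|
    (Measure.pi fun _ : Fin n => unifFin m).prod <|
    (unif 0 (1 / 10)).prod (unif 0 (1 / 10))

/-- The algorithm (one level of the construction) with `m` buckets and fallback algorithm `A`. -/
def alg {Ω : Type*} {n m : ℕ} (A : Ω → (Fin n → ℝ) → Finset (Fin n)) :
    AlgSeed Ω n m → (Fin n → ℝ) → Finset (Fin n) :=
  fun (ω, E, ωₖ, R, C, bucket, σ, τ) x =>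
    Hashing.round ⟨R, C, bucket, σ, τ⟩ x (expClocks E) (A ω) (treeRounding ωₖ)

end CorrelatedSampling

end

open CorrelatedSampling

noncomputable section

namespace CorrelatedSampling

/-! ### Uniform distributions on intervals -/

/-! A path from `x` to `y` that changes one coordinate at a time (`le_ofReal_l1`) reduces the claim
to inputs where `y` is `x` with ε added to coordinate `i`. For such a pair the expected difference
is shown to be O(log(kα))·ε in `lintegral_alg_le_of_step`.

Tree rounding in dimension d has stretch 1 + 4⌈log₂ d⌉. The node threshold and the bit threshold of
the coordinate sent upward together define one bit for each child (`resolve_out`), and these bits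
have exactly the marginals of the children as probabilities. If one entry grows by ε, every marginal
on the path to the root moves by ε modulo 1, and all others stay fixed. At a node on the path, the
sibling's bit changes with probability at most 2ε. The bits of the path child for the two inputs are
within ε of monotone coupling, so replacing the common-threshold coupling by this one costs at most
2ε. Each level thus adds 4ε (`CoordTree.shift_and_cost_le`).

Compression is cheap because the compressed vector does not depend on which representative won its
bucket (`xhat_eq`). The tree therefore sees an input at ℓ₁-distance ε that is independent of the
clocks. Adding ε to a weight in a bucket of new load s changes the winner with probability at most
ε/s (`clockLaw_expClocks_ne_le`), and this is visible only if the bucket is selected, which has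
probability at most s. The product is at most ε, so a step that meets no failure and leaves the
split into small and large items unchanged costs `treeStretch (m ^ 3) * ε + 2 * ε`
(`Hashing.cost_le_of_not_cross`).

The exceptional events are controlled by σ, τ and m. An item crosses the small/large threshold only
if σ lies in an interval of length ε, which has probability at most 10ε; the cost is then O(log m),
or at most 2k if a failure occurs as well. Without crossing, only the heaviness of a bucket can
change the failure status, and this requires both τ in an interval of length ε and the event
`heavySet`; the cost is then at most 2k. If both inputs fail, the fallback pays αε. Failures have
probability O(k²/m), by a union bound for collisions and Markov's inequality for heavy buckets, and
their bounds do not involve σ or τ, so the probabilities multiply. Since m ≥ 32k⁵α⁵, and α ≥ 1 as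
soon as a nonzero input exists, these terms add only O(ε). Finally log m = O(log(kα)). -/

lemma isProbabilityMeasure_unif {a b : ℝ} (h : a < b) : IsProbabilityMeasure (unif a b) := by
  unfold unif
  refine cond_isProbabilityMeasure_of_finite ?_ ?_ <;> simp [h]

instance : IsProbabilityMeasure (unif 0 1) := isProbabilityMeasure_unif one_pos

instance : IsProbabilityMeasure (unif 0 (1 / 10)) := isProbabilityMeasure_unif (by norm_num)

lemma unif_apply_le {a b : ℝ} (s : Set ℝ) :
    unif a b s ≤ (ENNReal.ofReal (b - a))⁻¹ * volume s := by
  rw [unif, cond_apply measurableSet_Icc, Real.volume_Icc]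
  gcongr
  exact Set.inter_subset_right

lemma unif_zero_one_apply (s : Set ℝ) : unif 0 1 s = volume (Set.Icc 0 1 ∩ s) := by
  rw [unif, cond_apply measurableSet_Icc]
  simp

lemma unif_real_Iic {t : ℝ} (h0 : 0 ≤ t) (h1 : t ≤ 1) : (unif 0 1).real (Set.Iic t) = t := by
  have : Set.Icc (0 : ℝ) 1 ∩ Set.Iic t = Set.Icc 0 t := by
    ext u; simp only [Set.mem_inter_iff, Set.mem_Icc, Set.mem_Iic]
    exact ⟨fun h => ⟨h.1.1, h.2⟩, fun h => ⟨⟨h.1, h.2.trans h1⟩, h.2⟩⟩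
  simp [Measure.real, unif_zero_one_apply, this, h0]

lemma unif_real_Ioi {t : ℝ} (h0 : 0 ≤ t) (h1 : t ≤ 1) : (unif 0 1).real (Set.Ioi t) = 1 - t := by
  rw [← Set.compl_Iic, probReal_compl_eq_one_sub measurableSet_Iic, unif_real_Iic h0 h1]

lemma unif_real_Ioc_le {s t : ℝ} (h : s ≤ t) : (unif 0 1).real (Set.Ioc s t) ≤ t - s := by
  refine ENNReal.toReal_le_of_le_ofReal (by linarith) ((unif_apply_le _).trans ?_)
  simp

/-! ### The two indicator bits at a tree node -/

/-- The marginal sent by a node that receives the marginals `a` and `b`. -/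
def combine (a b : ℝ) : ℝ := if a + b ≤ 1 then a + b else a + b - 1

/-- The pairs `(θ, θr)` for which the left coordinate is fixed to `1`, when the node threshold is
`θ` and the coordinate sent to the parent is rounded with the threshold `θr`. -/
def leftSet (a b : ℝ) : Set (ℝ × ℝ) :=
  {u | if a + b ≤ 1 then u.1 ≤ a / (a + b) ∧ u.2 ≤ a + b
    else u.1 ≤ (1 - b) / (2 - a - b) ∨ u.2 ≤ a + b - 1}

/-- The analogue of `leftSet` for the right coordinate. -/
def rightSet (a b : ℝ) : Set (ℝ × ℝ) :=
  {u | if a + b ≤ 1 then ¬ u.1 ≤ a / (a + b) ∧ u.2 ≤ a + b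
    else ¬ u.1 ≤ (1 - b) / (2 - a - b) ∨ u.2 ≤ a + b - 1}

/-- The law of a pair of independent thresholds. -/
def thresholdLaw : Measure (ℝ × ℝ) := (unif 0 1).prod (unif 0 1)

instance : IsProbabilityMeasure thresholdLaw := by unfold thresholdLaw; infer_instance

lemma thresholdLaw_real_prod (s t : Set ℝ) :
    thresholdLaw.real (s ×ˢ t) = (unif 0 1).real s * (unif 0 1).real t :=
  measureReal_prod_prod s t

lemma leftSet_of_le {a b : ℝ} (h : a + b ≤ 1) :
    leftSet a b = Set.Iic (a / (a + b)) ×ˢ Set.Iic (a + b) := by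
  ext u; simp [leftSet, h, Prod.le_def]

lemma rightSet_of_le {a b : ℝ} (h : a + b ≤ 1) :
    rightSet a b = Set.Ioi (a / (a + b)) ×ˢ Set.Iic (a + b) := by
  ext u; simp [rightSet, h]

lemma leftSet_of_lt {a b : ℝ} (h : 1 < a + b) :
    leftSet a b = (Set.Ioi ((1 - b) / (2 - a - b)) ×ˢ Set.Ioi (a + b - 1))ᶜ := by
  ext u
  simp only [leftSet, h.not_ge, if_false, Set.mem_ofPred_eq, Set.mem_compl_iff, Set.mem_prod,
    Set.mem_Ioi, not_and_or, not_lt]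

lemma rightSet_of_lt {a b : ℝ} (h : 1 < a + b) :
    rightSet a b = (Set.Iic ((1 - b) / (2 - a - b)) ×ˢ Set.Ioi (a + b - 1))ᶜ := by
  ext u
  simp only [rightSet, h.not_ge, if_false, Set.mem_ofPred_eq, Set.mem_compl_iff, Set.mem_prod,
    Set.mem_Ioi, Set.mem_Iic, not_and_or, not_lt]

lemma measurableSet_leftSet (a b : ℝ) : MeasurableSet (leftSet a b) := by
  rcases le_or_gt (a + b) 1 with h | h
  · rw [leftSet_of_le h]; exact measurableSet_Iic.prod measurableSet_Iic
  · rw [leftSet_of_lt h]; exact (measurableSet_Ioi.prod measurableSet_Ioi).compl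

lemma measurableSet_rightSet (a b : ℝ) : MeasurableSet (rightSet a b) := by
  rcases le_or_gt (a + b) 1 with h | h
  · rw [rightSet_of_le h]; exact measurableSet_Ioi.prod measurableSet_Iic
  · rw [rightSet_of_lt h]; exact (measurableSet_Iic.prod measurableSet_Ioi).compl

section bits

variable {a b a' b' ε : ℝ}

lemma combine_mem (ha : a ∈ Set.Icc (0 : ℝ) 1) (hb : b ∈ Set.Icc (0 : ℝ) 1) :
    combine a b ∈ Set.Icc (0 : ℝ) 1 := by
  obtain ⟨ha0, ha1⟩ := ha
  obtain ⟨hb0, hb1⟩ := hb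
  unfold combine
  split_ifs <;> constructor <;> linarith

lemma ratio_le_mem (ha : a ∈ Set.Icc (0 : ℝ) 1) (hb : b ∈ Set.Icc (0 : ℝ) 1) :
    0 ≤ a / (a + b) ∧ a / (a + b) ≤ 1 :=
  ⟨div_nonneg ha.1 (add_nonneg ha.1 hb.1),
    div_le_one_of_le₀ (by linarith [hb.1]) (add_nonneg ha.1 hb.1)⟩

lemma ratio_lt_mem (ha : a ∈ Set.Icc (0 : ℝ) 1) (hb : b ∈ Set.Icc (0 : ℝ) 1) :
    0 ≤ (1 - b) / (2 - a - b) ∧ (1 - b) / (2 - a - b) ≤ 1 :=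
  ⟨div_nonneg (by linarith [hb.2]) (by linarith [hb.2, ha.2]),
    div_le_one_of_le₀ (by linarith [ha.2]) (by linarith [hb.2, ha.2])⟩

/-- The bit threshold cancels the denominator of the ratio: the event has probability a/(a+b)·(a+b)
if a + b ≤ 1, and its complement (1-a)/(2-a-b)·(2-a-b) otherwise. The degenerate denominators occur
only at a = b = 0 and a = b = 1. -/
lemma thresholdLaw_leftSet (ha : a ∈ Set.Icc (0 : ℝ) 1) (hb : b ∈ Set.Icc (0 : ℝ) 1) :
    thresholdLaw.real (leftSet a b) = a := by
  rcases le_or_gt (a + b) 1 with h | h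
  · obtain ⟨h0, h1⟩ := ratio_le_mem ha hb
    rw [leftSet_of_le h, thresholdLaw_real_prod, unif_real_Iic h0 h1,
      unif_real_Iic (add_nonneg ha.1 hb.1) h]
    rcases eq_or_ne (a + b) 0 with h0 | h0
    · rw [h0]; linarith [ha.1, hb.1]
    · field_simp
  · obtain ⟨h0, h1⟩ := ratio_lt_mem ha hb
    rw [leftSet_of_lt h, probReal_compl_eq_one_sub (measurableSet_Ioi.prod measurableSet_Ioi),
      thresholdLaw_real_prod, unif_real_Ioi h0 h1,
      unif_real_Ioi (by linarith) (by linarith [ha.2, hb.2])]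
    rcases eq_or_ne (2 - a - b) 0 with h0 | h0
    · rw [h0]; simp only [div_zero]; linarith [ha.2, hb.2]
    · field_simp; ring

lemma thresholdLaw_rightSet (ha : a ∈ Set.Icc (0 : ℝ) 1) (hb : b ∈ Set.Icc (0 : ℝ) 1) :
    thresholdLaw.real (rightSet a b) = b := by
  rcases le_or_gt (a + b) 1 with h | h
  · obtain ⟨h0, h1⟩ := ratio_le_mem ha hb
    rw [rightSet_of_le h, thresholdLaw_real_prod, unif_real_Ioi h0 h1,
      unif_real_Iic (add_nonneg ha.1 hb.1) h]
    rcases eq_or_ne (a + b) 0 with h0 | h0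
    · rw [h0]; linarith [ha.1, hb.1]
    · field_simp; ring
  · obtain ⟨h0, h1⟩ := ratio_lt_mem ha hb
    rw [rightSet_of_lt h, probReal_compl_eq_one_sub (measurableSet_Iic.prod measurableSet_Ioi),
      thresholdLaw_real_prod, unif_real_Iic h0 h1,
      unif_real_Ioi (by linarith) (by linarith [ha.2, hb.2])]
    rcases eq_or_ne (2 - a - b) 0 with h0 | h0
    · rw [h0]; simp only [div_zero]; linarith [ha.2, hb.2]
    · field_simp; ring

/-- The ratio with which a node compares its threshold. -/
def ratio (a b : ℝ) : ℝ := if a + b ≤ 1 then a / (a + b) else (1 - b) / (2 - a - b)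

/-- On a + b = 1 both formulas equal a, so monotonicity persists when the sum crosses 1. The
excluded case is the one where the larger ratio is 0/0 and evaluates to 0. -/
lemma ratio_mono_left (ha : a ∈ Set.Icc (0 : ℝ) 1) (hb : b ∈ Set.Icc (0 : ℝ) 1)
    (ha' : a' ∈ Set.Icc (0 : ℝ) 1) (h : a ≤ a') (hab : 2 - a' - b ≠ 0) :
    ratio a b ≤ ratio a' b := by
  obtain ⟨ha0, ha1⟩ := ha
  obtain ⟨hb0, hb1⟩ := hb
  obtain ⟨ha0', ha1'⟩ := ha'
  have h2 : 0 < 2 - a' - b := lt_of_le_of_ne (by linarith) hab.symm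
  unfold ratio
  split_ifs with h1 h1'
  · rcases eq_or_ne (a + b) 0 with h0 | h0
    · rw [h0, div_zero]; positivity
    · have : 0 < a + b := lt_of_le_of_ne (by linarith) h0.symm
      rw [div_le_div_iff₀ this (by linarith)]; nlinarith
  · rcases eq_or_ne (a + b) 0 with h0 | h0
    · rw [h0, div_zero]; exact div_nonneg (by linarith) h2.le
    · have : 0 < a + b := lt_of_le_of_ne (by linarith) h0.symm
      rw [div_le_div_iff₀ this h2]
      nlinarith [mul_nonneg ha0 (sub_nonneg.2 ha1'), mul_nonneg hb0 (sub_nonneg.2 h1)]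
  · linarith
  · rw [div_le_div_iff₀ (by linarith) h2]; nlinarith

lemma ratio_anti_right (ha : a ∈ Set.Icc (0 : ℝ) 1) (hb : b ∈ Set.Icc (0 : ℝ) 1)
    (hb' : b' ∈ Set.Icc (0 : ℝ) 1) (h : b ≤ b') (hab : a + b ≠ 0) :
    ratio a b' ≤ ratio a b := by
  obtain ⟨ha0, ha1⟩ := ha
  obtain ⟨hb0, hb1⟩ := hb
  obtain ⟨hb0', hb1'⟩ := hb'
  have h2 : 0 < a + b := lt_of_le_of_ne (by linarith) hab.symm
  unfold ratio
  split_ifs with h1 h1' h1'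
  · rw [div_le_div_iff₀ (by linarith) h2]; nlinarith
  · linarith
  · rcases eq_or_ne (2 - a - b') 0 with h0 | h0
    · rw [h0, div_zero]; positivity
    · have : 0 < 2 - a - b' := lt_of_le_of_ne (by linarith) h0.symm
      rw [div_le_div_iff₀ this h2]
      nlinarith [mul_nonneg ha0 hb0, mul_nonneg hb0 (sub_nonneg.2 hb1')]
  · rcases eq_or_ne (2 - a - b') 0 with h0 | h0
    · rw [h0, div_zero]; exact div_nonneg (by linarith) (by linarith)
    · have : 0 < 2 - a - b' := lt_of_le_of_ne (by linarith) h0.symm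
      rw [div_le_div_iff₀ this (by linarith)]; nlinarith

/-- Both bounds grow with the coordinate's own marginal. When the sum crosses 1 the conjunction
becomes a disjunction, and the bound on the node threshold alone is enough. -/
lemma leftSet_subset (ha : a ∈ Set.Icc (0 : ℝ) 1) (hb : b ∈ Set.Icc (0 : ℝ) 1)
    (ha' : a' ∈ Set.Icc (0 : ℝ) 1) (h : a ≤ a') : leftSet a b ⊆ leftSet a' b := by
  intro u hu
  rcases eq_or_ne (2 - a' - b) 0 with h0 | h0
  · obtain rfl : b = 1 := by linarith [ha'.2, hb.2]
    obtain rfl : a' = 1 := by linarith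
    have : u.1 ≤ 0 ∨ u.2 ≤ 1 := by
      simp only [leftSet, Set.mem_ofPred_eq] at hu
      split_ifs at hu with h1
      · exact Or.inr (hu.2.trans h1)
      · simp only [sub_self, zero_div] at hu
        exact hu.imp id fun h => by linarith [ha.2]
    simp only [leftSet, Set.mem_ofPred_eq]
    norm_num
    exact this
  · have hr := ratio_mono_left ha hb ha' h h0
    simp only [leftSet, ratio, Set.mem_ofPred_eq] at hu hr ⊢
    split_ifs at hu hr ⊢ with h1 h2 h3
    · exact ⟨hu.1.trans hr, by linarith [hu.2]⟩
    · linarith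
    · exact Or.inl (hu.1.trans hr)
    · exact hu.imp (fun h => h.trans hr) fun h => by linarith

lemma rightSet_subset (ha : a ∈ Set.Icc (0 : ℝ) 1) (hb : b ∈ Set.Icc (0 : ℝ) 1)
    (hb' : b' ∈ Set.Icc (0 : ℝ) 1) (h : b ≤ b') : rightSet a b ⊆ rightSet a b' := by
  intro u hu
  rcases eq_or_ne (a + b) 0 with h0 | h0
  · obtain rfl : a = 0 := by linarith [ha.1, hb.1]
    obtain rfl : b = 0 := by linarith
    simp only [rightSet, Set.mem_ofPred_eq] at hu ⊢
    norm_num at hu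
    rw [if_pos (by linarith [hb'.2])]
    norm_num
    exact ⟨hu.1, hu.2.trans h⟩
  · have hr := ratio_anti_right ha hb hb' h h0
    simp only [rightSet, ratio, Set.mem_ofPred_eq] at hu hr ⊢
    split_ifs at hu hr ⊢ with h1 h2 h3
    · exact ⟨fun h => hu.1 (h.trans hr), by linarith [hu.2]⟩
    · linarith
    · exact Or.inl fun h => hu.1 (h.trans hr)
    · exact hu.imp (fun h h' => h (h'.trans hr)) fun h => by linarith

lemma thresholdLaw_Ioc_prod_le {p q w δ : ℝ} {s : Set ℝ} (hs : (unif 0 1).real s ≤ w) (hδ : 0 ≤ δ)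
    (h : (q - p) * w ≤ δ) : thresholdLaw.real (Set.Ioc p q ×ˢ s) ≤ δ := by
  rw [thresholdLaw_real_prod]
  rcases le_or_gt q p with hpq | hpq
  · rw [Set.Ioc_eq_empty hpq.not_gt]; simpa
  · exact (mul_le_mul (unif_real_Ioc_le hpq.le) hs measureReal_nonneg (by linarith)).trans h

lemma ratio_mul_of_le (ha : a ∈ Set.Icc (0 : ℝ) 1) (hb : b ∈ Set.Icc (0 : ℝ) 1) :
    a / (a + b) * (a + b) = a := by
  rcases eq_or_ne (a + b) 0 with h0 | h0
  · rw [h0]; linarith [ha.1, hb.1]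
  · field_simp

lemma ratio_mul_of_lt (ha : a ∈ Set.Icc (0 : ℝ) 1) (hb : b ∈ Set.Icc (0 : ℝ) 1) :
    (1 - b) / (2 - a - b) * (2 - a - b) = 1 - b := by
  rcases eq_or_ne (2 - a - b) 0 with h0 | h0
  · rw [h0]; linarith [ha.2, hb.2]
  · field_simp

/-- The threshold pairs lost by the right coordinate lie in a rectangle, with node thresholds
between the two ratios and bit thresholds in a second interval. The gap between the ratios need not
be O(a' - a) when a + b is small; the length of the second side compensates, as one sees by clearing
the denominators. -/
lemma thresholdLaw_rightSet_diff_le (ha : a ∈ Set.Icc (0 : ℝ) 1) (hb : b ∈ Set.Icc (0 : ℝ) 1)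
    (ha' : a' ∈ Set.Icc (0 : ℝ) 1) (h : a ≤ a') :
    thresholdLaw.real (rightSet a b \ rightSet a' b) ≤ a' - a := by
  have hδ : 0 ≤ a' - a := by linarith
  rcases le_or_gt (a' + b) 1 with h1' | h1'
  · have h1 : a + b ≤ 1 := by linarith
    have e := ratio_mul_of_le ha hb
    have e' := ratio_mul_of_le ha' hb
    obtain ⟨h0, -⟩ := ratio_le_mem ha' hb
    refine (measureReal_mono (s₂ := Set.Ioc (a / (a + b)) (a' / (a' + b)) ×ˢ Set.Iic (a + b))
      ?_).trans (thresholdLaw_Ioc_prod_le (unif_real_Iic (add_nonneg ha.1 hb.1) h1).le hδ ?_)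
    · rintro ⟨u, v⟩ ⟨hu, hu'⟩
      simp only [rightSet, h1, h1', if_true, Set.mem_ofPred_eq, not_and_or, not_not] at hu hu'
      exact ⟨⟨not_le.1 hu.1, hu'.resolve_right fun h' => h' (by linarith [hu.2])⟩, hu.2⟩
    · nlinarith
  · have e' := ratio_mul_of_lt ha' hb
    obtain ⟨h0', -⟩ := ratio_lt_mem ha' hb
    rcases le_or_gt (a + b) 1 with h1 | h1
    · have e := ratio_mul_of_le ha hb
      obtain ⟨-, h0⟩ := ratio_le_mem ha hb
      refine (measureReal_mono (s₂ := Set.Ioc (a / (a + b)) ((1 - b) / (2 - a' - b)) ×ˢ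
        Set.Ioc (a' + b - 1) (a + b))
        ?_).trans (thresholdLaw_Ioc_prod_le (unif_real_Ioc_le (by linarith [ha'.2, ha.1])) hδ ?_)
      · rintro ⟨u, v⟩ ⟨hu, hu'⟩
        simp only [rightSet, h1, h1'.not_ge, if_true, if_false, Set.mem_ofPred_eq, not_or,
          not_not] at hu hu'
        exact ⟨⟨not_le.1 hu.1, hu'.1⟩, not_le.1 hu'.2, hu.2⟩
      -- The second side has length (2-a'-b) - (1-a-b) = (a+b) - (a'+b-1). The first form is
      -- multiplied with the upper ratio, the second with the lower one.
      · nlinarith [mul_nonneg h0' (sub_nonneg.2 h1),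
          mul_nonneg (sub_nonneg.2 h0) (sub_nonneg.2 h1'.le)]
    · have e := ratio_mul_of_lt ha hb
      obtain ⟨-, h0⟩ := ratio_lt_mem ha hb
      refine (measureReal_mono (s₂ := Set.Ioc ((1 - b) / (2 - a - b)) ((1 - b) / (2 - a' - b)) ×ˢ
        Set.Ioi (a' + b - 1)) ?_).trans (thresholdLaw_Ioc_prod_le
          (unif_real_Ioi (by linarith) (by linarith [ha'.2, hb.2])).le hδ ?_)
      · rintro ⟨u, v⟩ ⟨hu, hu'⟩
        simp only [rightSet, h1.not_ge, h1'.not_ge, if_false, Set.mem_ofPred_eq, not_or,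
          not_not] at hu hu'
        exact ⟨⟨not_le.1 (hu.resolve_right fun h' => hu'.2 (by linarith)), hu'.1⟩, not_le.1 hu'.2⟩
      · nlinarith

lemma thresholdLaw_leftSet_diff_le (ha : a ∈ Set.Icc (0 : ℝ) 1) (hb : b ∈ Set.Icc (0 : ℝ) 1)
    (hb' : b' ∈ Set.Icc (0 : ℝ) 1) (h : b ≤ b') :
    thresholdLaw.real (leftSet a b \ leftSet a b') ≤ b' - b := by
  have hδ : 0 ≤ b' - b := by linarith
  rcases le_or_gt (a + b') 1 with h1' | h1'
  · have h1 : a + b ≤ 1 := by linarith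
    have e := ratio_mul_of_le ha hb
    have e' := ratio_mul_of_le ha hb'
    obtain ⟨-, h0⟩ := ratio_le_mem ha hb'
    refine (measureReal_mono (s₂ := Set.Ioc (a / (a + b')) (a / (a + b)) ×ˢ Set.Iic (a + b))
      ?_).trans (thresholdLaw_Ioc_prod_le (unif_real_Iic (add_nonneg ha.1 hb.1) h1).le hδ ?_)
    · rintro ⟨u, v⟩ ⟨hu, hu'⟩
      simp only [leftSet, h1, h1', if_true, Set.mem_ofPred_eq, not_and_or] at hu hu'
      exact ⟨⟨not_le.1 (hu'.resolve_right fun h' => h' (by linarith [hu.2])), hu.1⟩, hu.2⟩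
    · nlinarith
  · have e' := ratio_mul_of_lt ha hb'
    obtain ⟨h0', h01'⟩ := ratio_lt_mem ha hb'
    rcases le_or_gt (a + b) 1 with h1 | h1
    · have e := ratio_mul_of_le ha hb
      obtain ⟨h00, h0⟩ := ratio_le_mem ha hb
      refine (measureReal_mono (s₂ := Set.Ioc ((1 - b') / (2 - a - b')) (a / (a + b)) ×ˢ
        Set.Ioc (a + b' - 1) (a + b))
        ?_).trans (thresholdLaw_Ioc_prod_le (unif_real_Ioc_le (by linarith [hb'.2, hb.1])) hδ ?_)
      · rintro ⟨u, v⟩ ⟨hu, hu'⟩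
        simp only [leftSet, h1, h1'.not_ge, if_true, if_false, Set.mem_ofPred_eq, not_or] at hu hu'
        exact ⟨⟨not_le.1 hu'.1, hu.1⟩, not_le.1 hu'.2, hu.2⟩
      · nlinarith [mul_nonneg h00 (sub_nonneg.2 h1'.le),
          mul_nonneg (sub_nonneg.2 h01') (sub_nonneg.2 h1)]
    · have e := ratio_mul_of_lt ha hb
      obtain ⟨h00, h0⟩ := ratio_lt_mem ha hb
      refine (measureReal_mono (s₂ := Set.Ioc ((1 - b') / (2 - a - b')) ((1 - b) / (2 - a - b)) ×ˢ
        Set.Ioi (a + b' - 1)) ?_).trans (thresholdLaw_Ioc_prod_le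
          (unif_real_Ioi (by linarith) (by linarith [hb'.2, ha.2])).le hδ ?_)
      · rintro ⟨u, v⟩ ⟨hu, hu'⟩
        simp only [leftSet, h1.not_ge, h1'.not_ge, if_false, Set.mem_ofPred_eq, not_or] at hu hu'
        exact ⟨⟨not_le.1 hu'.1, hu.resolve_right fun h' => hu'.2 (by linarith)⟩, not_le.1 hu'.2⟩
      · nlinarith

end bits

end CorrelatedSampling

end

noncomputable section

namespace CorrelatedSampling

/-! ### Marginals shifted modulo one -/

section bits

variable {a b a' b' ε : ℝ}

open scoped symmDiff

lemma measureReal_symmDiff_eq_two_mul {Ω : Type*} [MeasurableSpace Ω] {μ : Measure Ω}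
    [IsFiniteMeasure μ] {s t : Set Ω} (hs : MeasurableSet s) (ht : MeasurableSet t)
    (h : μ.real s = μ.real t) : μ.real (s ∆ t) = 2 * μ.real (s \ t) := by
  have h1 := measureReal_sdiff_add_inter (μ := μ) (s := s) ht
  have h2 := measureReal_sdiff_add_inter (μ := μ) (s := t) hs
  rw [Set.inter_comm] at h2
  rw [measureReal_symmDiff_eq hs ht]
  linarith

lemma thresholdLaw_rightSet_symmDiff_le (ha : a ∈ Set.Icc (0 : ℝ) 1) (hb : b ∈ Set.Icc (0 : ℝ) 1)
    (ha' : a' ∈ Set.Icc (0 : ℝ) 1) (h : a ≤ a') :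
    thresholdLaw.real (rightSet a b ∆ rightSet a' b) ≤ 2 * (a' - a) := by
  rw [measureReal_symmDiff_eq_two_mul (measurableSet_rightSet a b) (measurableSet_rightSet a' b)
    (by rw [thresholdLaw_rightSet ha hb, thresholdLaw_rightSet ha' hb])]
  linarith [thresholdLaw_rightSet_diff_le ha hb ha' h]

lemma thresholdLaw_leftSet_symmDiff_le (ha : a ∈ Set.Icc (0 : ℝ) 1) (hb : b ∈ Set.Icc (0 : ℝ) 1)
    (hb' : b' ∈ Set.Icc (0 : ℝ) 1) (h : b ≤ b') :
    thresholdLaw.real (leftSet a b ∆ leftSet a b') ≤ 2 * (b' - b) := by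
  rw [measureReal_symmDiff_eq_two_mul (measurableSet_leftSet a b) (measurableSet_leftSet a b')
    (by rw [thresholdLaw_leftSet ha hb, thresholdLaw_leftSet ha hb'])]
  linarith [thresholdLaw_leftSet_diff_le ha hb hb' h]

lemma zero_mem_Icc : (0 : ℝ) ∈ Set.Icc (0 : ℝ) 1 := ⟨le_rfl, zero_le_one⟩

lemma one_mem_Icc : (1 : ℝ) ∈ Set.Icc (0 : ℝ) 1 := ⟨zero_le_one, le_rfl⟩

/-- A left marginal `1` has the same effect on the right coordinate as a left marginal `0`. -/
lemma thresholdLaw_rightSet_zero_one (hb : b ∈ Set.Icc (0 : ℝ) 1) :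
    thresholdLaw.real (rightSet 0 b ∆ rightSet 1 b) = 0 := by
  have e0 := thresholdLaw_rightSet zero_mem_Icc hb
  have e1 := thresholdLaw_rightSet one_mem_Icc hb
  rw [measureReal_symmDiff_eq_two_mul (measurableSet_rightSet 0 b) (measurableSet_rightSet 1 b)
    (by rw [e0, e1])]
  -- For b = 0 the first event is null; for b > 0 it is contained in the second. Since the
  -- probabilities agree, the symmetric difference is null either way.
  rcases hb.1.eq_or_lt with h | h
  · have := measureReal_mono (μ := thresholdLaw)
      (Set.sdiff_subset : rightSet 0 b \ rightSet 1 b ⊆ rightSet 0 b)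
    linarith [measureReal_nonneg (μ := thresholdLaw) (s := rightSet 0 b \ rightSet 1 b)]
  · have : rightSet 0 b ⊆ rightSet 1 b := by
      intro u hu
      simp only [rightSet, zero_add, hb.2, if_true, Set.mem_ofPred_eq] at hu ⊢
      rw [if_neg (by linarith)]
      exact Or.inr (by linarith [hu.2])
    simp [Set.sdiff_eq_empty.2 this]

/-- A right marginal `1` has the same effect on the left coordinate as a right marginal `0`. -/
lemma thresholdLaw_leftSet_zero_one (ha : a ∈ Set.Icc (0 : ℝ) 1) :
    thresholdLaw.real (leftSet a 0 ∆ leftSet a 1) = 0 := by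
  have e0 := thresholdLaw_leftSet ha zero_mem_Icc
  have e1 := thresholdLaw_leftSet ha one_mem_Icc
  rw [measureReal_symmDiff_eq_two_mul (measurableSet_leftSet a 0) (measurableSet_leftSet a 1)
    (by rw [e0, e1])]
  rcases ha.1.eq_or_lt with h | h
  · have := measureReal_mono (μ := thresholdLaw)
      (Set.sdiff_subset : leftSet a 0 \ leftSet a 1 ⊆ leftSet a 0)
    linarith [measureReal_nonneg (μ := thresholdLaw) (s := leftSet a 0 \ leftSet a 1)]
  · have : leftSet a 0 ⊆ leftSet a 1 := by
      intro u hu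
      simp only [leftSet, add_zero, ha.2, if_true, Set.mem_ofPred_eq] at hu ⊢
      rw [if_neg (by linarith)]
      exact Or.inr (by linarith [hu.2])
    simp [Set.sdiff_eq_empty.2 this]

/-- Moving from `a` to `a'` is adding `ε` modulo `1`. -/
def IsShift (ε a a' : ℝ) : Prop := a' = a + ε ∨ a' = a + ε - 1

lemma IsShift.combine_left (h : IsShift ε a a') (hε : ε ∈ Set.Icc (0 : ℝ) 1)
    (ha : a ∈ Set.Icc (0 : ℝ) 1) (hb : b ∈ Set.Icc (0 : ℝ) 1) (ha' : a' ∈ Set.Icc (0 : ℝ) 1) :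
    IsShift ε (combine a b) (combine a' b) := by
  obtain ⟨h0, h1⟩ := hε
  obtain ⟨ha0, ha1⟩ := ha
  obtain ⟨hb0, hb1⟩ := hb
  obtain ⟨ha0', ha1'⟩ := ha'
  unfold combine IsShift at *
  rcases h with rfl | rfl <;> split_ifs <;>
    first | (left; linarith) | (right; linarith)

lemma combine_comm (a b : ℝ) : combine a b = combine b a := by
  unfold combine; rw [add_comm]

lemma IsShift.combine_right (h : IsShift ε b b') (hε : ε ∈ Set.Icc (0 : ℝ) 1)
    (ha : a ∈ Set.Icc (0 : ℝ) 1) (hb : b ∈ Set.Icc (0 : ℝ) 1) (hb' : b' ∈ Set.Icc (0 : ℝ) 1) :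
    IsShift ε (combine a b) (combine a b') := by
  rw [combine_comm a, combine_comm a]
  exact h.combine_left hε hb ha hb'

/-- If the shift wraps around, move the marginal from a to 1, jump from 1 to 0 for free, and move on
to a + ε - 1: the total length travelled is ε. -/
lemma IsShift.rightSet_symmDiff_le (h : IsShift ε a a') (ha : a ∈ Set.Icc (0 : ℝ) 1)
    (hb : b ∈ Set.Icc (0 : ℝ) 1) (ha' : a' ∈ Set.Icc (0 : ℝ) 1) (hε : 0 ≤ ε) :
    thresholdLaw.real (rightSet a b ∆ rightSet a' b) ≤ 2 * ε := by
  rcases h with rfl | rfl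
  · linarith [thresholdLaw_rightSet_symmDiff_le ha hb ha' (by linarith)]
  · have h1 := thresholdLaw_rightSet_symmDiff_le ha hb one_mem_Icc ha.2
    have h2 := thresholdLaw_rightSet_symmDiff_le zero_mem_Icc hb ha' ha'.1
    have h3 := thresholdLaw_rightSet_zero_one hb
    have h4 := measureReal_symmDiff_le (μ := thresholdLaw) (s := rightSet a b)
      (t := rightSet 1 b) (rightSet (a + ε - 1) b)
    have h5 := measureReal_symmDiff_le (μ := thresholdLaw) (s := rightSet 1 b)
      (t := rightSet 0 b) (rightSet (a + ε - 1) b)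
    rw [symmDiff_comm] at h3
    linarith

lemma IsShift.leftSet_symmDiff_le (h : IsShift ε b b') (ha : a ∈ Set.Icc (0 : ℝ) 1)
    (hb : b ∈ Set.Icc (0 : ℝ) 1) (hb' : b' ∈ Set.Icc (0 : ℝ) 1) (hε : 0 ≤ ε) :
    thresholdLaw.real (leftSet a b ∆ leftSet a b') ≤ 2 * ε := by
  rcases h with rfl | rfl
  · linarith [thresholdLaw_leftSet_symmDiff_le ha hb hb' (by linarith)]
  · have h1 := thresholdLaw_leftSet_symmDiff_le ha hb one_mem_Icc hb.2
    have h2 := thresholdLaw_leftSet_symmDiff_le ha zero_mem_Icc hb' hb'.1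
    have h3 := thresholdLaw_leftSet_zero_one ha
    have h4 := measureReal_symmDiff_le (μ := thresholdLaw) (s := leftSet a b)
      (t := leftSet a 1) (leftSet a (b + ε - 1))
    have h5 := measureReal_symmDiff_le (μ := thresholdLaw) (s := leftSet a 1)
      (t := leftSet a 0) (leftSet a (b + ε - 1))
    rw [symmDiff_comm] at h3
    linarith

/-- The bit of a coordinate whose marginal is shifted by `ε` is coupled almost monotonically. -/
lemma IsShift.leftSet_min_diff_le (h : IsShift ε a a') (ha : a ∈ Set.Icc (0 : ℝ) 1)
    (hb : b ∈ Set.Icc (0 : ℝ) 1) (ha' : a' ∈ Set.Icc (0 : ℝ) 1) (hε : 0 ≤ ε) :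
    min (thresholdLaw.real (leftSet a b \ leftSet a' b))
      (thresholdLaw.real (leftSet a' b \ leftSet a b)) ≤ ε := by
  rcases h with rfl | rfl
  · rw [Set.sdiff_eq_empty.2 (leftSet_subset ha hb ha' (by linarith))]
    simp [hε]
  -- After wrapping, the new marginal a + ε - 1 is at most ε, so the whole new event is that small.
  · refine (min_le_right _ _).trans ((measureReal_mono Set.sdiff_subset).trans ?_)
    rw [thresholdLaw_leftSet ha' hb]
    linarith [ha.2]

lemma IsShift.rightSet_min_diff_le (h : IsShift ε b b') (ha : a ∈ Set.Icc (0 : ℝ) 1)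
    (hb : b ∈ Set.Icc (0 : ℝ) 1) (hb' : b' ∈ Set.Icc (0 : ℝ) 1) (hε : 0 ≤ ε) :
    min (thresholdLaw.real (rightSet a b \ rightSet a b'))
      (thresholdLaw.real (rightSet a b' \ rightSet a b)) ≤ ε := by
  rcases h with rfl | rfl
  · rw [Set.sdiff_eq_empty.2 (rightSet_subset ha hb hb' (by linarith))]
    simp [hε]
  · refine (min_le_right _ _).trans ((measureReal_mono Set.sdiff_subset).trans ?_)
    rw [thresholdLaw_rightSet ha hb']
    linarith [hb.2]

end bits

/-! ### Coupling two events -/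

section coupling

variable {Ω Ω' : Type*} [MeasurableSpace Ω] [MeasurableSpace Ω'] {μ : Measure Ω} {ν : Measure Ω'}

lemma lintegral_two_events [IsFiniteMeasure μ] {s t : Set Ω} (hs : MeasurableSet s)
    (ht : MeasurableSet t) (D : Prop → Prop → ℕ) :
    ∫⁻ u, (D (u ∈ s) (u ∈ t) : ENNReal) ∂μ =
      ENNReal.ofReal (D True True * μ.real (s ∩ t) + D True False * μ.real (s \ t) +
        (D False True * μ.real (t \ s) + D False False * μ.real (sᶜ \ t))) := by
  have piece : ∀ (p q : Prop) (r : Set Ω), MeasurableSet r →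
      (∀ u ∈ r, ((u ∈ s) = p) ∧ ((u ∈ t) = q)) →
      ∫⁻ u in r, (D (u ∈ s) (u ∈ t) : ENNReal) ∂μ = ENNReal.ofReal (D p q * μ.real r) := by
    intro p q r hr h
    rw [setLIntegral_congr_fun (g := fun _ => (D p q : ENNReal)) hr
      (fun u hu => by simp only [(h u hu).1, (h u hu).2]), setLIntegral_const,
      ENNReal.ofReal_mul (by positivity), ofReal_measureReal, ENNReal.ofReal_natCast]
  rw [← lintegral_add_compl _ hs, ← lintegral_inter_add_sdiff _ s ht,
    ← lintegral_inter_add_sdiff _ sᶜ ht,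
    piece True True _ (hs.inter ht) fun u hu => by simp [hu.1, hu.2],
    piece True False _ (hs.diff ht) fun u hu => by simp [hu.1, hu.2],
    piece False True (sᶜ ∩ t) (hs.compl.inter ht) fun u hu => by
      simpa using hu,
    piece False False _ (hs.compl.diff ht) fun u hu => by simpa using hu,
    ← ENNReal.ofReal_add (by positivity) (by positivity),
    ← ENNReal.ofReal_add (by positivity) (by positivity),
    ← ENNReal.ofReal_add (by positivity) (by positivity),
    show sᶜ ∩ t = t \ s by rw [Set.sdiff_eq, Set.inter_comm]]

/-- Replacing a coupling of two events by a monotone one changes the expectation of `D` by at most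
twice the probability by which the former fails to be monotone. -/
lemma lintegral_two_events_le [IsProbabilityMeasure μ] [IsProbabilityMeasure ν] {s t : Set Ω}
    {s' t' : Set Ω'} (hs : MeasurableSet s) (ht : MeasurableSet t) (hs' : MeasurableSet s')
    (ht' : MeasurableSet t') (hss : μ.real s = ν.real s') (htt : μ.real t = ν.real t')
    (mono : s' ⊆ t' ∨ t' ⊆ s') {D : Prop → Prop → ℕ} {ε : ℝ}
    (hD : D True False + D False True ≤ D True True + D False False + 2)
    (hε : min (μ.real (s \ t)) (μ.real (t \ s)) ≤ ε) :
    ∫⁻ u, (D (u ∈ s) (u ∈ t) : ENNReal) ∂μ ≤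
      ∫⁻ u, (D (u ∈ s') (u ∈ t') : ENNReal) ∂ν + ENNReal.ofReal (2 * ε) := by
  have hε0 : 0 ≤ ε := le_trans (le_min measureReal_nonneg measureReal_nonneg) hε
  rw [lintegral_two_events hs ht, lintegral_two_events hs' ht',
    ← ENNReal.ofReal_add (by positivity) (by positivity)]
  refine ENNReal.ofReal_le_ofReal ?_
  have hD' : (D True False : ℝ) + D False True ≤ D True True + D False False + 2 := by
    exact_mod_cast hD
  have e1 := measureReal_sdiff_add_inter (μ := μ) (s := s) ht
  have e2 := measureReal_sdiff_add_inter (μ := μ) (s := t) hs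
  have e3 := measureReal_sdiff_add_inter (μ := μ) (s := sᶜ) ht
  have e1' := measureReal_sdiff_add_inter (μ := ν) (s := s') ht'
  have e2' := measureReal_sdiff_add_inter (μ := ν) (s := t') hs'
  have e3' := measureReal_sdiff_add_inter (μ := ν) (s := s'ᶜ) ht'
  rw [probReal_compl_eq_one_sub hs, Set.inter_comm, ← Set.sdiff_eq] at e3
  rw [probReal_compl_eq_one_sub hs', Set.inter_comm, ← Set.sdiff_eq] at e3'
  rw [Set.inter_comm] at e2 e2'
  -- With fixed marginals, the joint law of two events has the single parameter q = P(s \ t). It is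
  -- least for a monotone coupling, and its excess is the smaller of P(s \ t) and P(t \ s).
  have hmin : μ.real (s \ t) - ν.real (s' \ t') ≤ ε ∧ 0 ≤ μ.real (s \ t) - ν.real (s' \ t') := by
    have p1 := measureReal_nonneg (μ := μ) (s := s \ t)
    have p2 := measureReal_nonneg (μ := μ) (s := t \ s)
    have p3 := measureReal_nonneg (μ := ν) (s := s' \ t')
    have p4 := measureReal_nonneg (μ := ν) (s := t' \ s')
    rcases mono with h | h
    · rw [Set.sdiff_eq_empty.2 h] at e1' p3 ⊢
      simp only [measureReal_empty] at e1' p3 ⊢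
      rcases min_le_iff.1 hε with h | h <;> constructor <;> linarith
    · rw [Set.sdiff_eq_empty.2 h] at e2' p4
      simp only [measureReal_empty] at e2' p4
      rcases min_le_iff.1 hε with h | h <;> constructor <;> linarith
  generalize μ.real (s \ t) = q at *
  generalize ν.real (s' \ t') = q' at *
  obtain ⟨hm1, hm2⟩ := hmin
  have r1 : μ.real (s ∩ t) = ν.real s' - q := by linarith
  have r2 : μ.real (t \ s) = ν.real t' - ν.real s' + q := by linarith
  have r3 : μ.real (sᶜ \ t) = 1 - ν.real t' - q := by linarith
  have r1' : ν.real (s' ∩ t') = ν.real s' - q' := by linarith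
  have r2' : ν.real (t' \ s') = ν.real t' - ν.real s' + q' := by linarith
  have r3' : ν.real (s'ᶜ \ t') = 1 - ν.real t' - q' := by linarith
  rw [r1, r2, r3, r1', r2', r3']
  -- The expectation is affine in q with slope D(T,F) + D(F,T) - D(T,T) - D(F,F), which is at most
  -- 2.
  nlinarith [mul_le_mul_of_nonneg_right hD' hm2]

lemma lintegral_event_congr [IsProbabilityMeasure μ] [IsProbabilityMeasure ν] {s : Set Ω}
    {t : Set Ω'} (hs : MeasurableSet s) (ht : MeasurableSet t) (hst : μ.real s = ν.real t)
    (D : Prop → ℕ) :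
    ∫⁻ u, (D (u ∈ s) : ENNReal) ∂μ = ∫⁻ u, (D (u ∈ t) : ENNReal) ∂ν := by
  rw [lintegral_two_events hs hs fun p _ => D p, lintegral_two_events ht ht fun p _ => D p]
  have e1 : sᶜ \ s = sᶜ := by ext; simp
  have e2 : tᶜ \ t = tᶜ := by ext; simp
  simp only [Set.inter_self, sdiff_self, Set.bot_eq_empty, measureReal_empty, e1, e2,
    probReal_compl_eq_one_sub hs, probReal_compl_eq_one_sub ht, hst]

end coupling

end CorrelatedSampling

end

noncomputable section

namespace CorrelatedSampling

instance {α : Type*} : MeasurableSpace (Finset α) := ⊤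

instance {α : Type*} : DiscreteMeasurableSpace (Finset α) := ⟨fun _ => trivial⟩

/-! ### Coordinate tree rounding -/

/-- The set of the coordinates below a node that are fixed to `1`, when the coordinate sent by the
node is fixed to `1` if and only if `p` holds. -/
def NodeState.out (s : NodeState) (p : Prop) : Finset ℕ :=
  open Classical in if p then insert s.coord s.ones else s.ones

lemma resolve_marginal (p q : NodeState) (θ : ℝ) :
    (resolve p q θ).marginal = combine p.marginal q.marginal := by
  unfold resolve combine; dsimp only; split_ifs <;> rfl

/-- The coordinate sent upward inherits the bit of the node and the other one is fixed at once. The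
node thus acts on its children only through one bit for each, a function of the two thresholds and
the two marginals. -/
lemma resolve_out (p q : NodeState) (θ θr : ℝ) :
    (resolve p q θ).out (θr ≤ combine p.marginal q.marginal) =
      p.out ((θ, θr) ∈ leftSet p.marginal q.marginal) ∪
        q.out ((θ, θr) ∈ rightSet p.marginal q.marginal) := by
  unfold resolve combine leftSet rightSet NodeState.out
  dsimp only [Set.mem_ofPred_eq]
  split_ifs <;> simp_all <;> grind

lemma card_symmDiff_le_add {α : Type*} [DecidableEq α] (s t u : Finset α) :
    (symmDiff s u).card ≤ (symmDiff s t).card + (symmDiff t u).card :=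
  (Finset.card_le_card (symmDiff_triangle s t u)).trans (Finset.card_union_le _ _)

lemma card_symmDiff_union_le {α : Type*} [DecidableEq α] (s t s' t' : Finset α) :
    (symmDiff (s ∪ t) (s' ∪ t')).card ≤ (symmDiff s s').card + (symmDiff t t').card := by
  refine (Finset.card_le_card ?_).trans (Finset.card_union_le _ _)
  intro i
  simp only [Finset.mem_symmDiff, Finset.mem_union]
  tauto

lemma NodeState.card_symmDiff_out_le (s : NodeState) (p q : Prop) :
    (symmDiff (s.out p) (s.out q)).card ≤ 1 := by
  refine (Finset.card_le_card (t := {s.coord}) ?_).trans (Finset.card_singleton _).le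
  intro i
  simp only [NodeState.out, Finset.mem_symmDiff, Finset.mem_singleton]
  split_ifs <;> simp <;> tauto

/-- This is the hypothesis `hD` of `lintegral_two_events_le`: flipping a single bit changes an
output by at most one element. -/
lemma NodeState.card_symmDiff_out_swap (s s' : NodeState) :
    (symmDiff (s.out True) (s'.out False)).card + (symmDiff (s.out False) (s'.out True)).card ≤
      (symmDiff (s.out True) (s'.out True)).card +
        (symmDiff (s.out False) (s'.out False)).card + 2 := by
  have h1 := card_symmDiff_le_add (s.out True) (s'.out True) (s'.out False)
  have h2 := card_symmDiff_le_add (s.out False) (s'.out False) (s'.out True)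
  have h3 := s'.card_symmDiff_out_le True False
  have h4 := s'.card_symmDiff_out_le False True
  omega

lemma lintegral_out_symmDiff_le {Ω : Type*} [MeasurableSpace Ω] {μ : Measure Ω} (s : NodeState)
    {B B' : Set Ω} (hB : MeasurableSet B) (hB' : MeasurableSet B') :
    ∫⁻ u, ((symmDiff (s.out (u ∈ B)) (s.out (u ∈ B'))).card : ENNReal) ∂μ ≤
      μ (symmDiff B B') := by
  rw [← lintegral_indicator_one (hB.symmDiff hB')]
  refine lintegral_mono fun u => ?_
  by_cases hu : u ∈ symmDiff B B'
  · rw [Set.indicator_of_mem hu]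
    simpa using s.card_symmDiff_out_le (u ∈ B) (u ∈ B')
  · have : (u ∈ B) = (u ∈ B') := by
      rw [Set.mem_symmDiff] at hu
      exact propext (by tauto)
    simp [this]

lemma measurable_comp_mem {Ω β : Type*} [MeasurableSpace Ω] [MeasurableSpace β] {s t : Set Ω}
    (hs : MeasurableSet s) (ht : MeasurableSet t) (D : Prop → Prop → β) :
    Measurable fun u => D (u ∈ s) (u ∈ t) :=
  (measurable_of_countable fun p : Prop × Prop => D p.1 p.2).comp
    ((measurable_mem.2 hs).prodMk (measurable_mem.2 ht))

namespace CoordTree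

variable (x y : ℕ → ℝ) (h : ℕ)

/-- The marginal sent by the root; it does not depend on the thresholds. -/
def marg : CoordTree → ℝ
  | .leaf i => x i
  | .node l r => combine (marg l) (marg r)

/-- The number of leaves with coordinate `h`. -/
def count : CoordTree → ℕ
  | .leaf i => if i = h then 1 else 0
  | .node l r => count l + count r

/-- The height of the tree. -/
def depth : CoordTree → ℕ
  | .leaf _ => 0
  | .node l r => max (depth l) (depth r) + 1

instance instIsProbabilityMeasureSeedLaw : (T : CoordTree) → IsProbabilityMeasure T.seedLaw
  | .leaf _ => (inferInstance : IsProbabilityMeasure (Measure.dirac () : Measure Unit))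
  | .node l r =>
    letI := instIsProbabilityMeasureSeedLaw l
    letI := instIsProbabilityMeasureSeedLaw r
    (inferInstance : IsProbabilityMeasure (l.seedLaw.prod (r.seedLaw.prod (unif 0 1))))

lemma process_marginal : (T : CoordTree) → (ω : T.Seed) → (T.process x ω).marginal = T.marg x
  | .leaf _, _ => rfl
  | .node l r, (ωl, ωr, θ) => by
    change (resolve _ _ _).marginal = combine _ _
    rw [resolve_marginal, process_marginal l, process_marginal r]

variable {x y h}

lemma marg_mem (hx : ∀ i, x i ∈ Set.Icc (0 : ℝ) 1) : (T : CoordTree) → T.marg x ∈ Set.Icc (0 : ℝ) 1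
  | .leaf i => hx i
  | .node l r => combine_mem (marg_mem hx l) (marg_mem hx r)

lemma process_congr (hxy : ∀ i, i ≠ h → x i = y i) :
    (T : CoordTree) → T.count h = 0 → (ω : T.Seed) → T.process x ω = T.process y ω
  | .leaf i, hT, _ => by
    have : i ≠ h := by rintro rfl; simp [count] at hT
    change NodeState.mk _ _ _ = NodeState.mk _ _ _
    rw [hxy i this]
  | .node l r, hT, (ωl, ωr, θ) => by
    change resolve _ _ _ = resolve _ _ _
    simp only [count, Nat.add_eq_zero_iff] at hT
    rw [process_congr hxy l hT.1, process_congr hxy r hT.2]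

lemma marg_congr (hxy : ∀ i, i ≠ h → x i = y i) :
    (T : CoordTree) → T.count h = 0 → T.marg x = T.marg y
  | .leaf i, hT => hxy i (by rintro rfl; simp [count] at hT)
  | .node l r, hT => by
    simp only [count, Nat.add_eq_zero_iff] at hT
    simp only [marg, marg_congr hxy l hT.1, marg_congr hxy r hT.2]

variable (x y h)

lemma measurable_process : (T : CoordTree) →
    Measurable (fun ω : T.Seed => ((T.process x ω).coord, (T.process x ω).ones))
  | .leaf i => measurable_const (a := ((i, ∅) : ℕ × Finset ℕ))
  | .node l r => by
    have hl := measurable_process l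
    have hr := measurable_process r
    have key : ∀ g : ((ℕ × Finset ℕ) × (ℕ × Finset ℕ)) → ℕ × Finset ℕ,
        Measurable fun u : l.Seed × r.Seed × ℝ =>
          g (((l.process x u.1).coord, (l.process x u.1).ones),
            ((r.process x u.2.1).coord, (r.process x u.2.1).ones)) := fun g =>
      (Measurable.of_discrete (f := g)).comp
        ((hl.comp measurable_fst).prodMk (hr.comp (measurable_fst.comp measurable_snd)))
    have hθ : ∀ t : ℝ, MeasurableSet {u : l.Seed × r.Seed × ℝ | u.2.2 ≤ t} := fun t =>
      measurableSet_le (measurable_snd.comp measurable_snd) measurable_const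
    have hp : ∀ u : l.Seed × r.Seed × ℝ, (node l r).process x u =
        resolve (l.process x u.1) (r.process x u.2.1) u.2.2 := fun _ => rfl
    have hm : ∀ u : l.Seed × r.Seed × ℝ, (((node l r).process x u).coord,
        ((node l r).process x u).ones) =
        if l.marg x + r.marg x ≤ 1 then
          if u.2.2 ≤ l.marg x / (l.marg x + r.marg x) then
            ((l.process x u.1).coord, (l.process x u.1).ones ∪ (r.process x u.2.1).ones)
          else ((r.process x u.2.1).coord, (l.process x u.1).ones ∪ (r.process x u.2.1).ones)
        else
          if u.2.2 ≤ (1 - r.marg x) / (2 - l.marg x - r.marg x) then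
            ((r.process x u.2.1).coord,
              insert (l.process x u.1).coord ((l.process x u.1).ones ∪ (r.process x u.2.1).ones))
          else ((l.process x u.1).coord,
            insert (r.process x u.2.1).coord
              ((l.process x u.1).ones ∪ (r.process x u.2.1).ones)) := by
      intro u
      simp only [hp, resolve, process_marginal]
      split_ifs <;> rfl
    change Measurable (fun u : l.Seed × r.Seed × ℝ =>
      (((node l r).process x u).coord, ((node l r).process x u).ones))
    simp only [hm]
    by_cases hs : l.marg x + r.marg x ≤ 1
    · simp only [hs, if_true]
      exact Measurable.ite (hθ _) (key fun p => (p.1.1, p.1.2 ∪ p.2.2))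
        (key fun p => (p.2.1, p.1.2 ∪ p.2.2))
    · simp only [hs, if_false]
      exact Measurable.ite (hθ _) (key fun p => (p.2.1, insert p.1.1 (p.1.2 ∪ p.2.2)))
        (key fun p => (p.1.1, insert p.2.1 (p.1.2 ∪ p.2.2)))

/-- The set of the coordinates below the root that are rounded to `1`, given the thresholds of the
nodes and the additional threshold. -/
def output (T : CoordTree) (u : T.Seed × ℝ) : Finset ℕ :=
  (T.process x u.1).out (u.2 ≤ T.marg x)

lemma measurable_output (T : CoordTree) : Measurable (T.output x) := by
  have h1 : Measurable fun u : T.Seed × ℝ =>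
      (((T.process x u.1).coord, (T.process x u.1).ones), (u.2 ≤ T.marg x : Prop)) :=
    ((measurable_process x T).comp measurable_fst).prodMk
      (measurable_mem.2 (measurableSet_le measurable_snd measurable_const))
  exact (measurable_of_countable fun p : (ℕ × Finset ℕ) × Prop =>
    NodeState.out ⟨p.1.1, 0, p.1.2⟩ p.2).comp h1

lemma output_node (l r : CoordTree) (ωl : l.Seed) (ωr : r.Seed) (θ θr : ℝ) :
    (node l r).output x ((ωl, ωr, θ), θr) =
      (l.process x ωl).out ((θ, θr) ∈ leftSet (l.marg x) (r.marg x)) ∪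
        (r.process x ωr).out ((θ, θr) ∈ rightSet (l.marg x) (r.marg x)) := by
  have := resolve_out (l.process x ωl) (r.process x ωr) θ θr
  simp only [process_marginal] at this
  exact this

/-- The law of the thresholds of the nodes and of the additional threshold. -/
def law (T : CoordTree) : Measure (T.Seed × ℝ) := T.seedLaw.prod (unif 0 1)

/-- The two thresholds are integrated innermost, with the seeds of both subtrees frozen. Each
summand involves one subtree only, so the other seed integrates out. No measurability of `f` is
needed for an upper bound. -/
lemma lintegral_node_le {l r : CoordTree} {f : (node l r).Seed × ℝ → ENNReal}
    {A : l.Seed → ℝ × ℝ → ENNReal} {B : r.Seed → ℝ × ℝ → ENNReal}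
    (hA : ∀ ω, Measurable (A ω)) (hB : ∀ ω, Measurable (B ω))
    (hf : ∀ ωl ωr θ θr, f ((ωl, ωr, θ), θr) ≤ A ωl (θ, θr) + B ωr (θ, θr)) :
    ∫⁻ u, f u ∂(node l r).law ≤
      ∫⁻ ω, ∫⁻ u, A ω u ∂thresholdLaw ∂l.seedLaw + ∫⁻ ω, ∫⁻ u, B ω u ∂thresholdLaw ∂r.seedLaw :=
  calc ∫⁻ u, f u ∂(node l r).law
      ≤ ∫⁻ ω, ∫⁻ θr, f (ω, θr) ∂unif 0 1 ∂(node l r).seedLaw := lintegral_prod_le _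
    _ ≤ ∫⁻ ωl, ∫⁻ v, ∫⁻ θr, f ((ωl, v), θr) ∂unif 0 1 ∂(r.seedLaw.prod (unif 0 1)) ∂l.seedLaw :=
        lintegral_prod_le (μ := l.seedLaw) (ν := r.seedLaw.prod (unif 0 1)) _
    _ ≤ ∫⁻ ωl, ∫⁻ ωr, ∫⁻ u, (A ωl u + B ωr u) ∂thresholdLaw ∂r.seedLaw ∂l.seedLaw := by
        refine lintegral_mono fun ωl => (lintegral_prod_le _).trans (lintegral_mono fun ωr => ?_)
        exact (lintegral_mono fun θ => lintegral_mono fun θr => hf _ _ _ _).trans_eq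
          (lintegral_prod _ ((hA ωl).add (hB ωr)).aemeasurable).symm
    _ = _ := by
        simp only [fun ωl ωr => lintegral_add_left (μ := thresholdLaw) (hA ωl) (B ωr),
          lintegral_add_left measurable_const,
          lintegral_add_right _ measurable_const, lintegral_const, measure_univ, mul_one]

lemma lintegral_law (T : CoordTree) (G : Finset ℕ → Finset ℕ → ENNReal) :
    ∫⁻ u, G (T.output x u) (T.output y u) ∂T.law =
      ∫⁻ ω, ∫⁻ u, G ((T.process x ω).out (u ∈ Set.Iic (T.marg x)))
        ((T.process y ω).out (u ∈ Set.Iic (T.marg y))) ∂unif 0 1 ∂T.seedLaw :=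
  lintegral_prod (μ := T.seedLaw) (ν := unif 0 1) (fun u => G (T.output x u) (T.output y u))
    ((measurable_of_countable fun p : Finset ℕ × Finset ℕ => G p.1 p.2).comp
      ((measurable_output x T).prodMk (measurable_output y T))).aemeasurable

variable {x y h}

lemma notMem_out : (T : CoordTree) → T.count h = 0 → (ω : T.Seed) → (p : Prop) →
    h ∉ (T.process x ω).out p := by
  have key : ∀ T : CoordTree, T.count h = 0 → ∀ ω : T.Seed,
      h ≠ (T.process x ω).coord ∧ h ∉ (T.process x ω).ones := by
    intro T
    induction T with
    | leaf i =>
      intro hT _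
      exact ⟨by rintro (rfl : h = i); simp [count] at hT, Finset.notMem_empty _⟩
    | node l r ihl ihr =>
      intro hT
      rintro ⟨ωl, ωr, θ⟩
      simp only [count, Nat.add_eq_zero_iff] at hT
      have h1 := ihl hT.1 ωl
      have h2 := ihr hT.2 ωr
      change h ≠ (resolve _ _ _).coord ∧ h ∉ (resolve _ _ _).ones
      unfold resolve
      dsimp only
      split_ifs <;> simp_all
  intro T hT ω p
  have := key T hT ω
  unfold NodeState.out
  split_ifs <;> simp_all

/-- Coordinate `h` is rounded to `1` with probability at most `x h`. -/
lemma law_mem_output_le (hx : ∀ i, x i ∈ Set.Icc (0 : ℝ) 1) (T : CoordTree) (hT : T.count h ≤ 1) :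
    ∫⁻ u, ((if h ∈ T.output x u then 1 else 0 : ℕ) : ENNReal) ∂T.law ≤
      ENNReal.ofReal (T.count h * x h) := by
  induction T with
  | leaf i =>
    rw [lintegral_law x x _ fun s _ => ((if h ∈ s then 1 else 0 : ℕ) : ENNReal)]
    rcases eq_or_ne i h with rfl | hi
    · refine (lintegral_mono (g := fun _ => ENNReal.ofReal (x i)) fun ω => ?_).trans (by simp
          [count])
      refine (lintegral_mono (g := (Set.Iic (x i)).indicator 1) fun u => ?_).trans ?_
      · change (((if i ∈ NodeState.out ⟨i, x i, ∅⟩ (u ∈ Set.Iic (x i)) then 1 else 0 : ℕ)) :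
            ENNReal)
          ≤ _
        by_cases hu : u ∈ Set.Iic (x i) <;> simp [NodeState.out, hu]
      · rw [lintegral_indicator_one measurableSet_Iic, ← ofReal_measureReal,
          unif_real_Iic (hx i).1 (hx i).2]
    · have h0 : (leaf i).count h = 0 := by simp [count, hi]
      simp [notMem_out _ h0]
  | node l r ihl ihr =>
    have hl := marg_mem hx l
    have hr := marg_mem hx r
    simp only [count] at hT ⊢
    refine (lintegral_node_le
      (A := fun ω u => (if h ∈ (l.process x ω).out (u ∈ leftSet (l.marg x) (r.marg x))
        then 1 else 0 : ℕ))
      (B := fun ω u => (if h ∈ (r.process x ω).out (u ∈ rightSet (l.marg x) (r.marg x))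
        then 1 else 0 : ℕ))
      (fun ω => measurable_comp_mem (measurableSet_leftSet _ _) MeasurableSet.univ
        fun p _ => ((if h ∈ (l.process x ω).out p then 1 else 0 : ℕ) : ENNReal))
      (fun ω => measurable_comp_mem (measurableSet_rightSet _ _) MeasurableSet.univ
        fun p _ => ((if h ∈ (r.process x ω).out p then 1 else 0 : ℕ) : ENNReal)) ?_).trans ?_
    · intro ωl ωr θ θr
      simp only [output_node, Finset.mem_union]
      norm_cast
      split_ifs <;> simp_all
    · rw [Nat.cast_add, add_mul, ENNReal.ofReal_add (mul_nonneg (Nat.cast_nonneg _) (hx h).1)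
        (mul_nonneg (Nat.cast_nonneg _) (hx h).1)]
      refine add_le_add (le_trans (le_of_eq ?_) (ihl (by omega)))
        (le_trans (le_of_eq ?_) (ihr (by omega)))
      · rw [lintegral_law x x _ fun s _ => ((if h ∈ s then 1 else 0 : ℕ) : ENNReal)]
        -- For a frozen seed only one bit is left, and it has the same probability here as at the
        -- root of `l`.
        refine lintegral_congr fun ω => lintegral_event_congr (measurableSet_leftSet _ _)
          measurableSet_Iic ?_ fun p => if h ∈ (l.process x ω).out p then 1 else 0
        rw [thresholdLaw_leftSet hl hr, unif_real_Iic hl.1 hl.2]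
      · rw [lintegral_law x x _ fun s _ => ((if h ∈ s then 1 else 0 : ℕ) : ENNReal)]
        refine lintegral_congr fun ω => lintegral_event_congr (measurableSet_rightSet _ _)
          measurableSet_Iic ?_ fun p => if h ∈ (r.process x ω).out p then 1 else 0
        rw [thresholdLaw_rightSet hl hr, unif_real_Iic hr.1 hr.2]

/-! ### Stretch of the tree under a change of one entry -/

section step

variable {ε : ℝ}

/-- Changing one coordinate by `ε` changes at most `(1 + 4 * depth) * ε` coordinates of the output
in expectation. -/
lemma shift_and_cost_le (hx : ∀ i, x i ∈ Set.Icc (0 : ℝ) 1) (hy : ∀ i, y i ∈ Set.Icc (0 : ℝ) 1)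
    (hε : 0 ≤ ε) (hxy : ∀ i, i ≠ h → x i = y i) (hh : y h = x h + ε) (T : CoordTree)
    (hT : T.count h = 1) :
    IsShift ε (T.marg x) (T.marg y) ∧
      ∫⁻ u, ((symmDiff (T.output x u) (T.output y u)).card : ENNReal) ∂T.law ≤
        ENNReal.ofReal ((1 + 4 * T.depth) * ε) := by
  have hε1 : ε ∈ Set.Icc (0 : ℝ) 1 := ⟨hε, by linarith [(hx h).1, (hy h).2]⟩
  induction T with
  | leaf i =>
    obtain rfl : i = h := by by_contra hi; simp [count, hi] at hT
    refine ⟨Or.inl hh, ?_⟩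
    rw [lintegral_law x y _ fun s t => ((symmDiff s t).card : ENNReal)]
    refine (lintegral_mono (g := fun _ => ENNReal.ofReal ε) fun ω => ?_).trans (by simp [depth])
    refine (lintegral_out_symmDiff_le ⟨i, x i, ∅⟩ (B := Set.Iic (x i)) (B' := Set.Iic (y i))
      measurableSet_Iic measurableSet_Iic).trans ?_
    have : symmDiff (Set.Iic (x i)) (Set.Iic (y i)) = Set.Ioc (x i) (y i) := by
      rw [symmDiff_of_le (Set.Iic_subset_Iic.2 (by linarith))]
      exact Set.Iic_sdiff_Iic
    rw [this, ← ofReal_measureReal]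
    exact ENNReal.ofReal_le_ofReal ((unif_real_Ioc_le (by linarith)).trans (by linarith))
  | node l r ihl ihr =>
    have hlx := marg_mem hx l
    have hrx := marg_mem hx r
    have hly := marg_mem hy l
    have hry := marg_mem hy r
    have mono : ∀ s t : ℝ, Set.Iic s ⊆ Set.Iic t ∨ Set.Iic t ⊆ Set.Iic s := fun s t =>
      (le_total s t).imp Set.Iic_subset_Iic.2 Set.Iic_subset_Iic.2
    have bound := lintegral_node_le (f := fun u =>
        ((symmDiff ((node l r).output x u) ((node l r).output y u)).card : ENNReal))
      (A := fun ω u => (symmDiff ((l.process x ω).out (u ∈ leftSet (l.marg x) (r.marg x)))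
        ((l.process y ω).out (u ∈ leftSet (l.marg y) (r.marg y)))).card)
      (B := fun ω u => (symmDiff ((r.process x ω).out (u ∈ rightSet (l.marg x) (r.marg x)))
        ((r.process y ω).out (u ∈ rightSet (l.marg y) (r.marg y)))).card)
      (fun ω => measurable_comp_mem (measurableSet_leftSet _ _) (measurableSet_leftSet _ _)
        fun p q => ((symmDiff ((l.process x ω).out p) ((l.process y ω).out q)).card : ENNReal))
      (fun ω => measurable_comp_mem (measurableSet_rightSet _ _) (measurableSet_rightSet _ _)
        fun p q => ((symmDiff ((r.process x ω).out p) ((r.process y ω).out q)).card : ENNReal))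
      (fun ωl ωr θ θr => by
        rw [output_node, output_node]
        exact_mod_cast card_symmDiff_union_le _ _ _ _)
    -- The new level pays 2ε for recoupling the child on the path and 2ε for the bit of its sibling.
    have total : ∀ d : ℕ, d ≤ max l.depth r.depth → ENNReal.ofReal ((1 + 4 * d) * ε) +
        ENNReal.ofReal (2 * ε) + ENNReal.ofReal (2 * ε) ≤
          ENNReal.ofReal ((1 + 4 * (node l r).depth) * ε) := by
      intro d hd
      rw [← ENNReal.ofReal_add (by positivity) (by positivity),
        ← ENNReal.ofReal_add (by positivity) (by positivity)]
      refine ENNReal.ofReal_le_ofReal ?_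
      have : (d : ℝ) ≤ (max l.depth r.depth : ℕ) := by exact_mod_cast hd
      simp only [depth, Nat.cast_add, Nat.cast_one]
      nlinarith
    simp only [count] at hT
    rcases Nat.eq_zero_or_pos (r.count h) with h0 | h0
    · obtain ⟨ih1, ih2⟩ := ihl (by omega)
      have er := marg_congr hxy r h0
      refine ⟨by simp only [marg]; rw [← er]; exact ih1.combine_left hε1 hlx hrx hly, ?_⟩
      refine bound.trans (le_trans (add_le_add (?_ : _ ≤ ENNReal.ofReal ((1 + 4 * l.depth) * ε) +
        ENNReal.ofReal (2 * ε)) (?_ : _ ≤ ENNReal.ofReal (2 * ε))) (total _ (le_max_left _ _)))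
      -- The induction hypothesis couples the two root bits of `l` monotonically, by a common
      -- threshold. The events `leftSet` have the same probabilities and fail to be monotone by at
      -- most ε.
      · rw [lintegral_law x y _ fun s t => ((symmDiff s t).card : ENNReal)] at ih2
        refine le_trans ?_ (add_le_add_left ih2 _)
        rw [← mul_one (ENNReal.ofReal (2 * ε)), ← measure_univ (μ := l.seedLaw), ← lintegral_const,
          ← lintegral_add_right _ measurable_const]
        refine lintegral_mono fun ω => ?_
        rw [← er]
        refine lintegral_two_events_le
          (D := fun p q => (symmDiff ((l.process x ω).out p) ((l.process y ω).out q)).card)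
          (measurableSet_leftSet _ _) (measurableSet_leftSet _ _) measurableSet_Iic
          measurableSet_Iic ?_ ?_ (mono _ _) (NodeState.card_symmDiff_out_swap _ _)
          (ih1.leftSet_min_diff_le hlx hrx hly hε)
        · rw [thresholdLaw_leftSet hlx hrx, unif_real_Iic hlx.1 hlx.2]
        · rw [thresholdLaw_leftSet hly hrx, unif_real_Iic hly.1 hly.2]
      -- The sibling does not contain `h`, so it sends the same state for both inputs and only its
      -- bit may differ.
      · refine (lintegral_mono (g := fun _ => ENNReal.ofReal (2 * ε)) fun ω => ?_).trans (by simp)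
        rw [← er, ← process_congr hxy r h0]
        refine (lintegral_out_symmDiff_le _ (measurableSet_rightSet _ _)
          (measurableSet_rightSet _ _)).trans ?_
        rw [← ofReal_measureReal]
        exact ENNReal.ofReal_le_ofReal (ih1.rightSet_symmDiff_le hlx hrx hly hε)
    · have h0' : l.count h = 0 := by omega
      obtain ⟨ih1, ih2⟩ := ihr (by omega)
      have el := marg_congr hxy l h0'
      refine ⟨by simp only [marg]; rw [← el]; exact ih1.combine_right hε1 hlx hrx hry, ?_⟩
      refine bound.trans (le_trans (le_of_eq (add_comm _ _)) (le_trans (add_le_add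
        (?_ : _ ≤ ENNReal.ofReal ((1 + 4 * r.depth) * ε) +
        ENNReal.ofReal (2 * ε)) (?_ : _ ≤ ENNReal.ofReal (2 * ε))) (total _ (le_max_right _ _))))
      · rw [lintegral_law x y _ fun s t => ((symmDiff s t).card : ENNReal)] at ih2
        refine le_trans ?_ (add_le_add_left ih2 _)
        rw [← mul_one (ENNReal.ofReal (2 * ε)), ← measure_univ (μ := r.seedLaw), ← lintegral_const,
          ← lintegral_add_right _ measurable_const]
        refine lintegral_mono fun ω => ?_
        rw [← el]
        refine lintegral_two_events_le
          (D := fun p q => (symmDiff ((r.process x ω).out p) ((r.process y ω).out q)).card)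
          (measurableSet_rightSet _ _) (measurableSet_rightSet _ _) measurableSet_Iic
          measurableSet_Iic ?_ ?_ (mono _ _) (NodeState.card_symmDiff_out_swap _ _)
          (ih1.rightSet_min_diff_le hlx hrx hry hε)
        · rw [thresholdLaw_rightSet hlx hrx, unif_real_Iic hrx.1 hrx.2]
        · rw [thresholdLaw_rightSet hlx hry, unif_real_Iic hry.1 hry.2]
      · refine (lintegral_mono (g := fun _ => ENNReal.ofReal (2 * ε)) fun ω => ?_).trans (by simp)
        rw [← el, ← process_congr hxy l h0']
        refine (lintegral_out_symmDiff_le _ (measurableSet_leftSet _ _)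
          (measurableSet_leftSet _ _)).trans ?_
        rw [← ofReal_measureReal]
        exact ENNReal.ofReal_le_ofReal (ih1.leftSet_symmDiff_le hlx hrx hry hε)

end step

end CoordTree

end CorrelatedSampling

end

noncomputable section

namespace CorrelatedSampling

/-! ### Reduction to inputs that differ in one coordinate -/

lemma l1_eq_sum {n : ℕ} {x : Fin n → ℝ} (hx : ∀ i, 0 ≤ x i) : l1 x = ∑ i, x i :=
  Finset.sum_congr rfl fun i _ => abs_of_nonneg (hx i)

/-- Switch the coordinates from `x` to `y` one after the other. Every hybrid lies between 0 and `y`,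
hence in `P`, and the increments of the steps add up. -/
lemma le_ofReal_l1_of_le {n : ℕ} {P : Set (Fin n → ℝ)}
    (hP : ∀ x ∈ P, (∀ i, 0 ≤ x i) ∧ ∀ z, (∀ i, 0 ≤ z i) → z ≤ x → z ∈ P)
    {d : (Fin n → ℝ) → (Fin n → ℝ) → ENNReal} {K : ℝ} (hK : 0 ≤ K)
    (hself : ∀ x ∈ P, d x x = 0)
    (htri : ∀ x ∈ P, ∀ y ∈ P, ∀ z ∈ P, d x z ≤ d x y + d y z)
    (hstep : ∀ x ∈ P, ∀ y ∈ P, ∀ i ε, 0 < ε → y = Function.update x i (x i + ε) →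
      d x y ≤ ENNReal.ofReal (K * ε))
    {x y : Fin n → ℝ} (hx : x ∈ P) (hy : y ∈ P) (hxy : x ≤ y) :
    d x y ≤ ENNReal.ofReal (K * ∑ i, (y i - x i)) := by
  classical
  let z : Finset (Fin n) → Fin n → ℝ := fun s i => if i ∈ s then y i else x i
  have hz : ∀ s, z s ∈ P := by
    refine fun s => (hP y hy).2 _ (fun i => ?_) fun i => ?_
    · have h1 := (hP x hx).1 i
      have h2 := (hP y hy).1 i
      dsimp only [z]; split_ifs <;> assumption
    · dsimp only [z]; split_ifs; exacts [le_rfl, hxy i]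
  have key : ∀ s : Finset (Fin n), d x (z s) ≤ ENNReal.ofReal (K * ∑ i ∈ s, (y i - x i)) := by
    intro s
    induction s using Finset.induction_on with
    | empty =>
      have : z ∅ = x := by ext i; simp [z]
      rw [this, hself x hx]; exact zero_le
    | insert i s hi ih =>
      have h0 : 0 ≤ y i - x i := sub_nonneg.2 (hxy i)
      rw [Finset.sum_insert hi, add_comm, mul_add, ENNReal.ofReal_add
        (mul_nonneg hK (Finset.sum_nonneg fun j _ => sub_nonneg.2 (hxy j))) (mul_nonneg hK h0)]
      have hu : z (insert i s) = Function.update (z s) i (z s i + (y i - x i)) := by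
        ext j
        rcases eq_or_ne j i with rfl | hj
        · simp [z, hi]
        · simp [z, hj]
      refine (htri _ hx _ (hz s) _ (hz _)).trans (add_le_add ih ?_)
      rcases h0.eq_or_lt with h | h
      · rw [hu, ← h, add_zero, Function.update_eq_self, hself _ (hz s)]; exact zero_le
      · exact hstep _ (hz s) _ (hz _) i _ h hu
  have : z Finset.univ = y := by ext i; simp [z]
  simpa [this] using key Finset.univ

/-- A pseudometric on a downward closed set of nonnegative vectors that is Lipschitz along
coordinate directions is Lipschitz for the `ℓ₁` norm. -/
lemma le_ofReal_l1 {n : ℕ} {P : Set (Fin n → ℝ)}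
    (hP : ∀ x ∈ P, (∀ i, 0 ≤ x i) ∧ ∀ z, (∀ i, 0 ≤ z i) → z ≤ x → z ∈ P)
    {d : (Fin n → ℝ) → (Fin n → ℝ) → ENNReal} {K : ℝ} (hK : 0 ≤ K)
    (hself : ∀ x ∈ P, d x x = 0) (hsymm : ∀ x ∈ P, ∀ y ∈ P, d x y = d y x)
    (htri : ∀ x ∈ P, ∀ y ∈ P, ∀ z ∈ P, d x z ≤ d x y + d y z)
    (hstep : ∀ x ∈ P, ∀ y ∈ P, ∀ i ε, 0 < ε → y = Function.update x i (x i + ε) →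
      d x y ≤ ENNReal.ofReal (K * ε))
    {x y : Fin n → ℝ} (hx : x ∈ P) (hy : y ∈ P) :
    d x y ≤ ENNReal.ofReal (K * l1 (x - y)) := by
  -- Passing through the meet makes both halves of the path monotone and keeps it inside the
  -- downward closed set.
  have hz : x ⊓ y ∈ P :=
    (hP x hx).2 _ (fun i => le_inf ((hP x hx).1 i) ((hP y hy).1 i)) inf_le_left
  refine (htri x hx _ hz y hy).trans ?_
  rw [hsymm x hx _ hz]
  refine (add_le_add (le_ofReal_l1_of_le hP hK hself htri hstep hz hx inf_le_left)
    (le_ofReal_l1_of_le hP hK hself htri hstep hz hy inf_le_right)).trans_eq ?_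
  rw [← ENNReal.ofReal_add
    (mul_nonneg hK (Finset.sum_nonneg fun j _ => sub_nonneg.2 (inf_le_left (a := x) j)))
    (mul_nonneg hK (Finset.sum_nonneg fun j _ => sub_nonneg.2 (inf_le_right (a := x) j))),
    ← mul_add, ← Finset.sum_add_distrib]
  congr 2
  refine Finset.sum_congr rfl fun i _ => ?_
  simp only [Pi.inf_apply, Pi.sub_apply]
  rcases le_total (x i) (y i) with h | h
  · rw [inf_eq_left.2 h, abs_of_nonpos (by linarith)]; ring
  · rw [inf_eq_right.2 h, abs_of_nonneg (by linarith)]; ring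

lemma hypersimplex_lower {n k : ℕ} (x : Fin n → ℝ) (hx : x ∈ hypersimplex n k) :
    (∀ i, 0 ≤ x i) ∧ ∀ z, (∀ i, 0 ≤ z i) → z ≤ x → z ∈ hypersimplex n k := by
  refine ⟨fun i => (hx.1 i).1, fun z hz hzx => ⟨fun i => ⟨hz i, (hzx i).trans (hx.1 i).2⟩, ?_⟩⟩
  have := hx.2
  rw [l1_eq_sum fun i => (hx.1 i).1] at this
  rw [l1_eq_sum hz]
  exact (Finset.sum_le_sum fun i _ => hzx i).trans this

/-! ### The balanced tree -/

lemma count_balancedTree (h a len : ℕ) (hlen : 1 ≤ len) :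
    (balancedTree a len).count h = if a ≤ h ∧ h < a + len then 1 else 0 := by
  induction len using Nat.strong_induction_on generalizing a with
  | _ len ih =>
    rw [balancedTree]
    split_ifs with h1 h2 h2
    · have : a = h := by omega
      simp [CoordTree.count, this]
    · have : a ≠ h := by omega
      simp [CoordTree.count, this]
    all_goals
      rw [CoordTree.count, ih _ (by omega) _ (by omega), ih _ (by omega) _ (by omega)]
      split_ifs <;> omega

lemma depth_balancedTree_le (j a len : ℕ) (hlen : len ≤ 2 ^ j) :
    (balancedTree a len).depth ≤ j := by
  induction j generalizing a len with
  | zero => rw [balancedTree, if_pos (by simpa using hlen)]; exact le_rfl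
  | succ j ih =>
    rw [balancedTree]
    split_ifs with h1
    · exact Nat.zero_le _
    · rw [CoordTree.depth]
      have h2 := ih a (len / 2) (by omega)
      have h3 := ih (a + len / 2) (len - len / 2) (by omega)
      omega

/-! ### Coordinate tree rounding in dimension `d` -/

/-- Extension of a vector by zeros. -/
def extend {d : ℕ} (x : Fin d → ℝ) (i : ℕ) : ℝ := if h : i < d then x ⟨i, h⟩ else 0

lemma treeRounding_eq {d : ℕ} (ω : TreeSeed d) (x : Fin d → ℝ) :
    treeRounding ω x =
      ({h | (h : ℕ) ∈ (balancedTree 0 d).output (extend x) ω} : Finset (Fin d)) := by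
  simp only [treeRounding, CoordTree.output, NodeState.out, CoordTree.process_marginal]
  ext h
  unfold extend
  split_ifs <;> simp only [Finset.mem_filter]

instance (d : ℕ) : IsProbabilityMeasure (treeLaw d) := by unfold treeLaw; infer_instance

lemma measurable_treeRounding {d : ℕ} (x : Fin d → ℝ) :
    Measurable fun ω : TreeSeed d => treeRounding ω x := by
  simp only [treeRounding_eq]
  exact (measurable_of_countable fun s : Finset ℕ => ({h | (h : ℕ) ∈ s} : Finset (Fin d))).comp
    (CoordTree.measurable_output _ _)

lemma extend_mem {d : ℕ} {x : Fin d → ℝ} (hx : ∀ i, x i ∈ Set.Icc (0 : ℝ) 1) (i : ℕ) :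
    extend x i ∈ Set.Icc (0 : ℝ) 1 := by
  unfold extend
  split_ifs
  exacts [hx _, zero_mem_Icc]

lemma treeLaw_mem_le {d : ℕ} {x : Fin d → ℝ} (hx : ∀ i, x i ∈ Set.Icc (0 : ℝ) 1) (h : Fin d) :
    treeLaw d {ω | h ∈ treeRounding ω x} ≤ ENNReal.ofReal (x h) := by
  have hd : 1 ≤ d := by have := h.2; omega
  have hc : (balancedTree 0 d).count h = 1 := by
    rw [count_balancedTree _ _ _ hd, if_pos ⟨Nat.zero_le _, by simp⟩]
  have := CoordTree.law_mem_output_le (extend_mem hx) (balancedTree 0 d) (h := h) hc.le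
  rw [hc, Nat.cast_one, one_mul] at this
  have e : extend x h = x h := by simp [extend]
  rw [e] at this
  refine le_trans (le_of_eq ?_) this
  rw [← lintegral_indicator_one]
  · refine lintegral_congr fun ω => ?_
    simp [Set.indicator_apply, treeRounding_eq]
  · exact measurable_treeRounding x (MeasurableSet.of_discrete (s := {s | h ∈ s}))

/-- The stretch of coordinate tree rounding in dimension `d`. -/
def treeStretch (d : ℕ) : ℝ := 1 + 4 * Nat.clog 2 d

lemma treeStretch_nonneg (d : ℕ) : 0 ≤ treeStretch d := by unfold treeStretch; positivity

lemma measurable_card_symmDiff {Ω : Type*} [MeasurableSpace Ω] {α : Type*} [Countable α]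
    [DecidableEq α] {f g : Ω → Finset α} (hf : Measurable f) (hg : Measurable g) :
    Measurable fun ω => ((symmDiff (f ω) (g ω)).card : ENNReal) := by
  have h : Measurable fun p : Finset α × Finset α => (symmDiff p.1 p.2).card :=
    measurable_of_countable _
  have h1 : Measurable fun ω => (f ω, g ω) := hf.prodMk hg
  exact (Measurable.of_discrete (f := fun n : ℕ => (n : ENNReal))).comp (h.comp h1)

lemma lintegral_symmDiff_triangle {Ω : Type*} [MeasurableSpace Ω] {μ : Measure Ω} {α : Type*}
    [Countable α] [DecidableEq α] {f g k : Ω → Finset α} (hf : Measurable f) (hg : Measurable g) :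
    ∫⁻ ω, ((symmDiff (f ω) (k ω)).card : ENNReal) ∂μ ≤
      ∫⁻ ω, ((symmDiff (f ω) (g ω)).card : ENNReal) ∂μ +
        ∫⁻ ω, ((symmDiff (g ω) (k ω)).card : ENNReal) ∂μ := by
  rw [← lintegral_add_left (measurable_card_symmDiff hf hg)]
  refine lintegral_mono fun ω => ?_
  rw [← Nat.cast_add, Nat.cast_le]
  exact card_symmDiff_le_add _ _ _

lemma treeRounding_step {d : ℕ} {x y : Fin d → ℝ} (hx : ∀ i, x i ∈ Set.Icc (0 : ℝ) 1)
    (hy : ∀ i, y i ∈ Set.Icc (0 : ℝ) 1) {h : Fin d} {ε : ℝ} (hε : 0 ≤ ε)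
    (hxy : y = Function.update x h (x h + ε)) :
    ∫⁻ ω, ((symmDiff (treeRounding ω x) (treeRounding ω y)).card : ENNReal) ∂treeLaw d ≤
      ENNReal.ofReal (treeStretch d * ε) := by
  have hd : 1 ≤ d := by have := h.2; omega
  have hc : (balancedTree 0 d).count h = 1 := by
    rw [count_balancedTree _ _ _ hd, if_pos ⟨Nat.zero_le _, by simp⟩]
  have key := (CoordTree.shift_and_cost_le (extend_mem hx) (extend_mem hy) (h := h) hε
    (fun i hi => by
      unfold extend
      split_ifs with hid
      · rw [hxy, Function.update_of_ne (fun e => hi (by rw [← e]))]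
      · rfl) (by simp [extend, hxy]) (balancedTree 0 d) hc).2
  refine (lintegral_mono fun ω => ?_).trans (key.trans (ENNReal.ofReal_le_ofReal ?_))
  · rw [treeRounding_eq, treeRounding_eq, Nat.cast_le]
    refine Finset.card_le_card_of_injOn (fun i : Fin d => (i : ℕ)) ?_ Fin.val_injective.injOn
    intro i hi
    simpa [Set.mem_symmDiff] using hi
  · unfold treeStretch
    have : ((balancedTree 0 d).depth : ℝ) ≤ Nat.clog 2 d := by
      exact_mod_cast depth_balancedTree_le _ _ _ (Nat.le_pow_clog one_lt_two d)
    gcongr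

/-- The stretch bound for coordinate tree rounding. -/
lemma treeRounding_stretch {d : ℕ} {x y : Fin d → ℝ} (hx : ∀ i, x i ∈ Set.Icc (0 : ℝ) 1)
    (hy : ∀ i, y i ∈ Set.Icc (0 : ℝ) 1) :
    ∫⁻ ω, ((symmDiff (treeRounding ω x) (treeRounding ω y)).card : ENNReal) ∂treeLaw d ≤
      ENNReal.ofReal (treeStretch d * l1 (x - y)) :=
  le_ofReal_l1 (P := {x | ∀ i, x i ∈ Set.Icc (0 : ℝ) 1})
    (d := fun x y => ∫⁻ ω, ((symmDiff (treeRounding ω x) (treeRounding ω y)).card : ENNReal)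
      ∂treeLaw d)
    (fun x hx => ⟨fun i => (hx i).1, fun z hz hzx i => ⟨hz i, (hzx i).trans (hx i).2⟩⟩)
    (treeStretch_nonneg d) (fun x _ => by simp) (fun x _ y _ => by simp only [symmDiff_comm])
    (fun x _ y _ z _ => lintegral_symmDiff_triangle (measurable_treeRounding x)
      (measurable_treeRounding y))
    (fun x hx y hy i ε hε hxy => treeRounding_step hx hy hε.le hxy) hx hy

end CorrelatedSampling

end

noncomputable section

namespace CorrelatedSampling

/-! ### Exponential clocks -/

instance : IsProbabilityMeasure (expMeasure 1) := isProbabilityMeasure_expMeasure one_pos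

instance (n : ℕ) : IsProbabilityMeasure (clockLaw n) := by unfold clockLaw; infer_instance

lemma expMeasure_eq_withDensity (r : ℝ) :
    expMeasure r = volume.withDensity (exponentialPDF r) := rfl

lemma measurable_exponentialPDF (r : ℝ) : Measurable (exponentialPDF r) :=
  (measurable_exponentialPDFReal r).ennreal_ofReal

lemma expMeasure_Ioi {c : ℝ} (hc : 0 ≤ c) :
    expMeasure 1 (Set.Ioi c) = ENNReal.ofReal (Real.exp (-c)) := by
  rw [← ofReal_measureReal, ← Set.compl_Iic, probReal_compl_eq_one_sub measurableSet_Iic,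
    ← cdf_eq_real, cdf_expMeasure_eq one_pos, if_pos hc]
  simp

lemma expMeasure_Ici {c : ℝ} (hc : 0 ≤ c) :
    expMeasure 1 (Set.Ici c) = ENNReal.ofReal (Real.exp (-c)) := by
  have : NullSingletonClass (expMeasure 1) := by
    rw [expMeasure_eq_withDensity]; infer_instance
  rw [← expMeasure_Ioi hc]
  exact (measure_congr Ioi_ae_eq_Ici).symm

lemma expMeasure_Iio_zero : expMeasure 1 (Set.Iio 0) = 0 := by
  rw [expMeasure_eq_withDensity, withDensity_apply _ measurableSet_Iio,
    lintegral_exponentialPDF_of_nonpos le_rfl]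

lemma lintegral_exp_neg_expMeasure {c : ℝ} (hc : 0 ≤ c) :
    ∫⁻ t, ENNReal.ofReal (Real.exp (-(c * t))) ∂expMeasure 1 = ENNReal.ofReal (1 / (1 + c)) := by
  have h1 : 0 < 1 + c := by linarith
  rw [expMeasure_eq_withDensity, lintegral_withDensity_eq_lintegral_mul _
    (measurable_exponentialPDF 1) (by fun_prop)]
  have : ∀ t, (exponentialPDF 1 * fun t => ENNReal.ofReal (Real.exp (-(c * t)))) t =
      ENNReal.ofReal (1 / (1 + c)) * exponentialPDF (1 + c) t := by
    intro t
    rw [Pi.mul_apply, exponentialPDF_eq, exponentialPDF_eq, ← ENNReal.ofReal_mul (by split_ifs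
        <;> positivity),
      ← ENNReal.ofReal_mul (by positivity)]
    congr 1
    split_ifs
    · rw [one_mul, one_mul, ← Real.exp_add]
      field_simp
      congr 1
      ring
    · simp
  rw [lintegral_congr this, lintegral_const_mul _ (measurable_exponentialPDF _),
    lintegral_exponentialPDF_eq_one h1, mul_one]

lemma ae_clockLaw_nonneg (n : ℕ) : ∀ᵐ E ∂clockLaw n, ∀ j, 0 ≤ E j := by
  rw [ae_all_iff]
  intro j
  have h : ∀ᵐ t ∂expMeasure 1, 0 ≤ t := by
    rw [ae_iff]
    simpa [Set.Iio_def] using expMeasure_Iio_zero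
  exact (Measure.quasiMeasurePreserving_eval (fun _ : Fin n => expMeasure 1) j).ae h

/-- Condition on `E i = t`: the other clocks contribute ∏ exp(-u j·t), and the exponential density
integrates this to 1/(1 + ∑ u j). The family `S` covers both open and closed half-lines, that is,
strict and weak victories of `i`. -/
lemma clockLaw_forall_ne {n : ℕ} (i : Fin n) {S : ℝ → Set ℝ}
    (hS : ∀ c, 0 ≤ c → expMeasure 1 (S c) = ENNReal.ofReal (Real.exp (-c)))
    {u : Fin n → ℝ} (hu : ∀ j, 0 ≤ u j)
    (hm : ∀ j, MeasurableSet {p : ℝ × ℝ | p.2 ∈ S (u j * p.1)}) :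
    clockLaw n {E | ∀ j, j ≠ i → E j ∈ S (u j * E i)} =
      ENNReal.ofReal (1 / (1 + ∑ j ∈ Finset.univ.erase i, u j)) := by
  obtain _ | n := n
  · exact i.elim0
  have hmp := measurePreserving_piFinSuccAbove (fun _ : Fin (n + 1) => expMeasure 1) i
  have hset : {E : Fin (n + 1) → ℝ | ∀ j, j ≠ i → E j ∈ S (u j * E i)} =
      MeasurableEquiv.piFinSuccAbove (fun _ => ℝ) i ⁻¹'
        {p : ℝ × (Fin n → ℝ) | ∀ j, p.2 j ∈ S (u (i.succAbove j) * p.1)} := by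
    ext E
    simp only [Set.mem_ofPred_eq, Set.mem_preimage]
    constructor
    · exact fun h j => h _ (Fin.succAbove_ne i j)
    · intro h j hj
      obtain ⟨l, rfl⟩ := Fin.exists_succAbove_eq hj
      exact h l
  have hmeas : MeasurableSet
      {p : ℝ × (Fin n → ℝ) | ∀ j, p.2 j ∈ S (u (i.succAbove j) * p.1)} := by
    have : {p : ℝ × (Fin n → ℝ) | ∀ j, p.2 j ∈ S (u (i.succAbove j) * p.1)} =
        ⋂ j, (fun p : ℝ × (Fin n → ℝ) => (p.1, p.2 j)) ⁻¹'
          {p : ℝ × ℝ | p.2 ∈ S (u (i.succAbove j) * p.1)} := by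
      ext p; simp
    rw [this]
    exact MeasurableSet.iInter fun j =>
      (measurable_fst.prodMk ((measurable_pi_apply j).comp measurable_snd)) (hm _)
  rw [clockLaw, hset, hmp.measure_preimage hmeas.nullMeasurableSet, Measure.prod_apply hmeas]
  have hsum : ∑ j ∈ Finset.univ.erase i, u j = ∑ j, u (i.succAbove j) := by
    rw [← add_right_inj (u i), Finset.add_sum_erase _ _ (Finset.mem_univ i), Fin.sum_univ_succAbove]
  rw [hsum, ← lintegral_exp_neg_expMeasure (Finset.sum_nonneg fun j _ => hu _)]
  have h : ∀ᵐ t ∂expMeasure 1, 0 ≤ t := by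
    rw [ae_iff]
    simpa [Set.Iio_def] using expMeasure_Iio_zero
  refine lintegral_congr_ae (h.mono fun t ht => ?_)
  have : Prod.mk t ⁻¹' {p : ℝ × (Fin n → ℝ) | ∀ j, p.2 j ∈ S (u (i.succAbove j) * p.1)} =
      Set.univ.pi fun j => S (u (i.succAbove j) * t) := by
    ext F; simp
  dsimp only
  rw [this, Measure.pi_pi]
  rw [Finset.prod_congr rfl fun j _ => hS _ (mul_nonneg (hu _) ht),
    ← ENNReal.ofReal_prod_of_nonneg fun _ _ => (Real.exp_pos _).le, ← Real.exp_sum,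
    Finset.sum_neg_distrib, Finset.sum_mul]

lemma mem_expClocks {n : ℕ} {E v : Fin n → ℝ} {i : Fin n} : i ∈ expClocks E v ↔
    0 < v i ∧ ∀ j, 0 < v j → E i / v i < E j / v j ∨ (E i / v i = E j / v j ∧ i ≤ j) := by
  simp [expClocks]

lemma expClocks_unique {n : ℕ} {E v : Fin n → ℝ} {i j : Fin n} (hi : i ∈ expClocks E v)
    (hj : j ∈ expClocks E v) : i = j := by
  rw [mem_expClocks] at hi hj
  have h1 := hi.2 j hj.1
  have h2 := hj.2 i hi.1
  rcases h1 with h1 | h1 <;> rcases h2 with h2 | h2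
  · linarith
  · linarith [h2.1]
  · linarith [h1.1]
  · exact le_antisymm h1.2 h2.2

lemma card_expClocks_le {n : ℕ} (E v : Fin n → ℝ) : (expClocks E v).card ≤ 1 :=
  Finset.card_le_one.2 fun _ hi _ hj => expClocks_unique hi hj

/-- Scaling all weights scales all arrival times alike, so weights need not be normalised by the
load of the bucket. -/
lemma expClocks_smul {n : ℕ} (E v : Fin n → ℝ) {c : ℝ} (hc : 0 < c) :
    expClocks E (fun i => v i / c) = expClocks E v := by
  ext i
  have h : ∀ j, E j / (v j / c) = c * (E j / v j) := fun j => by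
    rw [div_div_eq_mul_div]; ring
  have h1 : ∀ j, 0 < v j / c ↔ 0 < v j := fun j => div_pos_iff_of_pos_right hc
  simp only [mem_expClocks, h, h1, mul_lt_mul_iff_right₀ hc, mul_right_inj' hc.ne']

lemma measurableSet_mem_expClocks {n : ℕ} (v : Fin n → ℝ) (i : Fin n) :
    MeasurableSet {E | i ∈ expClocks E v} := by
  have e : {E | i ∈ expClocks E v} = {_E | 0 < v i} ∩ ⋂ j, {E | 0 < v j →
      E i / v i < E j / v j ∨ (E i / v i = E j / v j ∧ i ≤ j)} := by
    ext E; simp [mem_expClocks]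
  rw [e]
  have h : ∀ j, Measurable fun E : Fin n → ℝ => E j / v j := fun j =>
    (measurable_pi_apply j).div_const _
  refine (MeasurableSet.const _).inter (MeasurableSet.iInter fun j => ?_)
  by_cases hj : 0 < v j
  · simp only [hj, true_imp_iff]
    exact (measurableSet_lt (h i) (h j)).union
      ((measurableSet_eq_fun (h i) (h j)).inter (MeasurableSet.const _))
  · simp [hj]

lemma measurable_of_mem {Ω : Type*} [MeasurableSpace Ω] {n : ℕ} {f : Ω → Finset (Fin n)}
    (hf : ∀ i, MeasurableSet {ω | i ∈ f ω}) : Measurable f := by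
  refine measurable_to_countable' fun s => ?_
  have : f ⁻¹' {s} = ⋂ i, {ω | i ∈ f ω ↔ i ∈ s} := by
    ext ω
    simp [Finset.ext_iff]
  rw [this]
  exact MeasurableSet.iInter fun i => by
    by_cases hi : i ∈ s
    · simpa [hi] using hf i
    · have e : {ω | i ∈ f ω ↔ i ∈ s} = {ω | i ∈ f ω}ᶜ := by ext; simp [hi]
      rw [e]
      exact (hf i).compl

lemma measurable_expClocks {n : ℕ} (v : Fin n → ℝ) : Measurable fun E => expClocks E v :=
  measurable_of_mem (measurableSet_mem_expClocks v)

/-- The winner changes only if the index whose weight increases becomes the winner. -/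
lemma expClocks_ne_imp {n : ℕ} {E v w : Fin n → ℝ} (hE : ∀ j, 0 ≤ E j) {i : Fin n} {ε : ℝ}
    (hε : 0 < ε) (hv : ∀ j, 0 ≤ v j) (hw : w = Function.update v i (v i + ε))
    (hne : expClocks E v ≠ expClocks E w) :
    (∀ j, j ≠ i → E j ∈ Set.Ici (v j / w i * E i)) ∧
      ¬ (0 < v i ∧ ∀ j, j ≠ i → E j ∈ Set.Ioi (v j / v i * E i)) := by
  have hwi : w i = v i + ε := by simp [hw]
  have hwj : ∀ j, j ≠ i → w j = v j := fun j hj => by rw [hw, Function.update_of_ne hj]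
  have hwpos : 0 < w i := by linarith [hv i]
  have hle : 0 < v i → E i / w i ≤ E i / v i := fun h =>
    div_le_div_of_nonneg_left (hE i) h (by linarith)
  constructor
  -- Such a `j` strictly beats `i` even under the larger weight. Then `i` loses in both races, and
  -- the contest among the others is the same.
  · by_contra! hj
    obtain ⟨j, hji, hj⟩ := hj
    rw [Set.mem_Ici, not_le] at hj
    have hvj : 0 < v j := by
      refine (hv j).lt_of_ne fun h => ?_
      rw [← h, zero_div, zero_mul] at hj
      exact absurd (hE j) hj.not_ge
    have hlt : E j / v j < E i / w i := by
      rw [div_lt_div_iff₀ hvj hwpos]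
      rwa [div_mul_eq_mul_div, lt_div_iff₀ hwpos, mul_comm (v j)] at hj
    refine hne (Finset.ext fun a => ?_)
    rw [mem_expClocks, mem_expClocks]
    rcases eq_or_ne a i with rfl | ha
    · constructor
      · rintro ⟨h1, h2⟩
        rcases h2 j hvj with h | h
        · linarith [hle h1]
        · linarith [hle h1, h.1]
      · rintro ⟨-, h2⟩
        have := h2 j (by rwa [hwj j hji])
        rw [hwj j hji] at this
        rcases this with h | h
        · linarith
        · linarith [h.1]
    · rw [hwj a ha]
      refine and_congr_right fun hva => ⟨fun h b hb => ?_, fun h b hb => ?_⟩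
      · rcases eq_or_ne b i with rfl | hbi
        · left
          rcases h j hvj with h | h
          · linarith
          · linarith [h.1]
        · rw [hwj b hbi] at hb ⊢
          exact h b hb
      · rcases eq_or_ne b i with rfl | hbi
        · left
          have := h j (by rwa [hwj j hji])
          rw [hwj j hji] at this
          have h3 := hle hb
          rcases this with h | h
          · linarith
          · linarith [h.1]
        · have := h b (by rwa [hwj b hbi])
          rwa [hwj b hbi] at this
  · rintro ⟨hvi, hj⟩
    have hlt : ∀ j, j ≠ i → 0 < v j → E i / v i < E j / v j := fun j hji hvj => by
      have := hj j hji
      rw [Set.mem_Ioi, div_mul_eq_mul_div, div_lt_iff₀ hvi] at this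
      rw [div_lt_div_iff₀ hvi hvj]
      linarith
    have h1 : i ∈ expClocks E v := by
      refine mem_expClocks.2 ⟨hvi, fun j hvj => ?_⟩
      rcases eq_or_ne j i with rfl | hji
      · exact Or.inr ⟨rfl, le_rfl⟩
      · exact Or.inl (hlt j hji hvj)
    have h2 : i ∈ expClocks E w := by
      refine mem_expClocks.2 ⟨hwpos, fun j hwj' => ?_⟩
      rcases eq_or_ne j i with rfl | hji
      · exact Or.inr ⟨rfl, le_rfl⟩
      · rw [hwj j hji] at hwj' ⊢
        exact Or.inl ((hle hvi).trans_lt (hlt j hji hwj'))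
    exact hne (Finset.ext fun a =>
      ⟨fun ha => expClocks_unique ha h1 ▸ h2, fun ha => expClocks_unique ha h2 ▸ h1⟩)

/-- Increasing one weight by `ε` changes the winner with probability at most `ε` divided by the
total weight. -/
lemma clockLaw_expClocks_ne_le {n : ℕ} {v w : Fin n → ℝ} {i : Fin n} {ε : ℝ}
    (hε : 0 < ε) (hv : ∀ j, 0 ≤ v j) (hw : w = Function.update v i (v i + ε)) :
    clockLaw n {E | expClocks E v ≠ expClocks E w} ≤ ENNReal.ofReal (ε / ∑ j, w j) := by
  have hwi : w i = v i + ε := by simp [hw]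
  have hwpos : 0 < w i := by linarith [hv i]
  set V : ℝ := ∑ j ∈ Finset.univ.erase i, v j with hV
  have hV0 : 0 ≤ V := Finset.sum_nonneg fun j _ => hv j
  have hW : ∑ j, w j = v i + ε + V := by
    rw [← Finset.add_sum_erase _ _ (Finset.mem_univ i), hwi, hV]
    congr 1
    refine Finset.sum_congr rfl fun j hj => ?_
    rw [hw, Function.update_of_ne (Finset.ne_of_mem_erase hj)]
  -- `A` says that `i` wins weakly with its new weight, `B` below that it wins strictly with its old
  -- one. A change of winner forces `A \ B`, or just `A` if the old weight is zero.
  set A : Set (Fin n → ℝ) := {E | ∀ j, j ≠ i → E j ∈ Set.Ici (v j / w i * E i)}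
  have hA : clockLaw n A = ENNReal.ofReal (w i / (w i + V)) := by
    rw [clockLaw_forall_ne i (fun c hc => expMeasure_Ici hc)
      (fun j => div_nonneg (hv j) hwpos.le)
      (fun j => measurableSet_le (measurable_const.mul measurable_fst) measurable_snd),
      ← Finset.sum_div, ← hV]
    congr 1
    field_simp
  rw [hW]
  rcases (hv i).eq_or_lt with h0 | h0
  · refine (measure_mono_ae (t := A) ((ae_clockLaw_nonneg n).mono fun E hE hne =>
      (expClocks_ne_imp hE hε hv hw hne).1)).trans (hA.trans_le ?_)
    rw [hwi, ← h0, zero_add]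
  · set B : Set (Fin n → ℝ) := {E | ∀ j, j ≠ i → E j ∈ Set.Ioi (v j / v i * E i)}
    have hB : clockLaw n B = ENNReal.ofReal (v i / (v i + V)) := by
      rw [clockLaw_forall_ne i (fun c hc => expMeasure_Ioi hc)
        (fun j => div_nonneg (hv j) h0.le)
        (fun j => measurableSet_lt (measurable_const.mul measurable_fst) measurable_snd),
        ← Finset.sum_div, ← hV]
      congr 1
      field_simp
    have hBm : MeasurableSet B := by
      have : B = ⋂ j, {E | j ≠ i → v j / v i * E i < E j} := by ext E; simp [B]
      rw [this]
      refine MeasurableSet.iInter fun j => ?_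
      by_cases hj : j = i
      · simp [hj]
      · simp only [ne_eq, hj, not_false_eq_true, true_imp_iff]
        exact measurableSet_lt (measurable_const.mul (measurable_pi_apply i))
          (measurable_pi_apply j)
    have hBA : ∀ᵐ E ∂clockLaw n, E ∈ B → E ∈ A :=
      (ae_clockLaw_nonneg n).mono fun E hE hB j hj => by
        have h1 := hB j hj
        rw [Set.mem_Ioi] at h1
        refine le_trans (mul_le_mul_of_nonneg_right ?_ (hE i)) h1.le
        exact div_le_div_of_nonneg_left (hv j) h0 (by linarith)
    have hdiff : clockLaw n (A \ B) + clockLaw n B ≤ clockLaw n A := by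
      rw [← measure_sdiff_add_inter A hBm]
      refine add_le_add le_rfl (measure_mono_ae (hBA.mono fun E h hE => ⟨h hE, hE⟩))
    refine (measure_mono_ae (t := A \ B) ((ae_clockLaw_nonneg n).mono fun E hE hne => ?_)).trans ?_
    · obtain ⟨h1, h2⟩ := expClocks_ne_imp hE hε hv hw hne
      exact ⟨h1, fun h => h2 ⟨h0, h⟩⟩
    · rw [hA, hB] at hdiff
      refine (ENNReal.le_sub_of_add_le_right ENNReal.ofReal_ne_top hdiff).trans ?_
      rw [← ENNReal.ofReal_sub _ (by positivity), hwi]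
      refine ENNReal.ofReal_le_ofReal ?_
      -- The difference of the two winning probabilities is εV/((v i + ε + V)(v i + V)), and V ≤ v i
      -- + V.
      rw [sub_le_iff_le_add, div_add_div _ _ (by positivity) (by positivity),
        div_le_div_iff₀ (by positivity) (by positivity)]
      have : 0 ≤ (v i + ε + V) * (ε * v i) := by positivity
      nlinarith

end CorrelatedSampling

end

noncomputable section

namespace CorrelatedSampling

lemma expClocks_nonempty {n : ℕ} (E : Fin n → ℝ) {v : Fin n → ℝ} {i : Fin n} (hi : 0 < v i) :
    (expClocks E v).Nonempty := by
  classical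
  -- Minimising the pair (arrival time, index) lexicographically reproduces the tie-breaking rule.
  obtain ⟨j, hj, hmin⟩ := Finset.exists_min_image ({j | 0 < v j} : Finset (Fin n))
    (fun j => toLex (E j / v j, j)) ⟨i, by simpa using hi⟩
  refine ⟨j, mem_expClocks.2 ⟨by simpa using hj, fun l hl => ?_⟩⟩
  simpa [Prod.Lex.le_iff] using hmin l (by simpa using hl)

namespace Hashing

variable {n m : ℕ} (H : Hashing n m) (x : Fin n → ℝ)

/-! ### The compressed vector -/

/-- The restriction of `x` to the large items. -/
def largePart (i : Fin n) : ℝ := if i ∈ H.large x then x i else 0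

/-- The restriction of `x` to the small items. -/
def smallPart (i : Fin n) : ℝ := if i ∈ H.small x then x i else 0

/-- The restriction of `x` to the small items in bucket `b`. -/
def weight (b : Fin m) (i : Fin n) : ℝ := if i ∈ H.smallIn x b then x i else 0

/-- The compressed vector in `ℝ^(m³)`, written without reference to the representatives. -/
def base (h : Fin (m ^ 3)) : ℝ :=
  (∑ i, if H.C i = h then H.largePart x i else 0) + ∑ b, if H.R b = h then H.load x b else 0

variable {H x}

lemma mem_small {i : Fin n} : i ∈ H.small x ↔ 0 < x i ∧ x i ≤ 1 / 10 + H.σ := by simp [small]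

lemma mem_large {i : Fin n} : i ∈ H.large x ↔ 1 / 10 + H.σ < x i := by simp [large]

lemma mem_smallIn {b : Fin m} {i : Fin n} :
    i ∈ H.smallIn x b ↔ i ∈ H.small x ∧ H.bucket i = b := by simp [smallIn]

lemma sum_weight (b : Fin m) : ∑ i, H.weight x b i = H.load x b := by
  simp [weight, load, Finset.sum_ite_mem]

lemma load_eq (b : Fin m) :
    H.load x b = ∑ i, if H.bucket i = b then H.smallPart x i else 0 := by
  rw [← sum_weight]
  refine Finset.sum_congr rfl fun i _ => ?_
  simp only [weight, mem_smallIn, smallPart]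
  split_ifs <;> simp_all

lemma weight_nonneg (b : Fin m) (i : Fin n) : 0 ≤ H.weight x b i := by
  unfold weight
  split_ifs with h
  · exact (mem_small.1 (mem_smallIn.1 h).1).1.le
  · exact le_rfl

lemma load_nonneg (b : Fin m) : 0 ≤ H.load x b := by
  rw [← sum_weight]
  exact Finset.sum_nonneg fun i _ => weight_nonneg b i

/-- Normalisation is irrelevant by scale invariance. In a bucket of load zero all weights vanish, so
no clock competes and the winner set is empty as well. -/
lemma rep_eq (E : Fin n → ℝ) (b : Fin m) :
    H.rep x (expClocks E) b = expClocks E (H.weight x b) := by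
  unfold rep
  split_ifs with h
  · rw [← expClocks_smul E (H.weight x b) h]
    congr 1
    ext i
    unfold weight
    split_ifs <;> simp
  · ext i
    have h0 : H.weight x b i = 0 := by
      have h1 : ∑ i, H.weight x b i = 0 := by
        rw [sum_weight]; exact le_antisymm (not_lt.1 h) (load_nonneg b)
      exact (Finset.sum_eq_zero_iff_of_nonneg fun i _ => weight_nonneg b i).1 h1 i
        (Finset.mem_univ i)
    simp [mem_expClocks, h0]

lemma mem_smallIn_of_mem_rep {E : Fin n → ℝ} {b : Fin m} {i : Fin n}
    (h : i ∈ H.rep x (expClocks E) b) : i ∈ H.smallIn x b := by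
  rw [rep_eq, mem_expClocks, weight] at h
  by_contra hi
  simp [hi] at h

lemma card_rep_le (E : Fin n → ℝ) (b : Fin m) : (H.rep x (expClocks E) b).card ≤ 1 := by
  rw [rep_eq]; exact card_expClocks_le _ _

lemma card_rep_mul_load (E : Fin n → ℝ) (b : Fin m) :
    ((H.rep x (expClocks E) b).card : ℝ) * H.load x b = H.load x b := by
  rcases (load_nonneg (H := H) (x := x) b).eq_or_lt with h | h
  · rw [← h, mul_zero]
  · have : (H.rep x (expClocks E) b).Nonempty := by
      rw [rep_eq]
      rw [← sum_weight] at h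
      obtain ⟨i, -, hi⟩ := Finset.exists_lt_of_sum_lt (f := fun _ => (0 : ℝ))
        (by simpa using h)
      exact expClocks_nonempty E hi
    rw [le_antisymm (card_rep_le E b) this.card_pos, Nat.cast_one, one_mul]

lemma notMem_large_of_mem_small {i : Fin n} (h : i ∈ H.small x) : i ∉ H.large x := by
  rw [mem_large, not_lt]; exact (mem_small.1 h).2

/-- Whichever item represents a bucket, it carries the whole load to the hash of the bucket. The
input of tree rounding is therefore free of the clocks, which makes selection of a bucket and change
of its winner independent. -/
lemma xhat_eq (hx : ∀ i, 0 ≤ x i) (E : Fin n → ℝ) :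
    H.xhat x (expClocks E) = H.base x := by
  classical
  ext h
  have key : ∀ i, (if H.target x (expClocks E) i = h then H.compressed x (expClocks E) i else 0) =
      (if H.C i = h then H.largePart x i else 0) +
        ∑ b, if i ∈ H.rep x (expClocks E) b then (if H.R b = h then H.load x b else 0) else 0 := by
    intro i
    by_cases hs : i ∈ H.small x
    · have hsum : ∑ b, (if i ∈ H.rep x (expClocks E) b then
          (if H.R b = h then H.load x b else 0) else 0) =
          if i ∈ H.rep x (expClocks E) (H.bucket i) then
            (if H.R (H.bucket i) = h then H.load x (H.bucket i) else 0) else 0 := by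
        refine Finset.sum_eq_single _ (fun b _ hb => if_neg fun hi => hb ?_) (by simp)
        exact (mem_smallIn.1 (mem_smallIn_of_mem_rep hi)).2.symm
      rw [hsum, largePart, if_neg (notMem_large_of_mem_small hs), compressed, if_pos hs, target]
      split_ifs <;> simp
    · have hr : ∀ b, i ∉ H.rep x (expClocks E) b := fun b hi =>
        hs (mem_smallIn.1 (mem_smallIn_of_mem_rep hi)).1
      have hl : H.largePart x i = x i := by
        unfold largePart
        split_ifs with hl
        · rfl
        · rw [mem_small, not_and] at hs
          rw [mem_large, not_lt] at hl
          exact le_antisymm (hx i) (not_lt.1 fun h => hs h hl)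
      simp [hr, compressed, hs, target, hl]
  rw [xhat, Finset.sum_filter, Finset.sum_congr rfl fun i _ => key i, Finset.sum_add_distrib,
    Finset.sum_comm, base]
  congr 1
  refine Finset.sum_congr rfl fun b _ => ?_
  rw [← Finset.sum_filter, Finset.sum_const, Finset.filter_univ_mem, nsmul_eq_mul]
  split_ifs
  · exact card_rep_mul_load E b
  · simp

lemma largePart_add_smallPart (hx : ∀ i, 0 ≤ x i) (i : Fin n) :
    H.largePart x i + H.smallPart x i = x i := by
  unfold largePart smallPart
  simp only [mem_large, mem_small]
  have := hx i
  split_ifs with h1 h2 h2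
  · linarith [h2.2]
  · ring
  · ring
  · rcases this.eq_or_lt with h | h
    · linarith
    · exact absurd ⟨h, not_lt.1 h1⟩ h2

lemma largePart_nonneg (hx : ∀ i, 0 ≤ x i) (i : Fin n) : 0 ≤ H.largePart x i := by
  unfold largePart; split_ifs; exacts [hx i, le_rfl]

lemma smallPart_nonneg (i : Fin n) : 0 ≤ H.smallPart x i := by
  unfold smallPart; split_ifs with h; exacts [(mem_small.1 h).1.le, le_rfl]

lemma sum_largePart_add_sum_load (hx : ∀ i, 0 ≤ x i) :
    ∑ i, H.largePart x i + ∑ b, H.load x b = l1 x := by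
  rw [l1_eq_sum hx, Finset.sum_congr rfl fun b _ => load_eq (H := H) (x := x) b, Finset.sum_comm]
  simp only [Finset.sum_ite_eq, Finset.mem_univ, if_true]
  rw [← Finset.sum_add_distrib]
  exact Finset.sum_congr rfl fun i _ => largePart_add_smallPart hx i

lemma base_nonneg (hx : ∀ i, 0 ≤ x i) (h : Fin (m ^ 3)) : 0 ≤ H.base x h := by
  refine add_nonneg (Finset.sum_nonneg fun i _ => ?_) (Finset.sum_nonneg fun b _ => ?_)
  · split_ifs; exacts [largePart_nonneg hx i, le_rfl]
  · split_ifs; exacts [load_nonneg b, le_rfl]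

lemma base_eq (h : Fin (m ^ 3)) : H.base x h =
    ∑ i ∈ (H.large x).filter (fun i => H.C i = h), x i +
      ∑ b ∈ Finset.univ.filter (fun b => H.R b = h), H.load x b := by
  unfold base largePart
  have e := Finset.sum_ite_mem Finset.univ (H.large x) fun i => if H.C i = h then x i else 0
  rw [Finset.univ_inter] at e
  rw [Finset.sum_filter (s := H.large x), ← e, Finset.sum_filter]
  congr 1
  refine Finset.sum_congr rfl fun i _ => ?_
  split_ifs <;> rfl

lemma not_collision_iff : ¬ H.Collision x ↔ ∀ h,
    ((H.large x).filter (fun i => H.C i = h)).card +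
      (Finset.univ.filter (fun b => H.R b = h)).card ≤ 1 := by
  simp [Collision]

lemma base_le_one (hx : ∀ i, x i ≤ 1) (hτ : 0 ≤ H.τ) (hC : ¬ H.Collision x) (hH : ¬ H.Heavy x)
    (h : Fin (m ^ 3)) : H.base x h ≤ 1 := by
  rw [base_eq]
  have hl : ∀ b, H.load x b ≤ 1 := fun b => by
    simp only [Heavy, not_exists, not_lt] at hH
    linarith [hH b]
  have h1 := Finset.sum_le_card_nsmul ((H.large x).filter (fun i => H.C i = h)) x 1
    fun i _ => hx i
  have h2 := Finset.sum_le_card_nsmul (Finset.univ.filter (fun b => H.R b = h)) (H.load x) 1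
    fun b _ => hl b
  rw [nsmul_one] at h1 h2
  have h3 : (((H.large x).filter (fun i => H.C i = h)).card : ℝ) +
      (Finset.univ.filter (fun b => H.R b = h)).card ≤ 1 := by
    exact_mod_cast not_collision_iff.1 hC h
  linarith

lemma base_R (hC : ¬ H.Collision x) (b : Fin m) : H.base x (H.R b) = H.load x b := by
  have h := not_collision_iff.1 hC (H.R b)
  have hb : b ∈ Finset.univ.filter (fun b' => H.R b' = H.R b) := by simp
  have hpos := Finset.card_pos.2 ⟨b, hb⟩
  rw [base_eq, Finset.card_eq_zero.1 (by omega : ((H.large x).filter _).card = 0),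
    Finset.sum_empty, zero_add]
  obtain ⟨b', hb'⟩ := Finset.card_eq_one.1 (by omega : (Finset.univ.filter
    (fun b' => H.R b' = H.R b)).card = 1)
  rw [hb'] at hb ⊢
  rw [Finset.sum_singleton, Finset.mem_singleton.1 hb]

lemma base_C (hC : ¬ H.Collision x) {i : Fin n} (hi : i ∈ H.large x) :
    H.base x (H.C i) = x i := by
  have h := not_collision_iff.1 hC (H.C i)
  have hb : i ∈ (H.large x).filter (fun j => H.C j = H.C i) := by simp [hi]
  have hpos := Finset.card_pos.2 ⟨i, hb⟩
  rw [base_eq, Finset.card_eq_zero.1 (by omega : (Finset.univ.filter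
    (fun b => H.R b = H.C i)).card = 0), Finset.sum_empty, add_zero]
  obtain ⟨j, hj⟩ := Finset.card_eq_one.1 (by omega : ((H.large x).filter
    (fun j => H.C j = H.C i)).card = 1)
  rw [hj] at hb ⊢
  rw [Finset.sum_singleton, Finset.mem_singleton.1 hb]

/-- Adding entries together, first into buckets and then into hashes, does not increase ℓ₁-distance,
by the triangle inequality. Collisions do no harm here. -/
lemma l1_base_sub_le (x y : Fin n → ℝ) : l1 (H.base x - H.base y) ≤
    ∑ i, |H.largePart x i - H.largePart y i| + ∑ i, |H.smallPart x i - H.smallPart y i| := by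
  have hload : ∑ b, |H.load x b - H.load y b| ≤ ∑ i, |H.smallPart x i - H.smallPart y i| := by
    calc ∑ b, |H.load x b - H.load y b|
        ≤ ∑ b, ∑ i, if H.bucket i = b then |H.smallPart x i - H.smallPart y i| else 0 := by
          refine Finset.sum_le_sum fun b _ => ?_
          rw [load_eq, load_eq, ← Finset.sum_sub_distrib]
          refine (Finset.abs_sum_le_sum_abs _ _).trans (Finset.sum_le_sum fun i _ => ?_)
          split_ifs <;> simp
      _ = _ := by rw [Finset.sum_comm]; simp
  refine le_trans ?_ (add_le_add_right hload _)
  calc l1 (H.base x - H.base y)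
      ≤ ∑ h, ((∑ i, if H.C i = h then |H.largePart x i - H.largePart y i| else 0) +
          ∑ b, if H.R b = h then |H.load x b - H.load y b| else 0) := by
        refine Finset.sum_le_sum fun h _ => ?_
        rw [Pi.sub_apply, base, base, add_sub_add_comm, ← Finset.sum_sub_distrib,
          ← Finset.sum_sub_distrib]
        refine (abs_add_le _ _).trans (add_le_add ?_ ?_)
        all_goals
          refine (Finset.abs_sum_le_sum_abs _ _).trans (Finset.sum_le_sum fun i _ => ?_)
          split_ifs <;> simp
    _ = _ := by
        rw [Finset.sum_add_distrib, Finset.sum_comm, Finset.sum_comm (s := Finset.univ)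
          (t := (Finset.univ : Finset (Fin m)))]
        simp

end Hashing

end CorrelatedSampling

end

noncomputable section

namespace CorrelatedSampling

/-! ### Output sizes and the fallback algorithm -/

lemma card_biUnion_symmDiff_le {α β : Type*} [DecidableEq α] [DecidableEq β] [Fintype α]
    (s t : Finset α) (f g : α → Finset β) :
    (symmDiff (s.biUnion f) (t.biUnion g)).card ≤
      ∑ a, (symmDiff (if a ∈ s then f a else ∅) (if a ∈ t then g a else ∅)).card := by
  refine (Finset.card_le_card ?_).trans Finset.card_biUnion_le
  intro i hi
  simp only [Finset.mem_symmDiff, Finset.mem_biUnion, Finset.mem_univ, true_and] at hi ⊢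
  rcases hi with ⟨⟨a, ha, hia⟩, h⟩ | ⟨⟨a, ha, hia⟩, h⟩
  · refine ⟨a, Or.inl ⟨by simpa [ha], fun h' => h ⟨a, ?_⟩⟩⟩
    split_ifs at h' with hat
    · exact ⟨hat, h'⟩
    · simp at h'
  · refine ⟨a, Or.inr ⟨by simpa [ha], fun h' => h ⟨a, ?_⟩⟩⟩
    split_ifs at h' with hat
    · exact ⟨hat, h'⟩
    · simp at h'

lemma measurable_of_isCorrelatedSampling {Ω : Type*} [MeasurableSpace Ω] {μ : Measure Ω} {n k : ℕ}
    {α : ℝ} {A : Ω → (Fin n → ℝ) → Finset (Fin n)} (hA : IsCorrelatedSampling μ n k α A)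
    {x : Fin n → ℝ} (hx : x ∈ hypersimplex n k) : Measurable fun ω => A ω x :=
  measurable_to_countable' fun s => hA.measurable x hx s

lemma lintegral_card {Ω : Type*} [MeasurableSpace Ω] {μ : Measure Ω} {n : ℕ}
    {f : Ω → Finset (Fin n)} (hf : Measurable f) :
    ∫⁻ ω, ((f ω).card : ENNReal) ∂μ = ∑ i, μ {ω | i ∈ f ω} := by
  have hm : ∀ i, MeasurableSet {ω | i ∈ f ω} := fun i =>
    hf (MeasurableSet.of_discrete (s := {s : Finset (Fin n) | i ∈ s}))
  rw [← Finset.sum_congr rfl fun i _ => lintegral_indicator_one (hm i),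
    ← lintegral_finsetSum _ fun i _ => measurable_one.indicator (hm i)]
  refine lintegral_congr fun ω => ?_
  simp [Set.indicator_apply]

lemma lintegral_card_eq {Ω : Type*} [MeasurableSpace Ω] {μ : Measure Ω} [IsProbabilityMeasure μ]
    {n k : ℕ} {α : ℝ} {A : Ω → (Fin n → ℝ) → Finset (Fin n)}
    (hA : IsCorrelatedSampling μ n k α A) {x : Fin n → ℝ} (hx : x ∈ hypersimplex n k) :
    ∫⁻ ω, ((A ω x).card : ENNReal) ∂μ = ENNReal.ofReal (l1 x) := by
  rw [lintegral_card (measurable_of_isCorrelatedSampling hA hx), l1_eq_sum fun i => (hx.1 i).1,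
    ENNReal.ofReal_sum_of_nonneg fun i _ => (hx.1 i).1]
  exact Finset.sum_congr rfl fun i _ => by rw [← hA.marginals x hx i, ofReal_measureReal]

lemma lintegral_symmDiff_le_of_isCorrelatedSampling {Ω : Type*} [MeasurableSpace Ω] {μ : Measure Ω}
    [IsProbabilityMeasure μ] {n k : ℕ} {α : ℝ} {A : Ω → (Fin n → ℝ) → Finset (Fin n)}
    (hA : IsCorrelatedSampling μ n k α A) {x y : Fin n → ℝ} (hx : x ∈ hypersimplex n k)
    (hy : y ∈ hypersimplex n k) :
    ∫⁻ ω, ((symmDiff (A ω x) (A ω y)).card : ENNReal) ∂μ ≤ ENNReal.ofReal (α * l1 (x - y)) := by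
  have hm : Measurable fun ω => (symmDiff (A ω x) (A ω y)).card :=
    (Measurable.of_discrete (f := fun p : Finset (Fin n) × Finset (Fin n) =>
      (symmDiff p.1 p.2).card)).comp ((measurable_of_isCorrelatedSampling hA hx).prodMk
        (measurable_of_isCorrelatedSampling hA hy))
  have hint : Integrable (fun ω => ((symmDiff (A ω x) (A ω y)).card : ℝ)) μ :=
    Integrable.of_bound
      ((Measurable.of_discrete (f := fun j : ℕ => (j : ℝ))).comp hm).aestronglyMeasurable n
      (Filter.Eventually.of_forall fun ω => by
        simpa using (symmDiff (A ω x) (A ω y)).card_le_univ)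
  refine le_trans (le_of_eq ?_) (ENNReal.ofReal_le_ofReal (hA.stretch x hx y hy))
  rw [ofReal_integral_eq_lintegral_ofReal hint
    (Filter.Eventually.of_forall fun ω => Nat.cast_nonneg _)]
  simp

namespace Hashing

variable {n m : ℕ} (H : Hashing n m) (x : Fin n → ℝ)

/-! ### The output for fixed hashing -/

/-- The output when the coordinates in `T` are selected and the buckets have the representatives
`r`. -/
def select (T : Finset (Fin (m ^ 3))) (r : Fin m → Finset (Fin n)) : Finset (Fin n) :=
  {i ∈ H.large x | H.C i ∈ T} ∪ ({b | H.R b ∈ T} : Finset (Fin m)).biUnion r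

variable {H x}

lemma round_of_fail {A₁ A : (Fin n → ℝ) → Finset (Fin n)}
    {Aₖ : (Fin (m ^ 3) → ℝ) → Finset (Fin (m ^ 3))} (h : H.Collision x ∨ H.Heavy x) :
    H.round x A₁ A Aₖ = A x := by
  rw [round, if_pos h]

lemma round_of_not_fail {A : (Fin n → ℝ) → Finset (Fin n)} {E : Fin n → ℝ}
    {Aₖ : (Fin (m ^ 3) → ℝ) → Finset (Fin (m ^ 3))} (hx : ∀ i, 0 ≤ x i)
    (h : ¬ (H.Collision x ∨ H.Heavy x)) :
    H.round x (expClocks E) A Aₖ =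
      H.select x (Aₖ (H.base x)) fun b => expClocks E (H.weight x b) := by
  rw [round, if_neg h, xhat_eq hx]
  have : H.rep x (expClocks E) = fun b => expClocks E (H.weight x b) := funext fun b => rep_eq E b
  rw [this]
  simp only [select]

lemma card_select_le {T : Finset (Fin (m ^ 3))} {r : Fin m → Finset (Fin n)}
    (hr : ∀ b, (r b).card ≤ 1) :
    (H.select x T r).card ≤ ∑ i ∈ H.large x, (if H.C i ∈ T then 1 else 0) +
      ∑ b, if H.R b ∈ T then 1 else 0 := by
  refine (Finset.card_union_le _ _).trans (add_le_add ?_ ?_)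
  · rw [Finset.card_filter]
  · refine Finset.card_biUnion_le.trans ?_
    rw [Finset.sum_filter]
    exact Finset.sum_le_sum fun b _ => by split_ifs <;> simp [hr b]

/-- Outputs for two vectors whose large items and whose buckets differ in at most one element. -/
lemma card_symmDiff_select_le {y : Fin n → ℝ} {i : Fin n} {T T' : Finset (Fin (m ^ 3))}
    {r r' : Fin m → Finset (Fin n)} (hr : ∀ b, (r b).card ≤ 1) (hr' : ∀ b, (r' b).card ≤ 1)
    (hrr : ∀ b, b ≠ H.bucket i → r b = r' b) (hC : ¬ H.Collision y)
    (hL : H.large x ⊆ H.large y) (hL' : ∀ j ∈ H.large y, j ≠ i → j ∈ H.large x) :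
    (symmDiff (H.select x T r) (H.select y T' r')).card ≤
      (symmDiff T T').card + (if H.large x = H.large y then 0 else 1) +
        2 * ((if H.R (H.bucket i) ∈ T' then 1 else 0) *
          (if r (H.bucket i) ≠ r' (H.bucket i) then 1 else 0)) := by
  have h1 : (symmDiff {j ∈ H.large x | H.C j ∈ T} {j ∈ H.large y | H.C j ∈ T'}).card ≤
      ({j ∈ H.large y | H.C j ∈ symmDiff T T'} : Finset (Fin n)).card +
        (if H.large x = H.large y then 0 else 1) := by
    split_ifs with h
    · rw [add_zero, h]
      refine Finset.card_le_card fun j hj => ?_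
      simp only [Finset.mem_symmDiff, Finset.mem_filter] at hj ⊢
      tauto
    · refine (Finset.card_le_card (t := {j ∈ H.large y | H.C j ∈ symmDiff T T'} ∪ {i})
        fun j hj => ?_).trans
        ((Finset.card_union_le _ _).trans_eq (by rw [Finset.card_singleton]))
      have h3 := @hL j
      have h4 := hL' j
      simp only [Finset.mem_symmDiff, Finset.mem_filter, Finset.mem_union,
        Finset.mem_singleton] at hj ⊢
      tauto
  have h2 : (symmDiff (({b | H.R b ∈ T} : Finset (Fin m)).biUnion r)
      (({b | H.R b ∈ T'} : Finset (Fin m)).biUnion r')).card ≤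
      ({b | H.R b ∈ symmDiff T T'} : Finset (Fin m)).card +
        2 * ((if H.R (H.bucket i) ∈ T' then 1 else 0) *
          (if r (H.bucket i) ≠ r' (H.bucket i) then 1 else 0)) := by
    have e : 2 * ((if H.R (H.bucket i) ∈ T' then 1 else 0) *
        (if r (H.bucket i) ≠ r' (H.bucket i) then 1 else 0)) =
        ∑ b, if b = H.bucket i then 2 * ((if H.R b ∈ T' then 1 else 0) *
          (if r b ≠ r' b then 1 else 0)) else 0 := by simp
    rw [e, Finset.card_filter, ← Finset.sum_add_distrib]
    refine (card_biUnion_symmDiff_le _ _ _ _).trans (Finset.sum_le_sum fun b _ => ?_)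
    have hb := hr b
    have hb' := hr' b
    have e0 : symmDiff (r b) ∅ = r b := symmDiff_bot _
    have e0' : symmDiff ∅ (r' b) = r' b := bot_symmDiff _
    have hsd : (symmDiff (r b) (r' b)).card ≤ 2 := by
      refine (Finset.card_le_card (symmDiff_le_sup (a := r b) (b := r' b))).trans ?_
      exact (Finset.card_union_le _ _).trans (by omega)
    simp only [Finset.mem_filter, Finset.mem_univ, true_and, Finset.mem_symmDiff]
    -- A bucket selected in only one of the outputs is paid for by `symmDiff T T'`. A change of
    -- representative counts separately only when both outputs select the bucket, and then it costs
    -- at most 2.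
    by_cases c1 : H.R b ∈ T <;> by_cases c2 : H.R b ∈ T'
    · by_cases c3 : r b = r' b
      · simp [c1, c2, c3]
      · have c4 : b = H.bucket i := by by_contra h; exact c3 (hrr b h)
        simpa [c1, c2, c3, ← c4] using hsd
    · simpa [c1, c2, e0] using hb
    · have : (r' b).card ≤ 1 + if b = H.bucket i then 2 * (if r b ≠ r' b then 1 else 0) else 0 := by
        omega
      simpa [c1, c2, e0'] using this
    · simp [c1, c2]
  -- Absence of collisions for `y` means that every hash is used by at most one large item or
  -- bucket, so no element of `symmDiff T T'` is charged twice.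
  have h3 : ({j ∈ H.large y | H.C j ∈ symmDiff T T'} : Finset (Fin n)).card +
      ({b | H.R b ∈ symmDiff T T'} : Finset (Fin m)).card ≤ (symmDiff T T').card := by
    rw [Finset.card_eq_sum_card_fiberwise (f := H.C) (t := symmDiff T T')
      (s := {j ∈ H.large y | H.C j ∈ symmDiff T T'})
      (fun j hj => (Finset.mem_filter.1 (Finset.mem_coe.1 hj)).2),
      Finset.card_eq_sum_card_fiberwise (f := H.R) (t := symmDiff T T')
      (s := {b | H.R b ∈ symmDiff T T'})
      (fun j hj => (Finset.mem_filter.1 (Finset.mem_coe.1 hj)).2), ← Finset.sum_add_distrib,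
          Finset.card_eq_sum_ones]
    refine Finset.sum_le_sum fun h _ => le_trans ?_ (not_collision_iff.1 hC h)
    refine add_le_add (Finset.card_le_card ?_) (Finset.card_le_card ?_)
    · exact Finset.filter_subset_filter _ (Finset.filter_subset _ _)
    · exact Finset.filter_subset_filter _ (Finset.filter_subset _ _)
  have h4 := card_symmDiff_union_le {j ∈ H.large x | H.C j ∈ T}
    (({b | H.R b ∈ T} : Finset (Fin m)).biUnion r) {j ∈ H.large y | H.C j ∈ T'}
    (({b | H.R b ∈ T'} : Finset (Fin m)).biUnion r')
  unfold select
  omega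

/-! ### Increasing one coordinate -/

section step

variable {y : Fin n → ℝ} {i : Fin n} {ε : ℝ}

lemma step_le (hε : 0 < ε) (hxy : y = Function.update x i (x i + ε)) (j : Fin n) : x j ≤ y j := by
  rw [hxy]
  rcases eq_or_ne j i with rfl | hj
  · simp [hε.le]
  · simp [hj]

lemma large_subset (hε : 0 < ε) (hxy : y = Function.update x i (x i + ε)) :
    H.large x ⊆ H.large y := fun j hj => by
  rw [mem_large] at hj ⊢
  exact hj.trans_le (step_le hε hxy j)

lemma mem_large_of_ne (hxy : y = Function.update x i (x i + ε)) (j : Fin n) (hj : j ∈ H.large y)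
    (hji : j ≠ i) : j ∈ H.large x := by
  rw [mem_large, hxy, Function.update_of_ne hji] at hj
  exact mem_large.2 hj

lemma large_eq (hε : 0 < ε) (hxy : y = Function.update x i (x i + ε))
    (hcr : ¬ (x i ≤ 1 / 10 + H.σ ∧ 1 / 10 + H.σ < y i)) : H.large x = H.large y := by
  refine (large_subset hε hxy).antisymm fun j hj => ?_
  rcases eq_or_ne j i with rfl | hji
  · rw [mem_large] at hj ⊢
    exact not_le.1 fun h => hcr ⟨h, hj⟩
  · exact mem_large_of_ne hxy j hj hji

lemma weight_eq_of_ne (hxy : y = Function.update x i (x i + ε)) {b : Fin m}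
    (hb : b ≠ H.bucket i) : H.weight x b = H.weight y b := by
  ext j
  rcases eq_or_ne j i with rfl | hji
  · simp [weight, mem_smallIn, hb.symm]
  · simp [weight, mem_smallIn, mem_small, hxy, Function.update_of_ne hji]

lemma weight_eq_of_large (hε : 0 < ε) (hxy : y = Function.update x i (x i + ε))
    (hi : 1 / 10 + H.σ < x i) (b : Fin m) : H.weight x b = H.weight y b := by
  ext j
  rcases eq_or_ne j i with rfl | hji
  · have := step_le hε hxy j
    rw [weight, weight, if_neg, if_neg]
    · rw [mem_smallIn, mem_small]; rintro ⟨⟨-, h⟩, -⟩; linarith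
    · rw [mem_smallIn, mem_small]; rintro ⟨⟨-, h⟩, -⟩; linarith
  · simp [weight, mem_smallIn, mem_small, hxy, Function.update_of_ne hji]

lemma weight_eq_of_small (hx : ∀ j, 0 ≤ x j) (hε : 0 < ε)
    (hxy : y = Function.update x i (x i + ε)) (hi : y i ≤ 1 / 10 + H.σ) :
    H.weight y (H.bucket i) =
      Function.update (H.weight x (H.bucket i)) i (H.weight x (H.bucket i) i + ε) := by
  ext j
  rcases eq_or_ne j i with rfl | hji
  · have h1 : y j = x j + ε := by simp [hxy]
    have h0 := hx j
    have hw : H.weight x (H.bucket j) j = x j := by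
      rw [weight]
      split_ifs with h
      · rfl
      · by_contra h2
        exact h (mem_smallIn.2 ⟨mem_small.2 ⟨h0.lt_of_ne h2, by linarith⟩, rfl⟩)
    rw [Function.update_self, hw, weight, if_pos, h1]
    rw [mem_smallIn, mem_small]
    exact ⟨⟨by linarith, hi⟩, rfl⟩
  · simp [weight, mem_smallIn, mem_small, hxy, Function.update_of_ne hji]

lemma sum_abs_part_sub (hxy : y = Function.update x i (x i + ε)) :
    ∑ j, |H.largePart x j - H.largePart y j| + ∑ j, |H.smallPart x j - H.smallPart y j| =
      |H.largePart x i - H.largePart y i| + |H.smallPart x i - H.smallPart y i| := by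
  congr 1
  · refine Finset.sum_eq_single i (fun j _ hj => ?_) (by simp)
    simp [largePart, mem_large, hxy, Function.update_of_ne hj]
  · refine Finset.sum_eq_single i (fun j _ hj => ?_) (by simp)
    simp [smallPart, mem_small, hxy, Function.update_of_ne hj]

/-- Without crossing the threshold, the entry stays in one part, which absorbs all of ε. -/
lemma sum_abs_part_sub_eq (hx : ∀ j, 0 ≤ x j) (hy : ∀ j, 0 ≤ y j) (hε : 0 < ε)
    (hxy : y = Function.update x i (x i + ε))
    (hcr : ¬ (x i ≤ 1 / 10 + H.σ ∧ 1 / 10 + H.σ < y i)) :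
    ∑ j, |H.largePart x j - H.largePart y j| + ∑ j, |H.smallPart x j - H.smallPart y j| = ε := by
  have h1 : y i = x i + ε := by simp [hxy]
  rw [sum_abs_part_sub hxy, eq_sub_of_add_eq' (largePart_add_smallPart (H := H) hx i),
    eq_sub_of_add_eq' (largePart_add_smallPart (H := H) hy i), largePart, largePart,
    large_eq hε hxy hcr]
  split_ifs
  · rw [abs_of_nonpos (by linarith), abs_of_nonneg (by linarith)]; linarith
  · rw [abs_of_nonneg (by linarith), abs_of_nonpos (by linarith)]; linarith

/-- A crossing entry may leave one part and appear in the other at full value; each part still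
changes by at most 1, however small ε is. -/
lemma sum_abs_part_sub_le (hx : ∀ j, x j ∈ Set.Icc (0 : ℝ) 1)
    (hy : ∀ j, y j ∈ Set.Icc (0 : ℝ) 1) (hxy : y = Function.update x i (x i + ε)) :
    ∑ j, |H.largePart x j - H.largePart y j| + ∑ j, |H.smallPart x j - H.smallPart y j| ≤ 2 := by
  have h1 := largePart_add_smallPart (H := H) (fun j => (hx j).1) i
  have h2 := largePart_add_smallPart (H := H) (fun j => (hy j).1) i
  have h3 := largePart_nonneg (H := H) (fun j => (hx j).1) i
  have h4 := largePart_nonneg (H := H) (fun j => (hy j).1) i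
  have h5 := smallPart_nonneg (H := H) (x := x) i
  have h6 := smallPart_nonneg (H := H) (x := y) i
  have h7 := (hx i).2
  have h8 := (hy i).2
  rw [sum_abs_part_sub hxy]
  have h9 : |H.largePart x i - H.largePart y i| ≤ 1 := abs_sub_le_iff.2 ⟨by linarith, by linarith⟩
  have h10 : |H.smallPart x i - H.smallPart y i| ≤ 1 := abs_sub_le_iff.2 ⟨by linarith, by linarith⟩
  linarith

end step

end Hashing

end CorrelatedSampling

end

noncomputable section

namespace CorrelatedSampling

/-! ### Expected cost for fixed hashing and thresholds -/

namespace Hashing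

variable {n m k : ℕ} {H : Hashing n m} {x y : Fin n → ℝ} {Ω : Type*} [MeasurableSpace Ω]
  {μ : Measure Ω} [IsProbabilityMeasure μ] {α ε : ℝ} {A : Ω → (Fin n → ℝ) → Finset (Fin n)}
  {i : Fin n}

variable (H x y μ A) in
/-- The expected size of the symmetric difference of the outputs for fixed hashing. -/
def cost : ENNReal :=
  ∫⁻ t, ∫⁻ E, ∫⁻ ω, ((symmDiff (H.round x (expClocks E) (A ω) (treeRounding t))
    (H.round y (expClocks E) (A ω) (treeRounding t))).card : ENNReal) ∂μ ∂clockLaw n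
      ∂treeLaw (m ^ 3)

lemma sum_large_eq : ∑ i ∈ H.large x, x i = ∑ i, H.largePart x i := by
  simp [largePart, Finset.sum_ite_mem]

lemma measurableSet_mem_treeRounding {d : ℕ} (x : Fin d → ℝ) (h : Fin d) :
    MeasurableSet {t : TreeSeed d | h ∈ treeRounding t x} :=
  measurable_treeRounding x (MeasurableSet.of_discrete (s := {s : Finset (Fin d) | h ∈ s}))

/-- The expected output size is at most k in either branch: marginals of the fallback sum to ‖x‖₁,
and so do those of the large items and loads. Splitting the bound into a function of the tree seed
and one of the fallback seed allows iterated integration without joint measurability. -/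
lemma exists_size_bound (hA : IsCorrelatedSampling μ n k α A) (hx : x ∈ hypersimplex n k)
    (hτ : 0 ≤ H.τ) : ∃ (u : TreeSeed (m ^ 3) → ENNReal) (v : Ω → ENNReal), Measurable u ∧
      Measurable v ∧ (∀ t E ω, ((H.round x (expClocks E) (A ω) (treeRounding t)).card : ENNReal) ≤
        u t + v ω) ∧ ∫⁻ t, u t ∂treeLaw (m ^ 3) + ∫⁻ ω, v ω ∂μ ≤ ENNReal.ofReal k := by
  have hx0 : ∀ i, 0 ≤ x i := fun i => (hx.1 i).1
  by_cases hF : H.Collision x ∨ H.Heavy x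
  · refine ⟨0, fun ω => (A ω x).card, measurable_zero,
      (Measurable.of_discrete (f := fun s : Finset (Fin n) => (s.card : ENNReal))).comp
        (measurable_of_isCorrelatedSampling hA hx), fun t E ω => ?_, ?_⟩
    · rw [round_of_fail hF]; simp
    · rw [lintegral_card_eq hA hx]
      simpa using ENNReal.ofReal_le_ofReal hx.2
  · rw [not_or] at hF
    have hbase : ∀ h, H.base x h ∈ Set.Icc (0 : ℝ) 1 := fun h =>
      ⟨base_nonneg hx0 h, base_le_one (fun i => (hx.1 i).2) hτ hF.1 hF.2 h⟩
    have hm : ∀ h : Fin (m ^ 3), Measurable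
        ({t : TreeSeed (m ^ 3) | h ∈ treeRounding t (H.base x)}.indicator (1 : TreeSeed (m ^ 3) →
            ENNReal)) :=
      fun h => measurable_one.indicator (measurableSet_mem_treeRounding _ h)
    refine ⟨fun t => ∑ i ∈ H.large x,
        {t | H.C i ∈ treeRounding t (H.base x)}.indicator 1 t +
      ∑ b, {t | H.R b ∈ treeRounding t (H.base x)}.indicator 1 t, 0,
      (Finset.measurable_fun_sum _ fun i _ => hm _).add
        (Finset.measurable_fun_sum _ fun b _ => hm _),
      measurable_zero, fun t E ω => ?_, ?_⟩
    · rw [round_of_not_fail hx0 (not_or.2 hF)]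
      refine (Nat.cast_le.2 (card_select_le fun b => card_expClocks_le _ _)).trans (le_of_eq ?_)
      simp [Set.indicator_apply]
    · rw [lintegral_add_left (Finset.measurable_fun_sum _ fun i _ => hm _),
        lintegral_finsetSum _ fun i _ => hm _, lintegral_finsetSum _ fun b _ => hm _]
      simp only [lintegral_indicator_one (measurableSet_mem_treeRounding _ _), Pi.zero_apply,
        lintegral_zero, add_zero]
      calc _ ≤ ∑ i ∈ H.large x, ENNReal.ofReal (x i) + ∑ b, ENNReal.ofReal (H.load x b) := by
            refine add_le_add (Finset.sum_le_sum fun i hi => ?_) (Finset.sum_le_sum fun b _ => ?_)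
            · rw [← base_C hF.1 hi]; exact treeLaw_mem_le hbase _
            · rw [← base_R hF.1 b]; exact treeLaw_mem_le hbase _
        _ = ENNReal.ofReal (l1 x) := by
            rw [← ENNReal.ofReal_sum_of_nonneg fun i _ => hx0 i,
              ← ENNReal.ofReal_sum_of_nonneg fun b _ => load_nonneg b,
              ← ENNReal.ofReal_add (Finset.sum_nonneg fun i _ => hx0 i)
                (Finset.sum_nonneg fun b _ => load_nonneg b), sum_large_eq,
              sum_largePart_add_sum_load hx0]
        _ ≤ _ := ENNReal.ofReal_le_ofReal hx.2

lemma cost_le_of_bound {u : TreeSeed (m ^ 3) → ENNReal} {v : Ω → ENNReal}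
    (h : ∀ t E ω, ((symmDiff (H.round x (expClocks E) (A ω) (treeRounding t))
      (H.round y (expClocks E) (A ω) (treeRounding t))).card : ENNReal) ≤ u t + v ω) :
    H.cost x y μ A ≤ ∫⁻ t, u t ∂treeLaw (m ^ 3) + ∫⁻ ω, v ω ∂μ := by
  refine (lintegral_mono fun t => lintegral_mono fun E => lintegral_mono fun ω => h t E ω).trans ?_
  simp only [lintegral_add_left measurable_const, lintegral_const, measure_univ, mul_one,
    lintegral_add_right _ measurable_const]
  exact le_rfl

/-- This crude bound serves the rare configurations: crossing together with a failure, and inputs of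
which only one fails. -/
lemma cost_le (hA : IsCorrelatedSampling μ n k α A) (hx : x ∈ hypersimplex n k)
    (hy : y ∈ hypersimplex n k) (hτ : 0 ≤ H.τ) : H.cost x y μ A ≤ ENNReal.ofReal (2 * k) := by
  obtain ⟨u, v, hu, hv, h, hle⟩ := exists_size_bound hA hx hτ
  obtain ⟨u', v', hu', hv', h', hle'⟩ := exists_size_bound hA hy hτ
  refine (cost_le_of_bound (u := fun t => u t + u' t) (v := fun ω => v ω + v' ω)
    fun t E ω => ?_).trans ?_
  · refine le_trans (Nat.cast_le.2 ((Finset.card_le_card symmDiff_le_sup).trans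
      (Finset.card_union_le _ _))) ?_
    rw [Nat.cast_add, add_add_add_comm]
    exact add_le_add (h t E ω) (h' t E ω)
  · rw [lintegral_add_left hu, lintegral_add_left hv, add_add_add_comm, two_mul,
      ENNReal.ofReal_add (Nat.cast_nonneg _) (Nat.cast_nonneg _)]
    exact add_le_add hle hle'

lemma cost_le_of_fail (hA : IsCorrelatedSampling μ n k α A) (hx : x ∈ hypersimplex n k)
    (hy : y ∈ hypersimplex n k) (hFx : H.Collision x ∨ H.Heavy x)
    (hFy : H.Collision y ∨ H.Heavy y) : H.cost x y μ A ≤ ENNReal.ofReal (α * l1 (x - y)) := by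
  refine (cost_le_of_bound (u := 0) (v := fun ω => (symmDiff (A ω x) (A ω y)).card)
    fun t E ω => ?_).trans ?_
  · rw [round_of_fail hFx, round_of_fail hFy]; simp
  · simpa using lintegral_symmDiff_le_of_isCorrelatedSampling hA hx hy

lemma base_mem (hx : x ∈ hypersimplex n k) (hτ : 0 ≤ H.τ)
    (hF : ¬ (H.Collision x ∨ H.Heavy x)) (h : Fin (m ^ 3)) :
    H.base x h ∈ Set.Icc (0 : ℝ) 1 := by
  rw [not_or] at hF
  exact ⟨base_nonneg (fun i => (hx.1 i).1) h, base_le_one (fun i => (hx.1 i).2) hτ hF.1 hF.2 h⟩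

lemma lintegral_tree_le (hx : x ∈ hypersimplex n k) (hy : y ∈ hypersimplex n k) (hτ : 0 ≤ H.τ)
    (hFx : ¬ (H.Collision x ∨ H.Heavy x)) (hFy : ¬ (H.Collision y ∨ H.Heavy y)) {δ : ℝ}
    (hδ : ∑ j, |H.largePart x j - H.largePart y j| + ∑ j, |H.smallPart x j - H.smallPart y j| ≤ δ) :
    ∫⁻ t, ((symmDiff (treeRounding t (H.base x)) (treeRounding t (H.base y))).card : ENNReal)
      ∂treeLaw (m ^ 3) ≤ ENNReal.ofReal (treeStretch (m ^ 3) * δ) :=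
  (treeRounding_stretch (base_mem hx hτ hFx) (base_mem hy hτ hFy)).trans
    (ENNReal.ofReal_le_ofReal (mul_le_mul_of_nonneg_left ((l1_base_sub_le x y).trans hδ)
      (treeStretch_nonneg _)))

lemma card_symmDiff_round_le (hx : ∀ j, 0 ≤ x j) (hy : ∀ j, 0 ≤ y j) (hε : 0 < ε)
    (hxy : y = Function.update x i (x i + ε)) (hFx : ¬ (H.Collision x ∨ H.Heavy x))
    (hFy : ¬ (H.Collision y ∨ H.Heavy y)) (t : TreeSeed (m ^ 3)) (E : Fin n → ℝ)
    (A' : (Fin n → ℝ) → Finset (Fin n)) :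
    (symmDiff (H.round x (expClocks E) A' (treeRounding t))
      (H.round y (expClocks E) A' (treeRounding t))).card ≤
      (symmDiff (treeRounding t (H.base x)) (treeRounding t (H.base y))).card +
        (if H.large x = H.large y then 0 else 1) +
        2 * ((if H.R (H.bucket i) ∈ treeRounding t (H.base y) then 1 else 0) *
          (if expClocks E (H.weight x (H.bucket i)) ≠ expClocks E (H.weight y (H.bucket i))
            then 1 else 0)) := by
  rw [round_of_not_fail hx hFx, round_of_not_fail hy hFy]
  exact card_symmDiff_select_le (fun b => card_expClocks_le _ _) (fun b => card_expClocks_le _ _)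
    (fun b hb => by rw [weight_eq_of_ne hxy hb]) (not_or.1 hFy).1 (large_subset hε hxy)
    (mem_large_of_ne hxy)

/-- Used when an item crosses the small/large threshold. The tree input moves by at most 2; the item
may enter the output as a large one (1), and the representative of its bucket may change (2). -/
lemma cost_le_of_not_fail (hx : x ∈ hypersimplex n k) (hy : y ∈ hypersimplex n k) (hε : 0 < ε)
    (hxy : y = Function.update x i (x i + ε)) (hτ : 0 ≤ H.τ)
    (hFx : ¬ (H.Collision x ∨ H.Heavy x)) (hFy : ¬ (H.Collision y ∨ H.Heavy y)) :
    H.cost x y μ A ≤ ENNReal.ofReal (2 * treeStretch (m ^ 3) + 3) := by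
  refine (cost_le_of_bound (u := fun t => ((symmDiff (treeRounding t (H.base x))
    (treeRounding t (H.base y))).card : ENNReal)) (v := fun _ => 3) fun t E ω => ?_).trans ?_
  · have := card_symmDiff_round_le (fun j => (hx.1 j).1) (fun j => (hy.1 j).1) hε hxy
      hFx hFy t E (A ω)
    have h2 := this.trans (c := (symmDiff (treeRounding t (H.base x))
      (treeRounding t (H.base y))).card + 3) (by
        rw [add_assoc]
        refine Nat.add_le_add_left ?_ _
        split_ifs <;> simp)
    refine (Nat.cast_le.2 h2).trans (le_of_eq ?_)
    push_cast
    rfl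
  · rw [ENNReal.ofReal_add (mul_nonneg zero_le_two (treeStretch_nonneg _)) (by norm_num),
      mul_comm]
    refine add_le_add (lintegral_tree_le hx hy hτ hFx hFy (sum_abs_part_sub_le hx.1 hy.1 hxy)) ?_
    simp

/-- The tree pays its stretch times ε. A changed winner in the bucket of `i` costs 2, but it must
both be selected, with probability at most the load, and change, with probability at most ε divided
by the load. The tree seed and the clocks are independent, so the loads cancel. -/
lemma cost_le_of_not_cross (hx : x ∈ hypersimplex n k) (hy : y ∈ hypersimplex n k) (hε : 0 < ε)
    (hxy : y = Function.update x i (x i + ε)) (hτ : 0 ≤ H.τ)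
    (hFx : ¬ (H.Collision x ∨ H.Heavy x)) (hFy : ¬ (H.Collision y ∨ H.Heavy y))
    (hcr : ¬ (x i ≤ 1 / 10 + H.σ ∧ 1 / 10 + H.σ < y i)) :
    H.cost x y μ A ≤ ENNReal.ofReal (treeStretch (m ^ 3) * ε + 2 * ε) := by
  have hx0 : ∀ j, 0 ≤ x j := fun j => (hx.1 j).1
  have hy0 : ∀ j, 0 ≤ y j := fun j => (hy.1 j).1
  have htree := lintegral_tree_le hx hy hτ hFx hFy (sum_abs_part_sub_eq hx0 hy0 hε hxy hcr).le
  set N : Set (Fin n → ℝ) := {E | expClocks E (H.weight x (H.bucket i)) ≠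
    expClocks E (H.weight y (H.bucket i))} with hN
  have hNm : MeasurableSet N :=
    (measurableSet_eq_fun (measurable_expClocks (H.weight x (H.bucket i)))
      (measurable_expClocks (H.weight y (H.bucket i)))).compl
  set M : Set (TreeSeed (m ^ 3)) := {t | H.R (H.bucket i) ∈ treeRounding t (H.base y)} with hM
  have hMm : MeasurableSet M := measurableSet_mem_treeRounding _ _
  have hMle : treeLaw (m ^ 3) M ≤ ENNReal.ofReal (H.load y (H.bucket i)) := by
    rw [← base_R (not_or.1 hFy).1]
    exact treeLaw_mem_le (base_mem hy hτ hFy) _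
  have hprod : treeLaw (m ^ 3) M * clockLaw n N ≤ ENNReal.ofReal ε := by
    by_cases hi : 1 / 10 + H.σ < x i
    · have : N = ∅ := by ext E; simp [hN, weight_eq_of_large hε hxy hi]
      simp [this]
    · have hyi : y i ≤ 1 / 10 + H.σ := by
        by_contra h; exact hcr ⟨not_lt.1 hi, not_le.1 h⟩
      have hw := weight_eq_of_small hx0 hε hxy hyi
      have hNle := clockLaw_expClocks_ne_le hε (fun j => weight_nonneg (H.bucket i) j) hw
      rw [sum_weight] at hNle
      have hpos : 0 < H.load y (H.bucket i) := by
        rw [← sum_weight]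
        refine Finset.sum_pos' (fun j _ => weight_nonneg _ j) ⟨i, Finset.mem_univ i, ?_⟩
        rw [hw, Function.update_self]
        linarith [weight_nonneg (H := H) (x := x) (H.bucket i) i]
      refine (mul_le_mul' hMle hNle).trans_eq ?_
      rw [← ENNReal.ofReal_mul hpos.le, mul_div_cancel₀ _ hpos.ne']
  calc H.cost x y μ A
      ≤ ∫⁻ t, ∫⁻ E, ∫⁻ _ω, (((symmDiff (treeRounding t (H.base x))
          (treeRounding t (H.base y))).card : ENNReal) + 2 * (M.indicator 1 t * N.indicator 1 E))
            ∂μ ∂clockLaw n ∂treeLaw (m ^ 3) := by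
        refine lintegral_mono fun t => lintegral_mono fun E => lintegral_mono fun ω => ?_
        have := card_symmDiff_round_le hx0 hy0 hε hxy hFx hFy t E (A ω)
        rw [if_pos (large_eq hε hxy hcr), add_zero] at this
        refine (Nat.cast_le.2 this).trans (le_of_eq ?_)
        simp [Set.indicator_apply, hM, hN]
    _ = ∫⁻ t, ((symmDiff (treeRounding t (H.base x)) (treeRounding t (H.base y))).card : ENNReal)
          ∂treeLaw (m ^ 3) + 2 * (treeLaw (m ^ 3) M * clockLaw n N) := by
        simp only [lintegral_const, measure_univ, mul_one]
        rw [← lintegral_indicator_one hMm, ← lintegral_indicator_one hNm,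
          ← lintegral_mul_const _ (measurable_one.indicator hMm),
          ← lintegral_const_mul _ ((measurable_one.indicator hMm).mul_const _),
          ← lintegral_add_left (measurable_card_symmDiff (measurable_treeRounding _)
            (measurable_treeRounding _))]
        refine lintegral_congr fun t => ?_
        rw [lintegral_add_left measurable_const, lintegral_const, measure_univ, mul_one,
          lintegral_const_mul _ ((measurable_one.indicator hNm).const_mul _),
          lintegral_const_mul _ (measurable_one.indicator hNm)]
    _ ≤ _ := by
        rw [ENNReal.ofReal_add (mul_nonneg (treeStretch_nonneg _) hε.le) (by positivity),
          ENNReal.ofReal_mul zero_le_two, ENNReal.ofReal_ofNat]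
        exact add_le_add htree (mul_le_mul_right hprod _)

/-! ### The failure status -/

lemma collision_iff_of_large_eq (h : H.large x = H.large y) : H.Collision x ↔ H.Collision y := by
  simp only [Collision, h]

lemma load_le (hx : ∀ j, 0 ≤ x j) (hε : 0 < ε) (hxy : y = Function.update x i (x i + ε))
    (hcr : ¬ (x i ≤ 1 / 10 + H.σ ∧ 1 / 10 + H.σ < y i)) (b : Fin m) :
    H.load x b ≤ H.load y b ∧ H.load y b ≤ H.load x b + ε ∧
      (b ≠ H.bucket i → H.load y b = H.load x b) := by
  by_cases hb : b = H.bucket i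
  · subst hb
    by_cases hi : 1 / 10 + H.σ < x i
    · rw [← sum_weight, ← sum_weight, weight_eq_of_large hε hxy hi]
      exact ⟨le_rfl, by linarith, fun h => absurd rfl h⟩
    · have hyi : y i ≤ 1 / 10 + H.σ := by
        by_contra h; exact hcr ⟨not_lt.1 hi, not_le.1 h⟩
      have : H.load y (H.bucket i) = H.load x (H.bucket i) + ε := by
        rw [← sum_weight, ← sum_weight, weight_eq_of_small hx hε hxy hyi,
          Finset.sum_update_of_mem (Finset.mem_univ i), Finset.sdiff_singleton_eq_erase,
          ← Finset.add_sum_erase _ _ (Finset.mem_univ i)]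
        ring
      rw [this]
      exact ⟨by linarith, le_rfl, fun h => absurd rfl h⟩
  · rw [← sum_weight, ← sum_weight, weight_eq_of_ne hxy hb]
    exact ⟨le_rfl, by linarith, fun _ => rfl⟩

lemma heavy_of_heavy (hx : ∀ j, 0 ≤ x j) (hε : 0 < ε) (hxy : y = Function.update x i (x i + ε))
    (hcr : ¬ (x i ≤ 1 / 10 + H.σ ∧ 1 / 10 + H.σ < y i)) (h : H.Heavy x) : H.Heavy y := by
  obtain ⟨b, hb⟩ := h
  exact ⟨b, hb.trans_le (load_le hx hε hxy hcr b).1⟩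

/-- Only the bucket of `i` changes its load, by at most ε, so the threshold 1 - τ must be at least
its old load and less than its new one. -/
lemma mem_Ioc_of_heavy (hx : ∀ j, 0 ≤ x j) (hε : 0 < ε)
    (hxy : y = Function.update x i (x i + ε))
    (hcr : ¬ (x i ≤ 1 / 10 + H.σ ∧ 1 / 10 + H.σ < y i)) (h : ¬ H.Heavy x) (h' : H.Heavy y) :
    H.τ ∈ Set.Ioc (1 - (H.load x (H.bucket i) + ε)) (1 - H.load x (H.bucket i)) := by
  obtain ⟨b, hb⟩ := h'
  simp only [Heavy, not_exists, not_lt] at h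
  have h1 := load_le hx hε hxy hcr b
  have hbi : b = H.bucket i := by
    by_contra hne
    rw [h1.2.2 hne] at hb
    linarith [h b]
  subst hbi
  exact ⟨by linarith [h1.2.1], by linarith [h (H.bucket i)]⟩

end Hashing

end CorrelatedSampling

end

noncomputable section

namespace CorrelatedSampling

/-! ### Collision and heavy-bucket probabilities -/

lemma unifFin_real_singleton {d : ℕ} (h : Fin d) : (unifFin d).real {h} = 1 / d := by
  rw [Measure.real, unifFin, uniformOn_univ, Measure.count_singleton, Fintype.card_fin]
  simp

section uniform

variable {d : ℕ} [NeZero d]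

instance : IsProbabilityMeasure (unifFin d) :=
  isProbabilityMeasure_uniformOn Set.finite_univ Set.univ_nonempty

/-- The law of `a` independent uniform hash values. -/
def hashLaw (a d : ℕ) : Measure (Fin a → Fin d) := Measure.pi fun _ => unifFin d

instance (a : ℕ) : IsProbabilityMeasure (hashLaw a d) := by unfold hashLaw; infer_instance

lemma hashLaw_real_eval {a : ℕ} (i : Fin a) (h : Fin d) :
    (hashLaw a d).real {C | C i = h} = 1 / d := by
  rw [← unifFin_real_singleton h]
  exact (measurePreserving_eval (fun _ : Fin a => unifFin d) i).measureReal_preimage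
    (MeasurableSet.singleton h).nullMeasurableSet

lemma measureReal_eq_le {Ω : Type*} [MeasurableSpace Ω] {μ : Measure Ω} [IsProbabilityMeasure μ]
    {f g : Ω → Fin d} (h : ∀ v, μ.real ({ω | f ω = v} ∩ {ω | g ω = v}) ≤ 1 / d * (1 / d)) :
    μ.real {ω | f ω = g ω} ≤ 1 / d := by
  have hd : (d : ℝ) ≠ 0 := Nat.cast_ne_zero.2 (NeZero.ne d)
  have : {ω | f ω = g ω} = ⋃ v ∈ (Finset.univ : Finset (Fin d)),
      ({ω | f ω = v} ∩ {ω | g ω = v}) := by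
    ext ω; simp [eq_comm]
  rw [this]
  refine (measureReal_biUnion_finset_le _ _).trans ((Finset.sum_le_card_nsmul _ _ _
    fun v _ => h v).trans (le_of_eq ?_))
  rw [Finset.card_univ, Fintype.card_fin, nsmul_eq_mul]
  field_simp

lemma hashLaw_real_eq_le {a : ℕ} {i j : Fin a} (hij : i ≠ j) :
    (hashLaw a d).real {C | C i = C j} ≤ 1 / d := by
  refine measureReal_eq_le fun v => le_of_eq ?_
  have hind : iIndepFun (fun (i : Fin a) (C : Fin a → Fin d) => C i) (hashLaw a d) :=
    iIndepFun_pi (X := fun _ => id) fun _ => aemeasurable_id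
  have := (hind.indepFun hij).measure_inter_preimage_eq_mul {v} {v}
    (MeasurableSet.singleton v) (MeasurableSet.singleton v)
  rw [← hashLaw_real_eval i v, Measure.real, Measure.real, ← ENNReal.toReal_mul]
  have hji : (hashLaw a d) {C | C i = v} = (hashLaw a d) {C | C j = v} := by
    rw [← ofReal_measureReal, ← ofReal_measureReal, hashLaw_real_eval, hashLaw_real_eval]
  conv_rhs => rw [ENNReal.toReal_mul]; arg 2; rw [hji]
  rw [← ENNReal.toReal_mul]
  exact congrArg _ this

lemma hashLaw_prod_real_eq_le {a c : ℕ} (i : Fin c) (b : Fin a) :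
    ((hashLaw a d).prod (hashLaw c d)).real {p | p.2 i = p.1 b} ≤ 1 / d := by
  refine measureReal_eq_le fun v => le_of_eq ?_
  have : {p : (Fin a → Fin d) × (Fin c → Fin d) | p.2 i = v} ∩ {p | p.1 b = v} =
      {R | R b = v} ×ˢ {C | C i = v} := by ext p; simp [and_comm]
  rw [this, measureReal_prod_prod, hashLaw_real_eval, hashLaw_real_eval]

/-- The event that two different hash values among those in `L` and those of the buckets agree. -/
def collisionSet {a c : ℕ} (d : ℕ) (L : Finset (Fin c)) :
    Set ((Fin a → Fin d) × (Fin c → Fin d)) :=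
  ((⋃ p ∈ (L ×ˢ L).filter (fun p => p.1 ≠ p.2), {q | q.2 p.1 = q.2 p.2}) ∪
    ⋃ p ∈ L ×ˢ Finset.univ, {q | q.2 p.1 = q.1 p.2}) ∪
    ⋃ p ∈ Finset.univ.filter (fun p : Fin a × Fin a => p.1 ≠ p.2), {q | q.1 p.1 = q.1 p.2}

/-- Union bound over ordered pairs of large items, of an item and a bucket, and of buckets. -/
lemma collisionSet_real_le {a c : ℕ} (L : Finset (Fin c)) :
    ((hashLaw a d).prod (hashLaw c d)).real (collisionSet d L) ≤
      ((L.card : ℝ) * L.card + L.card * a + a * a) * (1 / d) := by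
  have hd : (0 : ℝ) ≤ 1 / d := by positivity
  rw [add_mul, add_mul]
  refine (measureReal_union_le _ _).trans (add_le_add
    ((measureReal_union_le _ _).trans (add_le_add ?_ ?_)) ?_)
  · refine (measureReal_biUnion_finset_le _ _).trans ((Finset.sum_le_card_nsmul _ _ (1 / (d : ℝ))
      fun p hp => ?_).trans ?_)
    · have : {q : (Fin a → Fin d) × (Fin c → Fin d) | q.2 p.1 = q.2 p.2} =
          Set.univ ×ˢ {C | C p.1 = C p.2} := by ext; simp
      rw [this, measureReal_prod_prod, probReal_univ, one_mul]
      exact hashLaw_real_eq_le (Finset.mem_filter.1 hp).2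
    · rw [nsmul_eq_mul, ← Nat.cast_mul, ← Finset.card_product]
      exact mul_le_mul_of_nonneg_right (Nat.cast_le.2 (Finset.card_filter_le _ _)) hd
  · refine (measureReal_biUnion_finset_le _ _).trans ((Finset.sum_le_card_nsmul _ _ (1 / (d : ℝ))
      fun p hp => hashLaw_prod_real_eq_le _ _).trans (le_of_eq ?_))
    rw [nsmul_eq_mul, Finset.card_product, Finset.card_univ, Fintype.card_fin, Nat.cast_mul]
  · refine (measureReal_biUnion_finset_le _ _).trans ((Finset.sum_le_card_nsmul _ _ (1 / (d : ℝ))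
      fun p hp => ?_).trans ?_)
    · have : {q : (Fin a → Fin d) × (Fin c → Fin d) | q.1 p.1 = q.1 p.2} =
          {C | C p.1 = C p.2} ×ˢ Set.univ := by ext; simp
      rw [this, measureReal_prod_prod, probReal_univ, mul_one]
      exact hashLaw_real_eq_le (Finset.mem_filter.1 hp).2
    · rw [nsmul_eq_mul]
      refine mul_le_mul_of_nonneg_right ?_ hd
      have := Finset.card_filter_le (Finset.univ : Finset (Fin a × Fin a)) fun p => p.1 ≠ p.2
      rw [Finset.card_univ, Fintype.card_prod, Fintype.card_fin] at this
      exact_mod_cast this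

/-- The product of two different entries of `x` that are at most `1 / 5`. -/
def pairWeight {n : ℕ} (x : Fin n → ℝ) (i j : Fin n) : ℝ :=
  if i ≠ j ∧ x i ≤ 1 / 5 ∧ x j ≤ 1 / 5 then x i * x j else 0

/-- An event that contains the occurrence of a heavy bucket. -/
def heavySet {n : ℕ} (d : ℕ) (x : Fin n → ℝ) : Set (Fin n → Fin d) :=
  {B | 63 / 100 ≤ ∑ i, ∑ j, if B i = B j then pairWeight x i j else 0}

lemma pairWeight_nonneg {n : ℕ} {x : Fin n → ℝ} (hx : ∀ i, 0 ≤ x i) (i j : Fin n) :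
    0 ≤ pairWeight x i j := by
  unfold pairWeight
  split_ifs
  exacts [mul_nonneg (hx i) (hx j), le_rfl]

/-- Two different items share a bucket with probability at most 1/d, so the expected pair sum is at
most ‖x‖₁²/d. Markov's inequality finishes, as 100/63 ≤ 2. -/
lemma heavySet_real_le {n : ℕ} {x : Fin n → ℝ} (hx : ∀ i, 0 ≤ x i) :
    (hashLaw n d).real (heavySet d x) ≤ 2 * (l1 x) ^ 2 / d := by
  have hmarkov := mul_meas_ge_le_integral_of_nonneg (μ := hashLaw n d)
    (f := fun B => ∑ i, ∑ j, if B i = B j then pairWeight x i j else 0)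
    (Filter.Eventually.of_forall fun B => Finset.sum_nonneg fun i _ => Finset.sum_nonneg fun j _
        => by
      split_ifs; exacts [pairWeight_nonneg hx i j, le_rfl]) Integrable.of_finite (63 / 100)
  have hint : ∫ B, ∑ i, ∑ j, (if B i = B j then pairWeight x i j else 0) ∂hashLaw n d ≤
      (l1 x) ^ 2 / d := by
    rw [integral_finsetSum _ fun _ _ => Integrable.of_finite]
    simp_rw [integral_finsetSum _ fun _ _ => Integrable.of_finite]
    rw [l1_eq_sum hx, sq, Finset.sum_mul_sum, Finset.sum_div]
    refine Finset.sum_le_sum fun i _ => ?_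
    rw [Finset.sum_div]
    refine Finset.sum_le_sum fun j _ => ?_
    have e : ∫ B, (if B i = B j then pairWeight x i j else 0) ∂hashLaw n d =
        (hashLaw n d).real {B | B i = B j} * pairWeight x i j := by
      rw [← smul_eq_mul, ← integral_indicator_const _ MeasurableSet.of_discrete]
      exact integral_congr_ae (ae_of_all _ fun B => by simp [Set.indicator_apply])
    rw [e]
    by_cases hij : i ≠ j ∧ x i ≤ 1 / 5 ∧ x j ≤ 1 / 5
    · rw [pairWeight, if_pos hij, div_eq_inv_mul, ← one_div]
      exact mul_le_mul_of_nonneg_right (hashLaw_real_eq_le hij.1) (mul_nonneg (hx i) (hx j))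
    · rw [pairWeight, if_neg hij, mul_zero]
      exact div_nonneg (mul_nonneg (hx i) (hx j)) (Nat.cast_nonneg _)
  have h0 : 0 ≤ (l1 x) ^ 2 / d := by positivity
  have : (hashLaw n d).real (heavySet d x) * (63 / 100) ≤ (l1 x) ^ 2 / d := by
    rw [mul_comm]; exact hmarkov.trans hint
  rw [mul_div_assoc]
  linarith

end uniform

namespace Hashing

variable {n m : ℕ} {H : Hashing n m} {x : Fin n → ℝ}

lemma mem_collisionSet {L : Finset (Fin n)} (hL : H.large x ⊆ L) (h : H.Collision x) :
    (H.R, H.C) ∈ collisionSet (m ^ 3) L := by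
  obtain ⟨v, hv⟩ := h
  simp only [collisionSet, Set.mem_union, Set.mem_iUnion, Finset.mem_filter, Finset.mem_product,
    Set.mem_ofPred_eq, Finset.mem_univ, true_and, and_true, Prod.exists, exists_prop]
  rcases Nat.lt_or_ge 1 (((H.large x).filter (fun i => H.C i = v)).card) with h1 | h1
  · obtain ⟨i, hi, j, hj, hij⟩ := Finset.one_lt_card.1 h1
    rw [Finset.mem_filter] at hi hj
    exact Or.inl (Or.inl ⟨i, j, ⟨⟨hL hi.1, hL hj.1⟩, hij⟩, hi.2.trans hj.2.symm⟩)
  rcases Nat.lt_or_ge 1 ((Finset.univ.filter (fun b => H.R b = v)).card) with h2 | h2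
  · obtain ⟨i, hi, j, hj, hij⟩ := Finset.one_lt_card.1 h2
    rw [Finset.mem_filter] at hi hj
    exact Or.inr ⟨i, j, hij, hi.2.trans hj.2.symm⟩
  · obtain ⟨i, hi⟩ := Finset.card_pos.1 (by omega :
      0 < ((H.large x).filter (fun i => H.C i = v)).card)
    obtain ⟨b, hb⟩ := Finset.card_pos.1 (by omega :
      0 < (Finset.univ.filter (fun b => H.R b = v)).card)
    rw [Finset.mem_filter] at hi hb
    exact Or.inl (Or.inr ⟨i, b, hL hi.1, hi.2.trans hb.2.symm⟩)

lemma mem_heavySet (hx : ∀ i, 0 ≤ x i) (hσ : H.σ ≤ 1 / 10) (hτ : H.τ ≤ 1 / 10)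
    (h : H.Heavy x) : H.bucket ∈ heavySet m x := by
  obtain ⟨b, hb⟩ := h
  have hmem : ∀ i ∈ H.smallIn x b, x i ≤ 1 / 5 ∧ H.bucket i = b := fun i hi => by
    rw [mem_smallIn, mem_small] at hi
    exact ⟨by linarith [hi.1.2], hi.2⟩
  have hload : 9 / 10 ≤ H.load x b := by linarith
  have hsq : ∑ i ∈ H.smallIn x b, x i * x i ≤ 1 / 5 * H.load x b := by
    rw [load, Finset.mul_sum]
    exact Finset.sum_le_sum fun i hi => mul_le_mul_of_nonneg_right (hmem i hi).1 (hx i)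
  have hpair : H.load x b * H.load x b - ∑ i ∈ H.smallIn x b, x i * x i =
      ∑ i ∈ H.smallIn x b, ∑ j ∈ H.smallIn x b,
        if H.bucket i = H.bucket j then pairWeight x i j else 0 := by
    rw [load, Finset.sum_mul_sum, ← Finset.sum_sub_distrib]
    refine Finset.sum_congr rfl fun i hi => ?_
    rw [← Finset.sum_erase_eq_sub hi]
    rw [← Finset.sum_erase (H.smallIn x b) (a := i)
      (f := fun j => if H.bucket i = H.bucket j then pairWeight x i j else 0)
      (by simp [pairWeight])]
    refine Finset.sum_congr rfl fun j hj => ?_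
    have hj' := Finset.mem_of_mem_erase hj
    rw [if_pos ((hmem i hi).2.trans (hmem j hj').2.symm), pairWeight,
      if_pos ⟨(Finset.ne_of_mem_erase hj).symm, (hmem i hi).1, (hmem j hj').1⟩]
  have h0 : ∀ i j, 0 ≤ if H.bucket i = H.bucket j then pairWeight x i j else 0 := fun i j => by
    split_ifs; exacts [pairWeight_nonneg hx i j, le_rfl]
  have hle : ∑ i ∈ H.smallIn x b, ∑ j ∈ H.smallIn x b,
      (if H.bucket i = H.bucket j then pairWeight x i j else 0) ≤
      ∑ i, ∑ j, if H.bucket i = H.bucket j then pairWeight x i j else 0 :=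
    (Finset.sum_le_sum fun i _ => Finset.sum_le_univ_sum_of_nonneg fun j => h0 i j).trans
      (Finset.sum_le_univ_sum_of_nonneg fun i => Finset.sum_nonneg fun j _ => h0 i j)
  rw [heavySet, Set.mem_ofPred_eq]
  -- A heavy load s is at least 9/10 and consists of items of size at most 1/5, so its off-diagonal
  -- pairs sum to at least s(s - 1/5) ≥ 9/10·7/10 = 63/100.
  nlinarith

end Hashing

end CorrelatedSampling

end

noncomputable section

namespace CorrelatedSampling

/-! ### Measurability and the order of integration -/

section measurability

variable {n m k : ℕ} {Ω : Type*} [MeasurableSpace Ω] {μ : Measure Ω} {α : ℝ}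
  {A : Ω → (Fin n → ℝ) → Finset (Fin n)} {x : Fin n → ℝ}

lemma measurable_comp_of_finset {β : Type*} [MeasurableSpace β] {a b c d : ℕ}
    (F : Finset (Fin d) → (Fin a → Finset (Fin b)) → Finset (Fin c)) {f : β → Finset (Fin d)}
    {g : Fin a → β → Finset (Fin b)} (hf : Measurable f) (hg : ∀ i, Measurable (g i)) :
    Measurable fun q => F (f q) fun i => g i q := by
  have h : Measurable fun p : Finset (Fin d) × (Fin a → Finset (Fin b)) => F p.1 p.2 :=
    measurable_of_countable _
  exact h.comp (hf.prodMk (measurable_pi_lambda _ hg))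

lemma measurable_round_of_fixed (hA : Measurable fun ω => A ω x) (hx : ∀ i, 0 ≤ x i)
    (R : Fin m → Fin (m ^ 3)) (C : Fin n → Fin (m ^ 3)) (bucket : Fin n → Fin m) (σ : ℝ) :
    Measurable fun q : Ω × (Fin n → ℝ) × TreeSeed (m ^ 3) × ℝ =>
      Hashing.round ⟨R, C, bucket, σ, q.2.2.2⟩ x (expClocks q.2.1) (A q.1)
        (treeRounding q.2.2.1) := by
  classical
  let H : Hashing n m := ⟨R, C, bucket, σ, 0⟩
  have e : ∀ q : Ω × (Fin n → ℝ) × TreeSeed (m ^ 3) × ℝ,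
      Hashing.round ⟨R, C, bucket, σ, q.2.2.2⟩ x (expClocks q.2.1) (A q.1)
        (treeRounding q.2.2.1) =
      if H.Collision x ∨ ∃ b, 1 - q.2.2.2 < H.load x b then A q.1 x
      else H.select x (treeRounding q.2.2.1 (H.base x)) fun b =>
        expClocks q.2.1 (H.weight x b) := by
    intro q
    split_ifs with h
    · exact Hashing.round_of_fail (H := ⟨R, C, bucket, σ, q.2.2.2⟩) h
    · exact Hashing.round_of_not_fail (H := ⟨R, C, bucket, σ, q.2.2.2⟩) hx h
  simp only [e]
  refine Measurable.ite ?_ (hA.comp measurable_fst) ?_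
  · refine (MeasurableSet.const _).union ?_
    have : {q : Ω × (Fin n → ℝ) × TreeSeed (m ^ 3) × ℝ | ∃ b, 1 - q.2.2.2 < H.load x b} =
        ⋃ b, {q | 1 - q.2.2.2 < H.load x b} := by ext; simp
    have hset : MeasurableSet
        {q : Ω × (Fin n → ℝ) × TreeSeed (m ^ 3) × ℝ | ∃ b, 1 - q.2.2.2 < H.load x b} := by
      rw [this]
      exact MeasurableSet.iUnion fun b =>
        measurableSet_lt (measurable_const.sub measurable_snd.snd.snd) measurable_const
    exact hset
  · exact measurable_comp_of_finset (H.select x)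
      ((measurable_treeRounding (H.base x)).comp measurable_snd.snd.fst)
      fun b => (measurable_expClocks (H.weight x b)).comp measurable_snd.fst

/-- The threshold σ enters only through the set of large items, which has finitely many possible
values. -/
lemma round_congr_threshold {R : Fin m → Fin (m ^ 3)}
    {C : Fin n → Fin (m ^ 3)} {bucket : Fin n → Fin m} {σ σ' τ : ℝ}
    (h : Hashing.large ⟨R, C, bucket, σ, τ⟩ x = Hashing.large ⟨R, C, bucket, σ', τ⟩ x)
    (A₁ A' : (Fin n → ℝ) → Finset (Fin n)) (Aₖ : (Fin (m ^ 3) → ℝ) → Finset (Fin (m ^ 3))) :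
    Hashing.round ⟨R, C, bucket, σ, τ⟩ x A₁ A' Aₖ =
      Hashing.round ⟨R, C, bucket, σ', τ⟩ x A₁ A' Aₖ := by
  have hS : Hashing.small ⟨R, C, bucket, σ, τ⟩ x = Hashing.small ⟨R, C, bucket, σ', τ⟩ x := by
    ext i
    have hi := Finset.ext_iff.1 h i
    simp only [Hashing.mem_large, Hashing.mem_small] at hi ⊢
    rw [← not_lt, ← not_lt, hi]
  unfold Hashing.round Hashing.Collision Hashing.Heavy Hashing.xhat Hashing.target
    Hashing.compressed Hashing.rep Hashing.load Hashing.smallIn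
  simp only [h, hS]

/-- Since σ matters only through the set of large items, it is replaced by a chosen representative
with the same set. The hashing and that set then form a countable parameter, and for each of its
values the remaining dependence is measurable. -/
lemma measurable_alg [NeZero m] (hA : Measurable fun ω => A ω x) (hx : ∀ i, 0 ≤ x i) :
    Measurable fun ω : AlgSeed Ω n m => alg A ω x := by
  classical
  let large : ℝ → Finset (Fin n) := fun σ => {i | 1 / 10 + σ < x i}
  have hlarge : Measurable large := measurable_of_mem fun i => by
    simpa [large] using measurableSet_lt (measurable_const.add measurable_id)
      (measurable_const (a := x i))
  let s : Finset (Fin n) → ℝ := fun L => if h : ∃ σ, large σ = L then h.choose else 0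
  have hs : ∀ σ, large (s (large σ)) = large σ := fun σ => by
    have h : ∃ σ', large σ' = large σ := ⟨σ, rfl⟩
    simp only [s, dif_pos h]
    exact h.choose_spec
  let g : ((Fin m → Fin (m ^ 3)) × (Fin n → Fin (m ^ 3)) × (Fin n → Fin m) × Finset (Fin n)) ×
      (Ω × (Fin n → ℝ) × TreeSeed (m ^ 3) × ℝ) → Finset (Fin n) := fun p =>
    Hashing.round ⟨p.1.1, p.1.2.1, p.1.2.2.1, s p.1.2.2.2, p.2.2.2.2⟩ x (expClocks p.2.2.1) (A
        p.2.1)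
      (treeRounding p.2.2.2.1)
  have hg : Measurable g := measurable_from_prod_countable_right fun d =>
    measurable_round_of_fixed hA hx d.1 d.2.1 d.2.2.1 (s d.2.2.2)
  let f : AlgSeed Ω n m → ((Fin m → Fin (m ^ 3)) × (Fin n → Fin (m ^ 3)) × (Fin n → Fin m) ×
      Finset (Fin n)) × (Ω × (Fin n → ℝ) × TreeSeed (m ^ 3) × ℝ) := fun ω =>
    ((ω.2.2.2.1, ω.2.2.2.2.1, ω.2.2.2.2.2.1, large ω.2.2.2.2.2.2.1),
      (ω.1, ω.2.1, ω.2.2.1, ω.2.2.2.2.2.2.2))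
  have hf : Measurable f := by
    have := hlarge.comp (measurable_id (α := AlgSeed Ω n m)).snd.snd.snd.snd.snd.snd.fst
    exact ((by fun_prop : Measurable fun ω : AlgSeed Ω n m => ω.2.2.2.1).prodMk
      ((by fun_prop : Measurable fun ω : AlgSeed Ω n m => ω.2.2.2.2.1).prodMk
        ((by fun_prop : Measurable fun ω : AlgSeed Ω n m => ω.2.2.2.2.2.1).prodMk this))).prodMk
      (by fun_prop)
  have e : (fun ω : AlgSeed Ω n m => alg A ω x) = g ∘ f := funext fun ω =>
    round_congr_threshold (hs ω.2.2.2.2.2.2.1).symm _ _ _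
  rw [e]
  exact hg.comp hf

lemma lintegral_prod_reverse {α β γ δ : Type*} [MeasurableSpace α] [MeasurableSpace β]
    [MeasurableSpace γ] [MeasurableSpace δ] (μ : Measure α) (ν : Measure β) (ρ : Measure γ)
    (κ : Measure δ) [SFinite μ] [SFinite ν] [SFinite ρ] [SFinite κ]
    {f : α × β × γ × δ → ENNReal} (hf : Measurable f) :
    ∫⁻ p, f p ∂μ.prod (ν.prod (ρ.prod κ)) =
      ∫⁻ d, ∫⁻ c, ∫⁻ b, ∫⁻ a, f (a, b, c, d) ∂μ ∂ν ∂ρ ∂κ := by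
  have h1 : Measurable fun q : β × γ × δ => ∫⁻ a, f (a, q) ∂μ := hf.lintegral_prod_left'
  have h2 : Measurable fun q : γ × δ => ∫⁻ b, ∫⁻ a, f (a, b, q) ∂μ ∂ν := h1.lintegral_prod_left'
  rw [lintegral_prod_symm' _ hf, lintegral_prod_symm' _ h1, lintegral_prod_symm' _ h2]

/-- The law of the hashing. -/
def hashingLaw (n m : ℕ) : Measure ((Fin m → Fin (m ^ 3)) × (Fin n → Fin (m ^ 3)) ×
    (Fin n → Fin m) × ℝ × ℝ) :=
  (hashLaw m (m ^ 3)).prod <| (hashLaw n (m ^ 3)).prod <| (hashLaw n m).prod <|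
    (unif 0 (1 / 10)).prod (unif 0 (1 / 10))

instance [NeZero m] : IsProbabilityMeasure (hashingLaw n m) := by
  unfold hashingLaw; infer_instance

/-- Exchanging the order puts the hashing outermost, so that the bounds for fixed hashing apply
under the integral. -/
lemma lintegral_algLaw [NeZero m] [IsProbabilityMeasure μ] {y : Fin n → ℝ}
    (hA : IsCorrelatedSampling μ n k α A) (hx : x ∈ hypersimplex n k)
    (hy : y ∈ hypersimplex n k) :
    ∫⁻ ω, ((symmDiff (alg A ω x) (alg A ω y)).card : ENNReal) ∂algLaw μ n m =
      ∫⁻ h, Hashing.cost ⟨h.1, h.2.1, h.2.2.1, h.2.2.2.1, h.2.2.2.2⟩ x y μ A ∂hashingLaw n m := by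
  have hm : Measurable fun ω : AlgSeed Ω n m =>
      ((symmDiff (alg A ω x) (alg A ω y)).card : ENNReal) := measurable_card_symmDiff
    (measurable_alg (measurable_of_isCorrelatedSampling hA hx) fun i => (hx.1 i).1)
    (measurable_alg (measurable_of_isCorrelatedSampling hA hy) fun i => (hy.1 i).1)
  exact lintegral_prod_reverse μ (clockLaw n) (treeLaw (m ^ 3)) (hashingLaw n m) hm

end measurability

end CorrelatedSampling

end

noncomputable section

namespace CorrelatedSampling

/-! ### A single step -/

lemma unif_le_of_volume_le {s : Set ℝ} {ε : ℝ} (hs : volume s ≤ ENNReal.ofReal ε) :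
    unif 0 (1 / 10) s ≤ ENNReal.ofReal (10 * ε) := by
  refine (unif_apply_le _).trans ((mul_le_mul_right hs _).trans_eq ?_)
  rw [← ENNReal.ofReal_inv_of_pos (by norm_num), ← ENNReal.ofReal_mul (by norm_num)]
  norm_num

/-- σ is fixed before τ because the critical interval for τ depends on a load, and hence on which
items are small. -/
lemma lintegral_unif_le {P Q D e : ENNReal} {f : ℝ → ℝ → ENNReal} {S : Set ℝ} {T : ℝ → Set ℝ}
    (hS : MeasurableSet S) (hT : ∀ σ, MeasurableSet (T σ)) (hSe : unif 0 (1 / 10) S ≤ e)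
    (hTe : ∀ σ, unif 0 (1 / 10) (T σ) ≤ e)
    (h : ∀ σ ∈ Set.Icc (0 : ℝ) (1 / 10), ∀ τ ∈ Set.Icc (0 : ℝ) (1 / 10),
      f σ τ ≤ S.indicator 1 σ * P + (Q + D * (T σ).indicator 1 τ)) :
    ∫⁻ σ, ∫⁻ τ, f σ τ ∂unif 0 (1 / 10) ∂unif 0 (1 / 10) ≤ e * P + (Q + D * e) := by
  have hmem : ∀ᵐ s ∂unif 0 (1 / 10), s ∈ Set.Icc (0 : ℝ) (1 / 10) := ae_cond_mem measurableSet_Icc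
  calc _ ≤ ∫⁻ σ, (S.indicator 1 σ * P + (Q + D * e)) ∂unif 0 (1 / 10) := by
        refine lintegral_mono_ae (hmem.mono fun σ hσ => ?_)
        calc _ ≤ ∫⁻ τ, (S.indicator 1 σ * P + (Q + D * (T σ).indicator 1 τ)) ∂unif 0 (1 / 10) :=
              lintegral_mono_ae (hmem.mono fun τ hτ => h σ hσ τ hτ)
          _ = S.indicator 1 σ * P + (Q + D * unif 0 (1 / 10) (T σ)) := by
              rw [lintegral_add_left measurable_const, lintegral_add_left measurable_const,
                lintegral_const_mul _ (measurable_one.indicator (hT σ)),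
                lintegral_indicator_one (hT σ)]
              simp only [lintegral_const, measure_univ, mul_one]
          _ ≤ _ := by gcongr; exact hTe σ
    _ = unif 0 (1 / 10) S * P + (Q + D * e) := by
        rw [lintegral_add_right _ measurable_const,
          lintegral_mul_const _ (measurable_one.indicator hS), lintegral_indicator_one hS]
        simp only [lintegral_const, measure_univ, mul_one]
    _ ≤ _ := by gcongr

lemma l1_sub_update {n : ℕ} {x y : Fin n → ℝ} {i : Fin n} {ε : ℝ} (hε : 0 ≤ ε)
    (hxy : y = Function.update x i (x i + ε)) : l1 (x - y) = ε := by
  subst hxy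
  rw [l1, Finset.sum_eq_single i]
  · simp [abs_of_nonneg hε]
  · intro j _ hj
    simp [hj]
  · simp

section step

variable {n m k : ℕ} {Ω : Type*} [MeasurableSpace Ω] {μ : Measure Ω} [IsProbabilityMeasure μ]
  {α ε : ℝ} {A : Ω → (Fin n → ℝ) → Finset (Fin n)} {x y : Fin n → ℝ} {i : Fin n}
  {L : Finset (Fin n)}

lemma Hashing.one_le_of_fail {H : Hashing n m} {z : Fin n → ℝ} (hz : ∀ j, 0 ≤ z j)
    (hσ : H.σ ∈ Set.Icc (0 : ℝ) (1 / 10)) (hτ : H.τ ∈ Set.Icc (0 : ℝ) (1 / 10))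
    (hL : ∀ j, 1 / 10 < z j → j ∈ L) (h : H.Collision z ∨ H.Heavy z) :
    (1 : ENNReal) ≤ (collisionSet (m ^ 3) L).indicator 1 (H.R, H.C) +
      (heavySet m z).indicator 1 H.bucket := by
  rcases h with h | h
  · have : (H.R, H.C) ∈ collisionSet (m ^ 3) L := mem_collisionSet (fun j hj =>
      hL j (by rw [mem_large] at hj; linarith [hσ.1])) h
    simp [Set.indicator_of_mem this]
  · have := mem_heavySet hz hσ.2 hτ.2 h
    simp [Set.indicator_of_mem this]

/-- An upper bound for the number of failures of the two inputs. -/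
def failBound (x y : Fin n → ℝ) (L : Finset (Fin n)) (R : Fin m → Fin (m ^ 3))
    (C : Fin n → Fin (m ^ 3)) (B : Fin n → Fin m) : ENNReal :=
  (collisionSet (m ^ 3) L).indicator 1 (R, C) + (heavySet m x).indicator 1 B +
    (heavySet m y).indicator 1 B

/-- The bound does not mention σ or τ: `L` contains the large items for every σ, and `heavySet`
admits all items up to 1/5. This lets failure probabilities multiply with those of the events in σ
and τ. -/
lemma Hashing.one_le_failBound {H : Hashing n m} (hx : ∀ j, 0 ≤ x j) (hy : ∀ j, 0 ≤ y j)
    (hxy : ∀ j, x j ≤ y j) (hσ : H.σ ∈ Set.Icc (0 : ℝ) (1 / 10))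
    (hτ : H.τ ∈ Set.Icc (0 : ℝ) (1 / 10)) (hL : ∀ j, 1 / 10 < y j → j ∈ L)
    (h : (H.Collision x ∨ H.Heavy x) ∨ (H.Collision y ∨ H.Heavy y)) :
    1 ≤ failBound x y L H.R H.C H.bucket := by
  rcases h with h | h
  · exact (one_le_of_fail hx hσ hτ (fun j hj => hL j (hj.trans_le (hxy j))) h).trans le_self_add
  · refine (one_le_of_fail hy hσ hτ hL h).trans ?_
    rw [failBound, add_right_comm]
    exact le_self_add

/-- If an item crosses, the first summand pays, with 2k in case of a failure. Otherwise collisions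
are the same for both inputs and heaviness passes from `x` to `y`: neither fails, both fail, or only
`y` does. In the last case a bucket becomes heavy, which places τ in an interval of length ε. -/
lemma Hashing.cost_le_of_step {H : Hashing n m} (hA : IsCorrelatedSampling μ n k α A)
    (hx : x ∈ hypersimplex n k) (hy : y ∈ hypersimplex n k) (hε : 0 < ε)
    (hxy : y = Function.update x i (x i + ε)) (hσ : H.σ ∈ Set.Icc (0 : ℝ) (1 / 10))
    (hτ : H.τ ∈ Set.Icc (0 : ℝ) (1 / 10)) (hL : ∀ j, 1 / 10 < y j → j ∈ L) :
    H.cost x y μ A ≤ (Set.Ico (x i - 1 / 10) (y i - 1 / 10)).indicator 1 H.σ *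
        (ENNReal.ofReal (2 * treeStretch (m ^ 3) + 3) +
          ENNReal.ofReal (2 * k) * failBound x y L H.R H.C H.bucket) +
      (ENNReal.ofReal (treeStretch (m ^ 3) * ε + 2 * ε) +
          ENNReal.ofReal (α * ε) * failBound x y L H.R H.C H.bucket +
        ENNReal.ofReal (2 * k) * (heavySet m y).indicator 1 H.bucket *
          (Set.Ioc (1 - (H.load x (H.bucket i) + ε)) (1 - H.load x (H.bucket i))).indicator 1
            H.τ) := by
  have hx0 : ∀ j, 0 ≤ x j := fun j => (hx.1 j).1
  have hy0 : ∀ j, 0 ≤ y j := fun j => (hy.1 j).1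
  have hF := one_le_failBound hx0 hy0 (step_le hε hxy) hσ hτ hL
  have hK := cost_le hA hx hy hτ.1
  by_cases hcr : x i ≤ 1 / 10 + H.σ ∧ 1 / 10 + H.σ < y i
  · have hmem : H.σ ∈ Set.Ico (x i - 1 / 10) (y i - 1 / 10) :=
      ⟨by linarith [hcr.1], by linarith [hcr.2]⟩
    refine le_trans ?_ le_self_add
    rw [Set.indicator_of_mem hmem, Pi.one_apply, one_mul]
    by_cases h : (H.Collision x ∨ H.Heavy x) ∨ (H.Collision y ∨ H.Heavy y)
    · exact (hK.trans (le_mul_of_one_le_right' (hF h))).trans le_add_self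
    · rw [not_or] at h
      exact (cost_le_of_not_fail hx hy hε hxy hτ.1 h.1 h.2).trans le_self_add
  · refine le_trans ?_ le_add_self
    have hcoll := collision_iff_of_large_eq (large_eq hε hxy hcr)
    by_cases hFy : H.Collision y ∨ H.Heavy y
    · by_cases hFx : H.Collision x ∨ H.Heavy x
      · have := cost_le_of_fail (μ := μ) hA hx hy hFx hFy
        rw [l1_sub_update hε.le hxy] at this
        refine le_trans ?_ le_self_add
        exact (this.trans (le_mul_of_one_le_right' (hF (Or.inl hFx)))).trans le_add_self
      · rw [not_or] at hFx
        have hHy : H.Heavy y := hFy.resolve_left fun h => hFx.1 (hcoll.2 h)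
        refine le_trans ?_ le_add_self
        rw [Set.indicator_of_mem (mem_Ioc_of_heavy hx0 hε hxy hcr hFx.2 hHy),
          Set.indicator_of_mem (mem_heavySet hy0 hσ.2 hτ.2 hHy)]
        simpa using hK
    · have hFx : ¬ (H.Collision x ∨ H.Heavy x) := fun h =>
        hFy (h.imp hcoll.1 (heavy_of_heavy hx0 hε hxy hcr))
      exact ((cost_le_of_not_cross hx hy hε hxy hτ.1 hFx hFy hcr).trans le_self_add).trans
        le_self_add

/-- The expected number of failures of the two inputs is at most this. -/
def failMeasure (m : ℕ) (x y : Fin n → ℝ) (L : Finset (Fin n)) : ENNReal :=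
  (hashLaw m (m ^ 3)).prod (hashLaw n (m ^ 3)) (collisionSet (m ^ 3) L) +
    hashLaw n m (heavySet m x) + hashLaw n m (heavySet m y)

lemma lintegral_failBound [NeZero m] (x y : Fin n → ℝ) (L : Finset (Fin n)) :
    ∫⁻ R, ∫⁻ C, ∫⁻ B, failBound x y L R C B ∂hashLaw n m ∂hashLaw n (m ^ 3) ∂hashLaw m (m ^ 3) =
      failMeasure m x y L := by
  have hc : MeasurableSet (collisionSet (a := m) (m ^ 3) L) := .of_discrete
  have hb : ∀ z, MeasurableSet (heavySet (n := n) m z) := fun z => .of_discrete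
  have hi : ∀ z, Measurable ((heavySet (n := n) m z).indicator (1 : (Fin n → Fin m) → ENNReal))
      := fun z =>
    measurable_one.indicator (hb z)
  have e : ∀ R C, ∫⁻ B, failBound (m := m) x y L R C B ∂hashLaw n m =
      (collisionSet (m ^ 3) L).indicator 1 (R, C) +
        (hashLaw n m (heavySet m x) + hashLaw n m (heavySet m y)) := fun R C => by
    simp only [failBound, add_assoc]
    rw [lintegral_add_left measurable_const, lintegral_add_left (hi x), lintegral_indicator_one
        (hb x),
      lintegral_indicator_one (hb y)]
    simp
  simp only [e, failMeasure, add_assoc]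
  rw [← lintegral_indicator_one hc, lintegral_prod _ (measurable_one.indicator hc).aemeasurable]
  simp only [lintegral_add_right _ measurable_const]
  simp

lemma lintegral_cost_le_of_step [NeZero m] (hA : IsCorrelatedSampling μ n k α A)
    (hx : x ∈ hypersimplex n k) (hy : y ∈ hypersimplex n k) (hε : 0 < ε)
    (hxy : y = Function.update x i (x i + ε)) (hL : ∀ j, 1 / 10 < y j → j ∈ L) :
    ∫⁻ h, Hashing.cost ⟨h.1, h.2.1, h.2.2.1, h.2.2.2.1, h.2.2.2.2⟩ x y μ A ∂hashingLaw n m ≤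
      ENNReal.ofReal (10 * ε) * (ENNReal.ofReal (2 * treeStretch (m ^ 3) + 3) +
          ENNReal.ofReal (2 * k) * failMeasure m x y L) +
      (ENNReal.ofReal (treeStretch (m ^ 3) * ε + 2 * ε) +
          ENNReal.ofReal (α * ε) * failMeasure m x y L +
        ENNReal.ofReal (2 * k) * hashLaw n m (heavySet m y) * ENNReal.ofReal (10 * ε)) := by
  set e := ENNReal.ofReal (10 * ε)
  set a := ENNReal.ofReal (2 * treeStretch (m ^ 3) + 3)
  set K := ENNReal.ofReal (2 * k)
  set c := ENNReal.ofReal (treeStretch (m ^ 3) * ε + 2 * ε)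
  set b := ENNReal.ofReal (α * ε)
  have hyi : y i - 1 / 10 - (x i - 1 / 10) = ε := by rw [hxy]; simp
  calc _ ≤ ∫⁻ R, ∫⁻ C, ∫⁻ B, ∫⁻ σ, ∫⁻ τ, Hashing.cost ⟨R, C, B, σ, τ⟩ x y μ A
        ∂unif 0 (1 / 10) ∂unif 0 (1 / 10) ∂hashLaw n m ∂hashLaw n (m ^ 3) ∂hashLaw m (m ^ 3) := by
        refine (lintegral_prod_le _).trans (lintegral_mono fun R => ?_)
        refine (lintegral_prod_le _).trans (lintegral_mono fun C => ?_)
        refine (lintegral_prod_le _).trans (lintegral_mono fun B => ?_)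
        exact lintegral_prod_le _
    _ ≤ ∫⁻ R, ∫⁻ C, ∫⁻ B, (e * (a + K * failBound x y L R C B) + (c + b * failBound x y L R C B +
          K * (heavySet m y).indicator 1 B * e))
          ∂hashLaw n m ∂hashLaw n (m ^ 3) ∂hashLaw m (m ^ 3) := by
        refine lintegral_mono fun R => lintegral_mono fun C => lintegral_mono fun B => ?_
        -- Loads do not depend on τ, so any value may stand in for it here.
        let load : ℝ → ℝ := fun σ => Hashing.load ⟨R, C, B, σ, 0⟩ x (B i)
        refine lintegral_unif_le (f := fun σ τ => Hashing.cost ⟨R, C, B, σ, τ⟩ x y μ A)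
          (S := Set.Ico (x i - 1 / 10) (y i - 1 / 10))
          (T := fun σ => Set.Ioc (1 - (load σ + ε)) (1 - load σ))
          (P := a + K * failBound x y L R C B) (Q := c + b * failBound x y L R C B)
          (D := K * (heavySet m y).indicator 1 B)
          measurableSet_Ico (fun σ => measurableSet_Ioc)
          (unif_le_of_volume_le ?_) (fun σ => unif_le_of_volume_le ?_)
          fun σ hσ τ hτ => Hashing.cost_le_of_step (H := ⟨R, C, B, σ, τ⟩) hA hx hy hε hxy hσ hτ hL
        · rw [Real.volume_Ico, hyi]
        · rw [Real.volume_Ioc]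
          exact le_of_eq (congrArg _ (by ring))
    _ = ∫⁻ R, ∫⁻ C, ∫⁻ B, ((e * a + c) + ((e * K + b) * failBound x y L R C B +
          K * e * (heavySet m y).indicator 1 B))
          ∂hashLaw n m ∂hashLaw n (m ^ 3) ∂hashLaw m (m ^ 3) := by
        refine lintegral_congr fun R => lintegral_congr fun C => lintegral_congr fun B => ?_
        ring
    _ = (e * a + c) + ((e * K + b) * failMeasure m x y L + K * e * hashLaw n m (heavySet m y)) := by
        have hb : MeasurableSet (heavySet (n := n) m y) := .of_discrete
        rw [← lintegral_failBound, ← lintegral_indicator_one hb]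
        simp only [lintegral_add_left (Measurable.of_discrete), lintegral_const_mul _
            (Measurable.of_discrete), lintegral_const, measure_univ, mul_one]
    _ = _ := by ring

end step

end CorrelatedSampling

end

noncomputable section

namespace CorrelatedSampling

/-! ### Conclusion -/

section conclusion

variable {n k : ℕ} {Ω : Type*} [MeasurableSpace Ω] {μ : Measure Ω} [IsProbabilityMeasure μ]
  {α ε : ℝ} {A : Ω → (Fin n → ℝ) → Finset (Fin n)} {x y : Fin n → ℝ} {i : Fin n}

/-- On input 0 the output is almost surely empty, so the stretch between 0 and `y` is at least 1.
This supplies α ≥ 1, which `2 ≤ k * α` does not give. -/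
lemma one_le_of_isCorrelatedSampling (hA : IsCorrelatedSampling μ n k α A)
    (hy : y ∈ hypersimplex n k) (hpos : 0 < l1 y) : 1 ≤ α := by
  have h0 : (0 : Fin n → ℝ) ∈ hypersimplex n k :=
    (hypersimplex_lower y hy).2 0 (fun _ => le_rfl) fun i => (hy.1 i).1
  have hm := measurable_of_isCorrelatedSampling hA h0
  have h : ENNReal.ofReal (l1 y) ≤ ENNReal.ofReal (α * l1 y) := by
    calc ENNReal.ofReal (l1 y) = ∫⁻ ω, ((A ω y).card : ENNReal) ∂μ := (lintegral_card_eq hA hy).symm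
      _ ≤ ∫⁻ ω, ((A ω 0).card + (symmDiff (A ω 0) (A ω y)).card : ENNReal) ∂μ := by
          refine lintegral_mono fun ω => ?_
          rw [← Nat.cast_add, Nat.cast_le]
          refine (Finset.card_le_card fun j hj => ?_).trans (Finset.card_union_le _ _)
          rw [Finset.mem_union, Finset.mem_symmDiff]
          tauto
      _ = ∫⁻ ω, ((symmDiff (A ω 0) (A ω y)).card : ENNReal) ∂μ := by
          have hc : Measurable fun ω => ((A ω 0).card : ENNReal) := (Measurable.of_discrete
            (f := fun s : Finset (Fin n) => (s.card : ENNReal))).comp hm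
          rw [lintegral_add_left hc, lintegral_card_eq hA h0]
          simp [l1]
      _ ≤ _ := by
          refine (lintegral_symmDiff_le_of_isCorrelatedSampling hA h0 hy).trans_eq ?_
          simp [l1]
  by_contra hα
  rw [not_le] at hα
  exact absurd h (not_le.2 ((ENNReal.ofReal_lt_ofReal_iff hpos).2 (by nlinarith)))

lemma card_filter_lt_le (hy : y ∈ hypersimplex n k) :
    ((Finset.univ.filter fun j => 1 / 10 < y j).card : ℝ) ≤ 10 * k := by
  have h := hy.2
  rw [l1_eq_sum fun j => (hy.1 j).1] at h
  have h1 : ∑ j ∈ Finset.univ.filter (fun j => 1 / 10 < y j), (1 / 10 : ℝ) ≤ ∑ j, y j :=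
    (Finset.sum_le_sum fun j hj => (Finset.mem_filter.1 hj).2.le).trans
      (Finset.sum_le_univ_sum_of_nonneg fun j => (hy.1 j).1)
  rw [Finset.sum_const, nsmul_eq_mul] at h1
  linarith

lemma hashLaw_heavySet_le {m : ℕ} [NeZero m] (hx : x ∈ hypersimplex n k) :
    hashLaw n m (heavySet m x) ≤ ENNReal.ofReal (2 * k ^ 2 / m) := by
  rw [← ofReal_measureReal]
  refine ENNReal.ofReal_le_ofReal ((heavySet_real_le fun j => (hx.1 j).1).trans ?_)
  have h0 : 0 ≤ l1 x := Finset.sum_nonneg fun j _ => abs_nonneg _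
  have := hx.2
  gcongr

lemma prod_collisionSet_le {m : ℕ} [NeZero m] {L : Finset (Fin n)} (hL : L.card ≤ (m : ℝ)) :
    (hashLaw m (m ^ 3)).prod (hashLaw n (m ^ 3)) (collisionSet (m ^ 3) L) ≤
      ENNReal.ofReal (3 / m) := by
  have hm : (0 : ℝ) < m := Nat.cast_pos.2 (NeZero.pos m)
  rw [← ofReal_measureReal]
  refine ENNReal.ofReal_le_ofReal ((collisionSet_real_le L).trans ?_)
  calc ((L.card : ℝ) * L.card + L.card * m + m * m) * (1 / (m ^ 3 : ℕ))
      ≤ (m * m + m * m + m * m) * (1 / (m ^ 3 : ℕ)) := by gcongr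
    _ = 3 / m := by push_cast; field_simp; norm_num

lemma failMeasure_le {m : ℕ} [NeZero m] {L : Finset (Fin n)} (hL : L.card ≤ (m : ℝ))
    (hx : x ∈ hypersimplex n k) (hy : y ∈ hypersimplex n k) :
    failMeasure m x y L ≤ ENNReal.ofReal ((3 + 4 * k ^ 2) / m) := by
  have e : ((3 : ℝ) + 4 * k ^ 2) / m = 3 / m + 2 * k ^ 2 / m + 2 * k ^ 2 / m := by ring
  rw [e, ENNReal.ofReal_add (by positivity) (by positivity),
    ENNReal.ofReal_add (by positivity) (by positivity)]
  exact add_le_add (add_le_add (prod_collisionSet_le hL) (hashLaw_heavySet_le hx))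
    (hashLaw_heavySet_le hy)

lemma lintegral_alg_le_of_step {m : ℕ} [NeZero m] (hA : IsCorrelatedSampling μ n k α A)
    (hx : x ∈ hypersimplex n k) (hy : y ∈ hypersimplex n k) (hε : 0 < ε)
    (hxy : y = Function.update x i (x i + ε)) (hk : 1 ≤ k) (hm : 32 * (k : ℝ) ^ 5 * α ^ 5 ≤ m) :
    ∫⁻ ω, ((symmDiff (alg A ω x) (alg A ω y)).card : ENNReal) ∂algLaw μ n m ≤
      ENNReal.ofReal ((21 * treeStretch (m ^ 3) + 40) * ε) := by
  have hpos : 0 < l1 y := by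
    rw [l1_eq_sum fun j => (hy.1 j).1]
    refine Finset.sum_pos' (fun j _ => (hy.1 j).1) ⟨i, Finset.mem_univ i, ?_⟩
    rw [hxy, Function.update_self]
    linarith [(hx.1 i).1]
  have hα := one_le_of_isCorrelatedSampling hA hy hpos
  have hk' : (1 : ℝ) ≤ k := by exact_mod_cast hk
  have hm0 : (0 : ℝ) < m := Nat.cast_pos.2 (NeZero.pos m)
  have hκ := treeStretch_nonneg (m ^ 3)
  have hk3 : (k : ℝ) ^ 3 * α * 32 ≤ m := by
    refine le_trans ?_ hm
    have h1 : (k : ℝ) ^ 3 ≤ k ^ 5 := pow_le_pow_right₀ hk' (by norm_num)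
    have h2 : α ≤ α ^ 5 := le_self_pow₀ hα (by norm_num)
    have : (k : ℝ) ^ 3 * α ≤ k ^ 5 * α ^ 5 := by gcongr
    linarith
  have hkm : 10 * (k : ℝ) ≤ m := by
    refine le_trans ?_ hk3
    have h1 : (k : ℝ) ≤ k ^ 3 := le_self_pow₀ hk' (by norm_num)
    have : (k : ℝ) * 1 ≤ k ^ 3 * α := by gcongr
    linarith
  set L : Finset (Fin n) := Finset.univ.filter fun j => 1 / 10 < y j
  have hf := failMeasure_le ((card_filter_lt_le hy).trans hkm) hx hy
  have hh := hashLaw_heavySet_le (m := m) hy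
  rw [lintegral_algLaw hA hx hy]
  refine (lintegral_cost_le_of_step (L := L) hA hx hy hε hxy fun j hj => by simpa [L] using
      hj).trans ?_
  refine le_trans (b := ENNReal.ofReal (10 * ε) * (ENNReal.ofReal (2 * treeStretch (m ^ 3) + 3) +
      ENNReal.ofReal (2 * k) * ENNReal.ofReal ((3 + 4 * k ^ 2) / m)) +
      (ENNReal.ofReal (treeStretch (m ^ 3) * ε + 2 * ε) +
          ENNReal.ofReal (α * ε) * ENNReal.ofReal ((3 + 4 * k ^ 2) / m) +
        ENNReal.ofReal (2 * k) * ENNReal.ofReal (2 * k ^ 2 / m) * ENNReal.ofReal (10 * ε)))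
    (by gcongr) ?_
  have hα0 : 0 ≤ α := zero_le_one.trans hα
  rw [← ENNReal.ofReal_mul (by positivity), ← ENNReal.ofReal_mul (by positivity),
    ← ENNReal.ofReal_mul (by positivity), ← ENNReal.ofReal_mul (by positivity),
    ← ENNReal.ofReal_add (by positivity) (by positivity), ← ENNReal.ofReal_mul (by positivity),
    ← ENNReal.ofReal_add (by positivity) (by positivity),
    ← ENNReal.ofReal_add (by positivity) (by positivity),
    ← ENNReal.ofReal_add (by positivity) (by positivity)]
  refine ENNReal.ofReal_le_ofReal ?_
  have hk2 : 1 ≤ (k : ℝ) ^ 2 := one_le_pow₀ hk'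
  have hkα : (k : ℝ) ≤ k * α := le_mul_of_one_le_right (by positivity) hα
  have hαk : α ≤ k * α := le_mul_of_one_le_left hα0 hk'
  -- All contributions of failures. The numerators total at most 187k³α, while m ≥ 32k³α, and 187 ≤
  -- 6·32.
  have key : (20 * k + α) * ((3 + 4 * k ^ 2) / m) + 20 * k * (2 * k ^ 2 / m) ≤ 6 := by
    rw [← mul_div_assoc, ← mul_div_assoc, ← add_div, div_le_iff₀ hm0]
    calc (20 * (k : ℝ) + α) * (3 + 4 * k ^ 2) + 20 * k * (2 * k ^ 2)
        ≤ (21 * (k * α)) * (7 * k ^ 2) + 20 * (k * α) * (2 * k ^ 2) := by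
          gcongr <;> linarith
      _ = 187 * (k ^ 3 * α) := by ring
      _ ≤ 6 * m := by nlinarith
  -- In units of ε, crossing gives 20 times the stretch plus 30, the ordinary step gives the stretch
  -- plus 2, and failures give at most 6.
  nlinarith

/-- log₂ m ≤ 6 + 5 log₂ t, rounding up adds at most 1, and log₂ t ≥ 1 absorbs the constant 7. -/
lemma clog_le_of_le_mul_pow {m : ℕ} {t : ℝ} (ht : 2 ≤ t) (hm : 0 < m) (h : (m : ℝ) ≤ 64 * t ^ 5) :
    (Nat.clog 2 m : ℝ) ≤ 12 * Real.logb 2 t := by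
  have ht0 : 0 < t := by linarith
  have h1 : 1 ≤ Real.logb 2 t := by
    rw [Real.le_logb_iff_rpow_le one_lt_two ht0]; simpa using ht
  have hm0 : (1 : ℝ) ≤ m := by exact_mod_cast hm
  have h2 : Real.logb 2 m ≤ 6 + 5 * Real.logb 2 t := by
    refine (Real.logb_le_logb_of_le one_lt_two (by linarith) h).trans_eq ?_
    rw [Real.logb_mul (by norm_num) (by positivity), Real.logb_pow]
    have : (64 : ℝ) = 2 ^ 6 := by norm_num
    rw [this, Real.logb_pow, Real.logb_self_eq_one one_lt_two]
    norm_num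
  have h3 : (Nat.clog 2 m : ℝ) < Real.logb 2 m + 1 := by
    rw [← Real.natCeil_logb_natCast]
    exact_mod_cast Nat.ceil_lt_add_one (Real.logb_nonneg one_lt_two hm0)
  linarith

lemma treeStretch_le {m : ℕ} {t : ℝ} (ht : 2 ≤ t) (hm : 0 < m) (h : (m : ℝ) ≤ 64 * t ^ 5) :
    treeStretch (m ^ 3) ≤ 145 * Real.logb 2 t := by
  have h1 : 1 ≤ Real.logb 2 t := by
    rw [Real.le_logb_iff_rpow_le one_lt_two (by linarith)]; simpa using ht
  have h2 : Nat.clog 2 (m ^ 3) ≤ 3 * Nat.clog 2 m := by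
    refine Nat.clog_le_of_le_pow ?_
    rw [mul_comm, pow_mul]
    exact Nat.pow_le_pow_left (Nat.le_pow_clog one_lt_two m) 3
  have h3 : (Nat.clog 2 (m ^ 3) : ℝ) ≤ 3 * Nat.clog 2 m := by exact_mod_cast h2
  have h4 := clog_le_of_le_mul_pow ht hm h
  rw [treeStretch]
  linarith

lemma lintegral_alg_le (hkα : 2 ≤ (k : ℝ) * α) (hA : IsCorrelatedSampling μ n k α A)
    (hx : x ∈ hypersimplex n k) (hy : y ∈ hypersimplex n k) :
    ∫⁻ ω, ((symmDiff (alg A ω x) (alg A ω y)).card : ENNReal) ∂algLaw μ n (numBuckets k α) ≤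
      ENNReal.ofReal (4000 * Real.logb 2 (k * α) * l1 (x - y)) := by
  have hk : 1 ≤ k := Nat.one_le_iff_ne_zero.2 fun h => by
    rw [h] at hkα; norm_num at hkα
  have hlog : 1 ≤ Real.logb 2 (k * α) := by
    rw [Real.le_logb_iff_rpow_le one_lt_two (by linarith)]; simpa using hkα
  have ht : (2 : ℝ) ^ 5 * (k : ℝ) ^ 5 * α ^ 5 = 32 * (k * α) ^ 5 := by ring
  have h5 : (1 : ℝ) ≤ (k * α) ^ 5 := one_le_pow₀ (by linarith)
  have hle : 32 * (k : ℝ) ^ 5 * α ^ 5 ≤ numBuckets k α := by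
    refine le_trans (by norm_num) (Nat.le_ceil _)
  have hge : (numBuckets k α : ℝ) ≤ 64 * (k * α) ^ 5 := by
    have := Nat.ceil_lt_add_one (a := (2 : ℝ) ^ 5 * (k : ℝ) ^ 5 * α ^ 5) (by rw [ht]; linarith)
    rw [numBuckets]
    rw [ht] at this ⊢
    linarith
  have hm : 0 < numBuckets k α := Nat.ceil_pos.2 (by rw [ht]; linarith)
  have : NeZero (numBuckets k α) := ⟨hm.ne'⟩
  have hκ := treeStretch_le hkα hm hge
  have hmeas : ∀ z ∈ hypersimplex n k,
      Measurable fun ω : AlgSeed Ω n (numBuckets k α) => alg A ω z := fun z hz =>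
    measurable_alg (measurable_of_isCorrelatedSampling hA hz) fun j => (hz.1 j).1
  refine le_ofReal_l1 (P := hypersimplex n k) (d := fun x y => ∫⁻ ω,
    ((symmDiff (alg A ω x) (alg A ω y)).card : ENNReal) ∂algLaw μ n (numBuckets k α))
    hypersimplex_lower (by positivity) (fun z _ => by simp) (fun z _ w _ => by
      simp only [symmDiff_comm]) (fun z hz w hw v _ => lintegral_symmDiff_triangle (hmeas z hz)
        (hmeas w hw)) (fun z hz w hw j δ hδ hzw => ?_) hx hy
  refine (lintegral_alg_le_of_step hA hz hw hδ hzw hk hle).trans (ENNReal.ofReal_le_ofReal ?_)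
  -- The constants combine to 21·145 + 40 = 3085 ≤ 4000, using log₂(kα) ≥ 1.
  gcongr
  linarith

end conclusion

end CorrelatedSampling

end

open CorrelatedSampling

theorem mainTheorem2 :
    ∃ c : ℝ, 0 < c ∧
      ∀ (n k : ℕ) (α : ℝ), 2 ≤ (k : ℝ) * α →
      ∀ (Ω : Type*) [MeasurableSpace Ω] (μ : Measure Ω) [IsProbabilityMeasure μ]
        (A : Ω → (Fin n → ℝ) → Finset (Fin n)), IsCorrelatedSampling μ n k α A →
      ∀ x ∈ hypersimplex n k, ∀ y ∈ hypersimplex n k,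
        Integrable
          (fun ω : AlgSeed Ω n (numBuckets k α) => ((symmDiff (alg A ω x) (alg A ω y)).card : ℝ))
          (algLaw μ n (numBuckets k α)) ∧
        ∫ ω : AlgSeed Ω n (numBuckets k α), ((symmDiff (alg A ω x) (alg A ω y)).card : ℝ)
            ∂(algLaw μ n (numBuckets k α)) ≤
          c * (Real.logb 2 k + Real.logb 2 α) * l1 (x - y) := by
  refine ⟨4000, by norm_num, fun n k α hkα Ω _ μ _ A hA x hx y hy => ?_⟩
  have hk : (k : ℝ) ≠ 0 := fun h => by rw [h] at hkα; norm_num at hkα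
  have hα : α ≠ 0 := fun h => by rw [h] at hkα; norm_num at hkα
  have hm : NeZero (numBuckets k α) := ⟨(Nat.ceil_pos.2 (by
    rw [show (2 : ℝ) ^ 5 * (k : ℝ) ^ 5 * α ^ 5 = 32 * (k * α) ^ 5 by ring]; positivity)).ne'⟩
  have hle := lintegral_alg_le hkα hA hx hy
  rw [← Real.logb_mul hk hα]
  have hmeas : Measurable fun ω : AlgSeed Ω n (numBuckets k α) =>
      ((symmDiff (alg A ω x) (alg A ω y)).card : ENNReal) := measurable_card_symmDiff
    (measurable_alg (measurable_of_isCorrelatedSampling hA hx) fun i => (hx.1 i).1)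
    (measurable_alg (measurable_of_isCorrelatedSampling hA hy) fun i => (hy.1 i).1)
  have hint := integrable_toReal_of_lintegral_ne_top hmeas.aemeasurable
    (hle.trans_lt ENNReal.ofReal_lt_top).ne
  have hlog : 0 ≤ Real.logb 2 (k * α) := Real.logb_nonneg one_lt_two (by linarith)
  have hl1 : 0 ≤ l1 (x - y) := Finset.sum_nonneg fun _ _ => abs_nonneg _
  simp only [ENNReal.toReal_natCast] at hint
  refine ⟨hint, ?_⟩
  rw [integral_eq_lintegral_of_nonneg_ae (ae_of_all _ fun _ => Nat.cast_nonneg _)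
    hint.aestronglyMeasurable]
  simp only [ENNReal.ofReal_natCast]
  exact ENNReal.toReal_le_of_le_ofReal (by positivity) hle
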